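/- **Theorem 4.2.** Let $G$ be a connected simple graph with $n\ge 1$ nodes and connectivity $k$ (the least number of nodes whose removal leaves a graph that is disconnected or has at most one node), with a color palette, i.e. a multiset of $n-1$ colors. (If $n=1$, so $k=0$, expressions such as $k-1$ below are read as $0$; likewise for one-node cores.) *Tubings and cores.* A tube is a nonempty proper subset of nodes inducing a connected subgraph; two tubes are compatible if one properly contains the other, or they are disjoint and not joined by an edge; a tubing is a set of pairwise compatible tubes. The universal tube is the whole node set; it is not a tube of any tubing. For a tubing $T$ and $t\in T$ or $t$ universal, the core $G_t(T)$ is the graph on the nodes of $t$ lying in no tube $t'\subsetneq t$ of $T$, two of them being adjacent if they are adjacent in $G$ or are joined by a path through some such $t'$. *Templates.* A color template $(T,\mathcal O)$ is a tubing $T$ with a partition $\mathcal O$ of the palette amongst the tubes of $T$ and the universal tube. With $k_t$ the connectivity of $G_t(T)$, the tube $t$ receives $|G_t(T)|$ colors: the color of $t$, then an ordered list of $k_t-1$ outer block colors, then an unordered multiset (the inner block) of the remaining $|G_t(T)|-k_t$ colors ($0$ colors for a one-node core). The universal tube is treated in the same way, except that it has no color of its own, and so receives one color less. *Order.* Let $T=T'\cup\{t\}$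 with $t\notin T'$, and let $t_*$ be the smallest tube of $T'$, or the universal tube, that properly contains $t$. A listing of the colors of a tube is the sequence of its own color (if any), its outer block colors in order, and its inner block colors in any order. Put $(T,\mathcal O)\prec(T',\mathcal O')$ if all blocks of tubes other than $t,t_*$ agree and there are listings $\ell_1$ of $t_*$ and $\ell_2$ of $t$ in $\mathcal O$ whose concatenation $\ell_1\ell_2$ is a listing of $t_*$ in $\mathcal O'$. The compatibility order on color templates is the reflexive-transitive closure of this relation. The colorful graph associahedron is the collection of the connected components of this poset, a least face (of rank $-1$) being adjoined to each component. *Abstract polytopes.* A poset is an abstract polytope of rank $d$ if it has a least and a greatest face; every flag (maximal chain) has exactly $d+2$ faces; any two flags $\Phi,\Psi$ are joined by a sequence of flags, consecutive ones differing in exactly one face, all containing $\Phi\cap\Psi$; and any two incident faces of ranks $j-1$ and $j+1$ have exactly two faces strictly between them. It is simple if for each vertex (face of rank $0$) $v$ the poset of faces $\ge v$ is isomorphic to the lattice of subsets of a $d$-element set. **Claim.** Every poset in the collection is a simple abstract polytope of rank $n-1$. Moreover, the posets in the collection are in bijection with the distinct ordered lists of $k-1$ colors from the palette (each color used at most as often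 as it occurs in the palette): the greatest face of each poset is a template with $T=\emptyset$, and the corresponding list is the coloring of the outer blocks of its universal tube. -/

import Mathlib

namespace ColorfulGA

/-! ### Abstract polytopes -/

section Polytope

/-- Two flags (maximal chains) are adjacent if they differ in precisely one face. -/
def FlagAdjacent {P : Type*} [PartialOrder P] (Φ Ψ : Flag P) : Prop :=
  ((Φ : Set P) \ (Ψ : Set P)).ncard = 1 ∧ ((Ψ : Set P) \ (Φ : Set P)).ncard = 1

/-- Any two flags `Φ`, `Ψ` are joined by a sequence of successively adjacent flags, all of which
contain `Φ ∩ Ψ`. -/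
def StronglyFlagConnected (P : Type*) [PartialOrder P] : Prop :=
  ∀ Φ Ψ : Flag P, Relation.ReflTransGen
    (fun A B : Flag P => FlagAdjacent A B ∧ (Φ : Set P) ∩ (Ψ : Set P) ⊆ (B : Set P)) Φ Ψ

/-- Abstract polytopes of rank `d`. The least face has rank `-1`, so the rank of a face `f` is
`Order.height f - 1`. -/
structure IsAbstractPolytope (P : Type*) [PartialOrder P] (d : ℕ) : Prop where
  exists_least : ∃ a : P, IsLeast Set.univ a
  exists_greatest : ∃ b : P, IsGreatest Set.univ b
  card_flag : ∀ Φ : Flag P, (Φ : Set P).encard = ((d + 2 : ℕ) : ℕ∞)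
  stronglyFlagConnected : StronglyFlagConnected P
  diamond : ∀ f h : P, f < h → Order.height h = Order.height f + 2 → (Set.Ioo f h).ncard = 2

/-- Simple abstract polytopes of rank `d`: every vertex-figure is a `(d-1)`-simplex, i.e. the faces
above any vertex (face of rank `0`) form a Boolean lattice with `d` atoms. -/
structure IsSimpleAbstractPolytope (P : Type*) [PartialOrder P] (d : ℕ) : Prop extends
    IsAbstractPolytope P d where
  vertexFigure : ∀ v : P, Order.height v = 1 → Nonempty (Set.Ici v ≃o Finset (Fin d))

end Polytope

/-! ### Tubes, tubings, connectivity and cores -/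

section Graphs

variable {V : Type*}

/-- Vertex connectivity: the least size of a set of nodes whose removal leaves a graph that is
disconnected or has at most one node. Thus the complete graph on `m ≥ 1` nodes has
connectivity `m - 1`. -/
noncomputable def connectivity [Fintype V] (H : SimpleGraph V) : ℕ :=
  sInf {k : ℕ | ∃ S : Finset V, S.card = k ∧
    (¬ (H.induce {v : V | v ∉ S}).Connected ∨ Fintype.card V ≤ k + 1)}

/-- A tube: a proper (nonempty) set of nodes whose induced graph is connected. -/
def IsTube [Fintype V] (G : SimpleGraph V) (t : Finset V) : Prop :=
  t ≠ Finset.univ ∧ (G.induce {v : V | v ∈ t}).Connected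

/-- One tube properly contains the other, or they are disjoint and not joined by an edge. -/
def TubesCompatible (G : SimpleGraph V) (s t : Finset V) : Prop :=
  s ⊂ t ∨ t ⊂ s ∨ (Disjoint s t ∧ ∀ a ∈ s, ∀ b ∈ t, ¬ G.Adj a b)

/-- A tubing: a set of pairwise compatible tubes. -/
def IsTubing [Fintype V] (G : SimpleGraph V) (T : Finset (Finset V)) : Prop :=
  (∀ t ∈ T, IsTube G t) ∧ ∀ s ∈ T, ∀ t ∈ T, s ≠ t → TubesCompatible G s t

variable [DecidableEq V]

/-- Nodes of the core of `t` in `T`: those nodes of `t` that lie in no tube `s ⊂ t` of `T`.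
For the universal tube take `t = univ`. -/
def coreNodes (T : Finset (Finset V)) (t : Finset V) : Finset V :=
  t.filter (fun v => ∀ s ∈ T, s ⊂ t → v ∉ s)

/-- The core graph of `t` in `T`: distinct core nodes are adjacent if they are adjacent in `G`, or
if they are joined by a path of `G` through some tube `s ⊂ t` of `T` (as `s` is connected, this
means that both have a neighbour in `s`). -/
def coreGraph (G : SimpleGraph V) (T : Finset (Finset V)) (t : Finset V) :
    SimpleGraph {v : V // v ∈ coreNodes T t} where
  Adj a b := a ≠ b ∧ (G.Adj a b ∨
    ∃ s ∈ T, s ⊂ t ∧ (∃ x ∈ s, G.Adj a x) ∧ (∃ y ∈ s, G.Adj b y))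
  symm := ⟨fun _ _ h => ⟨h.1.symm, h.2.elim (fun e => Or.inl e.symm)
    (fun ⟨s, hs, hst, hx, hy⟩ => Or.inr ⟨s, hs, hst, hy, hx⟩)⟩⟩
  loopless := ⟨fun _ h => h.1 rfl⟩

end Graphs

/-! ### Color templates -/

/-- The color blocks attached to a tube: the color of the tube (absent for the universal tube), the
ordered list of the colors in the outer blocks, and the unordered inner block. -/
@[ext]
structure Blocks (α : Type*) where
  color : Option α
  outer : List α
  inner : Multiset α

namespace Blocks

variable {α : Type*}

/-- The blocks of something that is not a tube of the tubing. -/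
def empty : Blocks α := ⟨none, [], 0⟩

/-- All colors of the blocks. -/
def colors (b : Blocks α) : Multiset α :=
  (b.color.toList : Multiset α) + (b.outer : Multiset α) + b.inner

/-- `l` lists the colors of `b` in an order that respects the blocks: the first block, then the
outer blocks in their order, then the inner block in an arbitrary order. -/
def IsListing (b : Blocks α) (l : List α) : Prop :=
  ∃ i : List α, (i : Multiset α) = b.inner ∧ l = b.color.toList ++ b.outer ++ i

end Blocks

section Templates

variable {V α : Type*} [Fintype V] [DecidableEq V]

/-- A color template of the graph `G` with palette `c`: a tubing with a partition of the palette
amongst its tubes and the universal tube `univ`. The blocks of a tube consist of its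
color (except for the universal tube, which is uncolored), `k - 1` outer blocks, where `k` is the
connectivity of its core, and an inner block that takes the remaining colors, the
total being the number of core nodes (one less for the universal tube). -/
@[ext]
structure ColorTemplate (G : SimpleGraph V) (c : Multiset α) where
  tubing : Finset (Finset V)
  blocks : Finset V → Blocks α
  isTubing : IsTubing G tubing
  color_isSome : ∀ t, (blocks t).color.isSome ↔ t ∈ tubing
  outer_length : ∀ t ∈ insert Finset.univ tubing,
    (blocks t).outer.length = connectivity (coreGraph G tubing t) - 1
  card_blocks : ∀ t ∈ insert Finset.univ tubing,
    1 + (blocks t).outer.length + (blocks t).inner.card = (coreNodes tubing t).card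
  blocks_eq_empty : ∀ t, t ∉ insert Finset.univ tubing → blocks t = Blocks.empty
  sum_colors : ∑ t ∈ insert Finset.univ tubing, (blocks t).colors = c

namespace ColorTemplate

variable {G : SimpleGraph V} {c : Multiset α}

/-- `x` is compatible with `y` and arises from it by adding one tube `t`. Here `u` is the smallest
tube (possibly the universal one) properly containing `t`. The colors of `u` in `y` are split: in an
order respecting the blocks of `y`, the first of them are the colors of `u` in `x` and the
others are the colors of `t` in `x`, both again in an order respecting their blocks. All
other blocks are unchanged. -/
def AddTube (x y : ColorTemplate G c) : Prop :=
  ∃ t u : Finset V, t ∉ y.tubing ∧ x.tubing = insert t y.tubing ∧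
    u ∈ insert Finset.univ y.tubing ∧ t ⊂ u ∧
    (∀ w ∈ insert Finset.univ y.tubing, t ⊂ w → u ⊆ w) ∧
    (∀ s, s ≠ t → s ≠ u → x.blocks s = y.blocks s) ∧
    ∃ l₁ l₂ : List α, (x.blocks u).IsListing l₁ ∧ (x.blocks t).IsListing l₂ ∧
      (y.blocks u).IsListing (l₁ ++ l₂)

theorem eq_or_card_lt {x y : ColorTemplate G c} (h : Relation.ReflTransGen AddTube x y) :
    x = y ∨ y.tubing.card < x.tubing.card := by
  induction h with
  | refl => exact Or.inl rfl
  | @tail b z _ hbz ih =>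
    obtain ⟨t, _, ht, hx, -⟩ := hbz
    have h1 : b.tubing.card = z.tubing.card + 1 := by
      rw [hx, Finset.card_insert_of_notMem ht]
    rcases ih with rfl | ih
    · right; omega
    · right; omega

/-- Compatibility of color templates: adding tubes iteratively. -/
instance : PartialOrder (ColorTemplate G c) where
  le x y := Relation.ReflTransGen AddTube x y
  le_refl _ := Relation.ReflTransGen.refl
  le_trans _ _ _ h h' := Relation.ReflTransGen.trans h h'
  le_antisymm x y h h' := by
    rcases eq_or_card_lt h with e | e
    · exact e
    · rcases eq_or_card_lt h' with e' | e'
      · exact e'.symm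
      · omega

end ColorTemplate

/-- The connected components of the poset of color templates (the classes of the equivalence
relation generated by comparability): they index the posets in the collection. -/
def Component (G : SimpleGraph V) (c : Multiset α) : Type _ :=
  Quot (fun x y : ColorTemplate G c => x ≤ y)

/-- The color templates in a component, ordered by compatibility. -/
abbrev Component.Templates {G : SimpleGraph V} {c : Multiset α} (C : Component G c) : Type _ :=
  {x : ColorTemplate G c // Quot.mk _ x = C}

/-- The poset of the collection belonging to a component: its color templates, together with a least
face of rank `-1`. -/
abbrev Component.FacePoset {G : SimpleGraph V} {c : Multiset α} (C : Component G c) : Type _ :=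
  WithBot C.Templates

end Templates

end ColorfulGA

set_option linter.unusedSectionVars false

/-! Removing a tube `t` merges its core with the core of its parent `u` and appends the colors of
`t` to those of `u`. Two inequalities between the connectivities of the cores, `sep_parent_le` and
`sep_parent_le_add`, show that the result does not depend on the chosen listings (`addTube_iff`); a
third one, `sep_siblings_le`, shows that removals commute (`Removes.comm`). Hence the templates
above a given one form the Boolean lattice of the subsets of its tubing (`le_of_le_of_subset`,
`exists_ge_of_subset`). This yields the vertex figures, the ranks and the diamonds above a template.
It also yields exactly one tubeless template in each component. Such a template is determined by its
outer colors, as the inner block is the rest of the palette; this is the bijection `componentEquiv`.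

What remains concerns the faces below a template. A vertex, having `n - 1` tubes, is a node order
together with a coloring of all nodes but the first: the tube of a node is its component once the
earlier nodes are deleted (`tubeOf`), and all cores are single nodes. A vertex lies below `y` iff
its order yields all tubes of `y` and its colors, read along each core of `y`, list the blocks there
(`Realizes.le_iff`). An edge has one core of two nodes, and its two vertices differ in which of
these stays in the core (`exists_lt_iff`).

Strong flag connectivity reduces to connectivity of sections (`IsRanking.stronglyFlagConnected`).
The one hard case is a section over the least face: any two vertices below `y` must be joined by
flips through edges below `y` (`reflTransGen_flip_of_le`). Sorting by adjacent swaps brings both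
vertices to a common node order. Then the colors within each core of `y` have to be matched. If the
inner block has at most one color, they agree already. Otherwise the core is listed with a minimum
separator in front, of size `k`. The separator takes the color of the tube and the `k - 1` outer
colors, so only the colors on the remaining nodes are free. These nodes fall into two sides without
paths between them, and by minimality the last separator node `b` is linked to both. The sides can
be shuffled at no cost, and moving `b` behind one node of each side permits the exchange of their
colors (`Realizes.crossSwap`). Exchanges across the sides generate all rearrangements. -/

namespace ColorfulGA

/-! ### Paths inside a set of nodes. -/

section Joined

variable {V : Type*} {G : SimpleGraph V} {A B K : Set V} {a b c : V}

/-- `a` and `b` are joined by a path of `G` inside `A`. -/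
def Joined (G : SimpleGraph V) (A : Set V) (a b : V) : Prop :=
  a ∈ A ∧ Relation.ReflTransGen (fun x y => G.Adj x y ∧ y ∈ A) a b

namespace Joined

theorem refl (h : a ∈ A) : Joined G A a a := ⟨h, .refl⟩

theorem mem_right (h : Joined G A a b) : b ∈ A := by
  rcases h.2.cases_tail with e | ⟨c, _, _, hb⟩
  · exact e ▸ h.1
  · exact hb

theorem tail (h : Joined G A a b) (hb : G.Adj b c) (hc : c ∈ A) : Joined G A a c :=
  ⟨h.1, h.2.tail ⟨hb, hc⟩⟩

theorem trans (h : Joined G A a b) (h' : Joined G A b c) : Joined G A a c :=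
  ⟨h.1, h.2.trans h'.2⟩

theorem of_adj (ha : a ∈ A) (hb : b ∈ A) (h : G.Adj a b) : Joined G A a b :=
  (refl ha).tail h hb

theorem symm (h : Joined G A a b) : Joined G A b a := by
  obtain ⟨ha, h⟩ := h
  induction h with
  | refl => exact refl ha
  | @tail c d hc hd ih =>
    exact (of_adj hd.2 (mem_right ⟨ha, hc⟩) hd.1.symm).trans ih

theorem mono (hAB : A ⊆ B) (h : Joined G A a b) : Joined G B a b :=
  ⟨hAB h.1, Relation.ReflTransGen.mono (fun _ _ h => ⟨h.1, hAB h.2⟩) _ _ h.2⟩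

/-- A path inside `A` cannot leave a set that absorbs all neighbours in `A`. -/
theorem of_closed (hK : ∀ x ∈ K, ∀ y ∈ A, G.Adj x y → y ∈ K) (h : Joined G A a b) (ha : a ∈ K) :
    Joined G K a b := by
  obtain ⟨hA, h⟩ := h
  induction h with
  | refl => exact refl ha
  | tail _ hd ih => exact ih.tail hd.1 (hK _ ih.mem_right _ hd.2 hd.1)

end Joined

/-- `Joined` keeps all nodes in `V`, so that the set `A` may vary freely within an argument; this
ties it to induced graphs. -/
theorem reachable_induce_iff {a b : A} :
    (G.induce A).Reachable a b ↔ Joined G A a b := by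
  constructor
  · intro h
    rw [SimpleGraph.reachable_iff_reflTransGen] at h
    induction h with
    | refl => exact .refl a.2
    | @tail c d _ hd ih => exact ih.tail hd d.2
  · rintro ⟨ha, h⟩
    suffices ∀ c, Relation.ReflTransGen (fun x y => G.Adj x y ∧ y ∈ A) a c →
        ∀ hc : c ∈ A, (G.induce A).Reachable a ⟨c, hc⟩ from this b h b.2
    intro c h
    induction h with
    | refl => exact fun _ => .refl _
    | @tail c d hc hd ih =>
      intro hd'
      have hcA : c ∈ A := Joined.mem_right ⟨ha, hc⟩
      refine (ih hcA).trans (SimpleGraph.Adj.reachable ?_)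
      exact hd.1

theorem connected_induce_iff :
    (G.induce A).Connected ↔ A.Nonempty ∧ ∀ a ∈ A, ∀ b ∈ A, Joined G A a b := by
  rw [SimpleGraph.connected_iff]
  constructor
  · rintro ⟨h, ⟨⟨a, ha⟩⟩⟩
    exact ⟨⟨a, ha⟩, fun a ha b hb => reachable_induce_iff.1 (h ⟨a, ha⟩ ⟨b, hb⟩)⟩
  · rintro ⟨⟨a, ha⟩, h⟩
    exact ⟨fun a b => reachable_induce_iff.2 (h a a.2 b b.2), ⟨⟨a, ha⟩⟩⟩

theorem joined_univ (hG : G.Connected) (a b : V) : Joined G Set.univ a b := by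
  refine ⟨trivial, ?_⟩
  have h := hG.preconnected a b
  rw [SimpleGraph.reachable_iff_reflTransGen] at h
  exact Relation.ReflTransGen.mono (fun _ _ h => ⟨h, trivial⟩) _ _ h

variable [Fintype V]

open Classical in
/-- The nodes joined to `a` inside `A`. -/
noncomputable def comp (G : SimpleGraph V) (A : Set V) (a : V) : Finset V :=
  Finset.univ.filter fun b => Joined G A a b

theorem mem_comp : b ∈ comp G A a ↔ Joined G A a b := by simp [comp]

/-- A path inside `A` that starts in the component cannot leave it, so the component is connected in
itself. This is what makes `tubeOf` a tube. -/
theorem joined_comp (hb : b ∈ comp G A a) (hc : c ∈ comp G A a) :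
    Joined G (comp G A a : Set V) b c := by
  rw [mem_comp] at hb hc
  exact (hb.symm.trans hc).of_closed (K := (comp G A a : Set V)) (fun x hx y hy h => by
    rw [Finset.mem_coe, mem_comp] at hx ⊢
    exact hx.tail h hy) (by rwa [Finset.mem_coe, mem_comp])

theorem comp_eq_of_joined (h : Joined G A a b) : comp G A a = comp G A b := by
  ext c
  rw [mem_comp, mem_comp]
  exact ⟨fun h' => h.symm.trans h', fun h' => h.trans h'⟩

end Joined

/-! ### Nesting in a tubing: homes, cores and parents. -/

section Tubings

variable {V : Type*} [Fintype V] {G : SimpleGraph V} {T : Finset (Finset V)} {s t u w : Finset V}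

theorem isTube_iff :
    IsTube G t ↔ t ≠ Finset.univ ∧ t.Nonempty ∧ ∀ a ∈ t, ∀ b ∈ t, Joined G (t : Set V) a b := by
  rw [IsTube, connected_induce_iff]
  rfl

theorem TubesCompatible.symm (h : TubesCompatible G s t) : TubesCompatible G t s := by
  rcases h with h | h | ⟨h, h'⟩
  · exact .inr (.inl h)
  · exact .inl h
  · exact .inr (.inr ⟨h.symm, fun a ha b hb e => h' b hb a ha e.symm⟩)

theorem IsTubing.mono {T' : Finset (Finset V)} (h : IsTubing G T) (hT : T' ⊆ T) : IsTubing G T' :=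
  ⟨fun t ht => h.1 t (hT ht), fun s hs t ht => h.2 s (hT hs) t (hT ht)⟩

variable [DecidableEq V]

theorem IsTubing.univ_notMem (hT : IsTubing G T) : Finset.univ ∉ T := fun h => (hT.1 _ h).1 rfl

theorem IsTubing.ssubset_univ (hT : IsTubing G T) (h : t ∈ T) : t ⊂ Finset.univ :=
  Finset.ssubset_univ_iff.2 (hT.1 _ h).1

theorem IsTubing.compatible (hT : IsTubing G T) (hs : s ∈ insert Finset.univ T)
    (ht : t ∈ insert Finset.univ T) (hst : s ≠ t) : TubesCompatible G s t := by
  rw [Finset.mem_insert] at hs ht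
  rcases hs with rfl | hs
  · rcases ht with rfl | ht
    · exact absurd rfl hst
    · exact .inr (.inl (hT.ssubset_univ ht))
  · rcases ht with rfl | ht
    · exact .inl (hT.ssubset_univ hs)
    · exact hT.2 s hs t ht hst

theorem IsTubing.nested (hT : IsTubing G T) (hs : s ∈ insert Finset.univ T)
    (ht : t ∈ insert Finset.univ T) {v : V} (hvs : v ∈ s) (hvt : v ∈ t) : s ⊆ t ∨ t ⊂ s := by
  by_cases hst : s = t
  · exact .inl hst.subset
  · rcases hT.compatible hs ht hst with h | h | h
    · exact .inl h.subset
    · exact .inr h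
    · exact absurd hvt (Finset.disjoint_left.1 h.1 hvs)

/-- Compatibility leaves no other choice: `p` rules out `s ⊆ t`, and the edge rules out that `s` and
`t` are remote. -/
theorem IsTubing.ssubset_of_adj (hT : IsTubing G T) (hs : s ∈ insert Finset.univ T)
    (ht : t ∈ insert Finset.univ T) {p r : V} (hps : p ∈ s) (hpt : p ∉ t) (hr : r ∈ t)
    (h : G.Adj p r) : t ⊂ s := by
  rcases hT.compatible hs ht (by rintro rfl; exact hpt hps) with h' | h' | h'
  · exact absurd (h'.subset hps) hpt
  · exact h'
  · exact absurd h (h'.2 p hps r hr)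

theorem IsTubing.nonempty (hT : IsTubing G T) (ht : t ∈ T) : t.Nonempty :=
  (isTube_iff.1 (hT.1 t ht)).2.1

theorem IsTubing.joined (hG : G.Connected) (hT : IsTubing G T) (ht : t ∈ insert Finset.univ T)
    {a b : V} (ha : a ∈ t) (hb : b ∈ t) : Joined G (t : Set V) a b := by
  rw [Finset.mem_insert] at ht
  rcases ht with rfl | ht
  · simpa using joined_univ hG a b
  · exact (isTube_iff.1 (hT.1 t ht)).2.2 a ha b hb

/-- The smallest member of `T` or the universal tube that contains the node. -/
def home (T : Finset (Finset V)) (v : V) : Finset V :=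
  Finset.univ.filter fun w => ∀ s ∈ T, v ∈ s → w ∈ s

theorem mem_home (T : Finset (Finset V)) (v : V) : v ∈ home T v := by
  simp [home]

theorem home_subset {v : V} (ht : t ∈ insert Finset.univ T) (hv : v ∈ t) : home T v ⊆ t := by
  intro w hw
  rw [Finset.mem_insert] at ht
  rcases ht with rfl | ht
  · exact Finset.mem_univ _
  · exact (Finset.mem_filter.1 hw).2 t ht hv

theorem exists_min_of_chain {F : Finset (Finset V)} (hF : F.Nonempty)
    (h : ∀ s ∈ F, ∀ t ∈ F, s ⊆ t ∨ t ⊆ s) : ∃ u ∈ F, ∀ w ∈ F, u ⊆ w := by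
  obtain ⟨u, hu, hmin⟩ := F.exists_min_image Finset.card hF
  refine ⟨u, hu, fun w hw => ?_⟩
  rcases h u hu w hw with h | h
  · exact h
  · exact (Finset.eq_of_subset_of_card_le h (hmin w hw)).symm.subset

/-- The members that contain `v` form a chain, so their intersection is the smallest of them. -/
theorem IsTubing.home_mem (hT : IsTubing G T) (v : V) : home T v ∈ insert Finset.univ T := by
  obtain ⟨u, hu, hmin⟩ := exists_min_of_chain
    (F := (insert Finset.univ T).filter (v ∈ ·)) ⟨Finset.univ, by simp⟩ (by
      intro s hs t ht
      rw [Finset.mem_filter] at hs ht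
      exact (hT.nested hs.1 ht.1 hs.2 ht.2).imp_right fun h => h.subset)
  rw [Finset.mem_filter] at hu
  have : home T v = u := by
    refine (home_subset hu.1 hu.2).antisymm fun w hw => ?_
    rw [home, Finset.mem_filter]
    exact ⟨Finset.mem_univ _, fun s hs hv => hmin s (by simp [hs, hv]) hw⟩
  exact this ▸ hu.1

theorem mem_coreNodes {v : V} : v ∈ coreNodes T t ↔ v ∈ t ∧ ∀ s ∈ T, s ⊂ t → v ∉ s := by
  simp [coreNodes]

theorem coreNodes_subset : coreNodes T t ⊆ t :=
  fun _ hv => (mem_coreNodes.1 hv).1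

/-- The cores are the fibres of `home T`; hence they partition the nodes. -/
theorem IsTubing.mem_coreNodes_iff (hT : IsTubing G T) (ht : t ∈ insert Finset.univ T) {v : V} :
    v ∈ coreNodes T t ↔ home T v = t := by
  rw [mem_coreNodes]
  constructor
  · rintro ⟨hv, h⟩
    by_contra hne
    have hss := (home_subset ht hv).ssubset_of_ne hne
    have hm := hT.home_mem v
    rw [Finset.mem_insert] at hm
    rcases hm with hm | hm
    · rw [hm] at hss
      exact hss.2 (Finset.subset_univ _)
    · exact h _ hm hss (mem_home T v)
  · rintro rfl
    exact ⟨mem_home T v, fun s hs hss hv =>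
      hss.2 (home_subset (Finset.mem_insert_of_mem hs) hv)⟩

theorem IsTubing.disjoint_coreNodes (hT : IsTubing G T) (hs : s ∈ insert Finset.univ T)
    (ht : t ∈ insert Finset.univ T) (hst : s ≠ t) :
    Disjoint (coreNodes T s) (coreNodes T t) := by
  rw [Finset.disjoint_left]
  intro v hv hv'
  rw [hT.mem_coreNodes_iff hs] at hv
  rw [hT.mem_coreNodes_iff ht] at hv'
  exact hst (hv.symm.trans hv')

theorem IsTubing.biUnion_coreNodes (hT : IsTubing G T) :
    (insert Finset.univ T).biUnion (coreNodes T) = Finset.univ := by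
  ext v
  simp only [Finset.mem_biUnion, Finset.mem_univ, iff_true]
  exact ⟨_, hT.home_mem v, (hT.mem_coreNodes_iff (hT.home_mem v)).2 rfl⟩

theorem IsTubing.sum_card_coreNodes (hT : IsTubing G T) :
    ∑ t ∈ insert Finset.univ T, (coreNodes T t).card = Fintype.card V := by
  rw [← Finset.card_biUnion, hT.biUnion_coreNodes, Finset.card_univ]
  exact fun s hs t ht => hT.disjoint_coreNodes hs ht

/-- `u` is the smallest member of `T` or the universal tube that properly contains `t`. -/
def IsParent (T : Finset (Finset V)) (t u : Finset V) : Prop :=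
  u ∈ insert Finset.univ T ∧ t ⊂ u ∧ ∀ w ∈ insert Finset.univ T, t ⊂ w → u ⊆ w

theorem IsParent.unique (h : IsParent T t u) (h' : IsParent T t w) : u = w :=
  (h.2.2 _ h'.1 h'.2.1).antisymm (h'.2.2 _ h.1 h.2.1)

theorem IsTubing.exists_parent (hT : IsTubing G T) (ht : t ∈ T) : ∃ u, IsParent T t u := by
  obtain ⟨v, hv⟩ := hT.nonempty ht
  obtain ⟨u, hu, hmin⟩ := exists_min_of_chain
    (F := (insert Finset.univ T).filter (t ⊂ ·)) ⟨Finset.univ, by simp [hT.ssubset_univ ht]⟩ (by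
      intro s hs t' ht'
      rw [Finset.mem_filter] at hs ht'
      exact (hT.nested hs.1 ht'.1 (hs.2.subset hv) (ht'.2.subset hv)).imp_right
        fun h => h.subset)
  rw [Finset.mem_filter] at hu
  exact ⟨u, hu.1, hu.2, fun w hw htw => hmin w (by simpa [htw] using hw)⟩

theorem isParent_insert : IsParent (insert t T) t u ↔ IsParent T t u := by
  simp only [IsParent, Finset.mem_insert]
  constructor
  · rintro ⟨h1, h2, h3⟩
    refine ⟨?_, h2, fun w hw => h3 w (by tauto)⟩
    rcases h1 with h | h | h
    · exact .inl h
    · exact absurd h h2.ne'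
    · exact .inr h
  · rintro ⟨h1, h2, h3⟩
    refine ⟨by tauto, h2, ?_⟩
    rintro w (h | h | h) hw
    · exact h3 w (.inl h) hw
    · exact absurd h hw.ne'
    · exact h3 w (.inr h) hw

/-- If `w` properly contains `t`, it properly contains `u` as well, and `u` already hides the nodes
of `t` from the core of `w`. -/
theorem coreNodes_of_ne_parent (hu : IsParent T t u) (hw : w ∈ insert Finset.univ T)
    (hwu : w ≠ u) : coreNodes (insert t T) w = coreNodes T w := by
  ext v
  simp only [mem_coreNodes, Finset.mem_insert, forall_eq_or_imp]
  refine ⟨fun ⟨h, h1, h2⟩ => ⟨h, h2⟩, fun ⟨h, h2⟩ => ⟨h, fun htw hvt => ?_, h2⟩⟩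
  have h3 := (hu.2.2 w hw htw).ssubset_of_ne hwu.symm
  have h4 := hu.1
  rw [Finset.mem_insert] at h4
  rcases h4 with rfl | h4
  · exact h3.2 (Finset.subset_univ _)
  · exact h2 u h4 h3 (hu.2.1.subset hvt)

/-- A tube of `T` that meets the core of `t` contains `t` properly, hence contains `u`; so without
`t` its core is exposed to `u`. -/
theorem IsTubing.coreNodes_parent (hT : IsTubing G (insert t T)) (ht : t ∉ T)
    (hu : IsParent T t u) : coreNodes T u = coreNodes (insert t T) u ∪ coreNodes (insert t T) t := by
  have htu := hu.2.1
  have hu1 : u ∈ insert Finset.univ (insert t T) := by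
    have := hu.1
    simp only [Finset.mem_insert] at this ⊢
    tauto
  have ht1 : t ∈ insert Finset.univ (insert t T) := by simp
  ext v
  simp only [mem_coreNodes, Finset.mem_union, Finset.mem_insert, forall_eq_or_imp]
  constructor
  · rintro ⟨h, h2⟩
    by_cases hvt : v ∈ t
    · exact .inr ⟨hvt, fun h => absurd rfl h.ne, fun s hs hst => h2 s hs (hst.trans htu)⟩
    · exact .inl ⟨h, fun _ => hvt, h2⟩
  · rintro (⟨h, h1, h2⟩ | ⟨h, h1, h2⟩)
    · exact ⟨h, h2⟩
    · refine ⟨htu.subset h, fun s hs hsu hvs => ?_⟩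
      have hs1 : s ∈ insert Finset.univ (insert t T) := by simp [hs]
      rcases hT.nested hs1 ht1 hvs h with h4 | h4
      · by_cases e : s = t
        · exact absurd (e ▸ hs) ht
        · exact h2 s hs (h4.ssubset_of_ne e) hvs
      · exact hsu.2 (hu.2.2 s (by simp [hs]) h4)

theorem IsTubing.disjoint_coreNodes_parent (hT : IsTubing G (insert t T)) (hu : IsParent T t u) :
    Disjoint (coreNodes (insert t T) u) (coreNodes (insert t T) t) := by
  refine hT.disjoint_coreNodes ?_ (by simp) hu.2.1.ne'
  have := hu.1
  simp only [Finset.mem_insert] at this ⊢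
  tauto

end Tubings

end ColorfulGA

namespace ColorfulGA

/-! ### Connectivity of cores as separation in `G`, and its change when cores merge. -/

section Separation

variable {V : Type*} [DecidableEq V] {G : SimpleGraph V} {T : Finset (Finset V)}
  {s t u N S : Finset V}

/-- Removing `S` separates two nodes of `N` inside `u`. -/
def IsCut (G : SimpleGraph V) (u N S : Finset V) : Prop :=
  ∃ a ∈ N \ S, ∃ b ∈ N \ S, ¬ Joined G ((u : Set V) \ S) a b

/-- The connectivity of the node set `N` inside `u`. -/
noncomputable def sep (G : SimpleGraph V) (u N : Finset V) : ℕ :=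
  sInf {k : ℕ | ∃ S : Finset V, S ⊆ N ∧ S.card = k ∧ (IsCut G u N S ∨ N.card ≤ k + 1)}

theorem sep_le_of_isCut (hS : S ⊆ N) (h : IsCut G u N S) : sep G u N ≤ S.card :=
  Nat.sInf_le ⟨S, hS, rfl, .inl h⟩

theorem sep_set_nonempty (G : SimpleGraph V) (u N : Finset V) :
    {k : ℕ | ∃ S : Finset V, S ⊆ N ∧ S.card = k ∧ (IsCut G u N S ∨ N.card ≤ k + 1)}.Nonempty :=
  ⟨N.card, N, Finset.Subset.refl N, rfl, .inr (Nat.le_succ _)⟩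

theorem sep_le_card_sub_one (G : SimpleGraph V) (u N : Finset V) : sep G u N ≤ N.card - 1 := by
  obtain ⟨S, hS, hc⟩ := Finset.exists_subset_card_eq (Nat.sub_le N.card 1)
  exact Nat.sInf_le ⟨S, hS, hc, .inr (by omega)⟩

theorem exists_sep (G : SimpleGraph V) (u N : Finset V) :
    ∃ S ⊆ N, S.card = sep G u N ∧ (IsCut G u N S ∨ N.card ≤ sep G u N + 1) :=
  let ⟨S, h1, h2, h3⟩ := Nat.sInf_mem (sep_set_nonempty G u N)
  ⟨S, h1, h2, h3⟩

theorem joined_of_card_lt_sep (hS : S ⊆ N) (h : S.card < sep G u N) {a b : V} (ha : a ∈ N \ S)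
    (hb : b ∈ N \ S) : Joined G ((u : Set V) \ S) a b := by
  by_contra hn
  exact absurd (sep_le_of_isCut hS ⟨a, ha, b, hb, hn⟩) (not_le.2 h)

variable [Fintype V]

theorem connectivity_eq {W : Type*} [Fintype W] (H : SimpleGraph W) :
    connectivity H = sInf {k : ℕ | ∃ S : Finset W, S.card = k ∧
      ((∃ a, a ∉ S ∧ ∃ b, b ∉ S ∧ ¬ Joined H {v | v ∉ S} a b) ∨ Fintype.card W ≤ k + 1)} := by
  rw [connectivity]
  congr 1
  ext k
  refine exists_congr fun S => and_congr_right fun hk => ?_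
  rw [connected_induce_iff, not_and_or]
  push Not
  constructor
  · rintro ((h | ⟨a, ha, b, hb, h⟩) | h)
    -- If `S` is the whole node set, nothing is left to separate and the bound on the cardinality
    -- takes over.
    · right
      have : S = Finset.univ := by
        ext v
        simpa using Set.eq_empty_iff_forall_notMem.1 h v
      rw [this, Finset.card_univ] at hk
      omega
    · exact .inl ⟨a, ha, b, hb, h⟩
    · exact .inr h
  · rintro (⟨a, ha, b, hb, h⟩ | h)
    · exact .inl (.inr ⟨a, ha, b, hb, h⟩)
    · exact .inr h

theorem connectivity_eq_sep_univ (H : SimpleGraph V) :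
    connectivity H = sep H Finset.univ Finset.univ := by
  rw [connectivity_eq, sep]
  congr 1
  ext k
  have key : ∀ S : Finset V, {v | v ∉ S} = ((Finset.univ : Finset V) : Set V) \ (S : Set V) :=
    fun S => by ext; simp
  simp [IsCut, key]

theorem exists_maximal_below {c : V} (hcu : c ∈ u)
    (hc : c ∉ coreNodes T u) :
    ∃ s ∈ T, s ⊂ u ∧ c ∈ s ∧ ∀ s' ∈ T, s' ⊂ u → s ⊆ s' → s' = s := by
  have : ∃ s ∈ T, s ⊂ u ∧ c ∈ s := by
    by_contra h
    push Not at h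
    exact hc (mem_coreNodes.2 ⟨hcu, h⟩)
  obtain ⟨s0, h0⟩ := this
  obtain ⟨s, hs, hmax⟩ := (T.filter fun s => s ⊂ u ∧ c ∈ s).exists_max_image Finset.card
    ⟨s0, by simpa using h0⟩
  simp only [Finset.mem_filter] at hs hmax
  exact ⟨s, hs.1, hs.2.1, hs.2.2, fun s' hs' hsu hss =>
    (Finset.eq_of_subset_of_card_le hss (hmax s' ⟨hs', hsu, hss hs.2.2⟩)).symm⟩

/-- A path in the core graph expands, through the connected tubes below `u`, to a path in `u`.
Conversely, dropping the non-core nodes of a path in `u` leaves core nodes that are successively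
equal or adjacent in the core graph. -/
theorem joined_coreGraph_iff (hT : IsTubing G T) (S : Finset {v // v ∈ coreNodes T u})
    {a b : {v // v ∈ coreNodes T u}} (ha : a ∉ S) :
    Joined (coreGraph G T u) {v | v ∉ S} a b ↔
      Joined G ((u : Set V) \ (S.map (Function.Embedding.subtype _) : Finset V)) a b := by
  have hmem : ∀ c : {v // v ∈ coreNodes T u}, c ∉ S →
      (c : V) ∈ (u : Set V) \ (S.map (Function.Embedding.subtype _) : Finset V) := by
    intro c hc
    refine ⟨coreNodes_subset c.2, ?_⟩
    simpa using hc
  have htube : ∀ s ∈ T, s ⊂ u →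
      (s : Set V) ⊆ (u : Set V) \ (S.map (Function.Embedding.subtype _) : Finset V) := by
    intro s hs hsu v hv
    refine ⟨hsu.subset hv, ?_⟩
    simp only [Finset.coe_map, Set.mem_image, Finset.mem_coe, not_exists, not_and]
    rintro c hc rfl
    exact (mem_coreNodes.1 c.2).2 s hs hsu hv
  constructor
  · rintro ⟨-, h⟩
    induction h with
    | refl => exact .refl (hmem a ha)
    | @tail c d _ hd ih =>
      obtain ⟨⟨-, h | ⟨s, hs, hsu, ⟨x, hx, hcx⟩, y, hy, hdy⟩⟩, hdS⟩ := hd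
      · exact ih.tail h (hmem d hdS)
      · exact ((ih.tail hcx (htube s hs hsu hx)).trans
          (((isTube_iff.1 (hT.1 s hs)).2.2 x hx y hy).mono (htube s hs hsu))).tail
            hdy.symm (hmem d hdS)
  · rintro ⟨-, h⟩
    -- The invariant records the last core node `a'` and, if the path has left the core, the maximal
    -- tube below `u` that it runs through. Distinct maximal tubes have no edge between them, so the
    -- path cannot change the tube without meeting the core.
    have key : ∀ c : V, Relation.ReflTransGen (fun x y => G.Adj x y ∧
        y ∈ (u : Set V) \ (S.map (Function.Embedding.subtype _) : Finset V)) a c →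
        ∃ a' : {v // v ∈ coreNodes T u}, Joined (coreGraph G T u) {v | v ∉ S} a a' ∧
          (a'.1 = c ∨ ∃ s ∈ T, s ⊂ u ∧ c ∈ s ∧ (∀ s' ∈ T, s' ⊂ u → s ⊆ s' → s' = s) ∧
            ∃ x ∈ s, G.Adj a' x) := by
      intro c hc
      induction hc with
      | refl => exact ⟨a, .refl ha, .inl rfl⟩
      | @tail c d _ hd ih =>
        obtain ⟨a', haa, h⟩ := ih
        by_cases hdc : d ∈ coreNodes T u
        · have hdS : (⟨d, hdc⟩ : {v // v ∈ coreNodes T u}) ∉ S := by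
            intro hS
            refine hd.2.2 ?_
            simpa using ⟨hdc, hS⟩
          by_cases hda : a' = ⟨d, hdc⟩
          · exact ⟨a', haa, .inl (by rw [hda])⟩
          · refine ⟨⟨d, hdc⟩, haa.tail ⟨hda, ?_⟩ hdS, .inl rfl⟩
            rcases h with rfl | ⟨s, hs, hsu, hcs, -, hx⟩
            · exact .inl hd.1
            · exact .inr ⟨s, hs, hsu, hx, c, hcs, hd.1.symm⟩
        · obtain ⟨s', hs', hsu', hds', hmax'⟩ := exists_maximal_below hd.2.1 hdc
          refine ⟨a', haa, .inr ?_⟩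
          rcases h with rfl | ⟨s, hs, hsu, hcs, hmax, hx⟩
          · exact ⟨s', hs', hsu', hds', hmax', d, hds', hd.1⟩
          · by_cases e : s = s'
            · subst e
              exact ⟨s, hs, hsu, hds', hmax, hx⟩
            · rcases hT.2 s hs s' hs' e with h | h | h
              · exact absurd (hmax s' hs' hsu' h.subset).symm e
              · exact absurd (hmax' s hs hsu h.subset) e
              · exact absurd hd.1 (h.2 c hcs d hds')
    obtain ⟨a', haa, h | ⟨s, hs, hsu, hbs, -⟩⟩ := key b h
    · rwa [Subtype.ext h] at haa
    · exact absurd hbs ((mem_coreNodes.1 b.2).2 s hs hsu)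

/-- Only core nodes are removed, so the connectivity can be computed inside `G`. Cores of different
tubings become comparable in this way. -/
theorem connectivity_coreGraph (hT : IsTubing G T) (u : Finset V) :
    connectivity (coreGraph G T u) = sep G u (coreNodes T u) := by
  rw [connectivity_eq, sep]
  congr 1
  ext k
  rw [Set.mem_ofPred_eq, Set.mem_ofPred_eq, Fintype.card_coe]
  constructor
  · rintro ⟨S, hk, h⟩
    refine ⟨S.map (Function.Embedding.subtype _), ?_, by rwa [Finset.card_map], ?_⟩
    · intro v hv
      simp only [Finset.mem_map] at hv
      obtain ⟨c, _, rfl⟩ := hv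
      exact c.2
    · refine h.imp_left ?_
      rintro ⟨a, ha, b, hb, h⟩
      rw [joined_coreGraph_iff hT S ha] at h
      refine ⟨a, ?_, b, ?_, h⟩
      · simpa using ha
      · simpa using hb
  · rintro ⟨S, hS, hk, h⟩
    obtain ⟨S, rfl⟩ : ∃ S' : Finset {v // v ∈ coreNodes T u},
        S'.map (Function.Embedding.subtype _) = S := by
      refine ⟨S.subtype _, ?_⟩
      rw [Finset.subtype_map]
      exact Finset.filter_true_of_mem hS
    rw [Finset.card_map] at hk
    refine ⟨S, hk, h.imp_left ?_⟩
    rintro ⟨a, ha, b, hb, h⟩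
    rw [Finset.mem_sdiff] at ha hb
    refine ⟨⟨a, ha.1⟩, fun h' => ha.2 ?_, ⟨b, hb.1⟩, fun h' => hb.2 ?_, ?_⟩
    · simpa using ⟨ha.1, h'⟩
    · simpa using ⟨hb.1, h'⟩
    · rw [joined_coreGraph_iff hT S]
      · exact h
      · exact fun h' => ha.2 (by simpa using ⟨ha.1, h'⟩)

/-- By the strict inequality the minimum is attained by an actual cut of `N`, and this separates the
same two nodes in the larger set. -/
theorem sep_union_le_left {M : Finset V} (h : sep G u N + 1 < N.card) :
    sep G u (N ∪ M) ≤ sep G u N ∨ ¬ Disjoint N M := by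
  by_cases hd : Disjoint N M
  · left
    obtain ⟨S, hS, hc, hcut | hle⟩ := exists_sep G u N
    · rw [← hc]
      refine sep_le_of_isCut (hS.trans Finset.subset_union_left) ?_
      obtain ⟨a, ha, b, hb, hn⟩ := hcut
      refine ⟨a, ?_, b, ?_, hn⟩
      · simp only [Finset.mem_sdiff, Finset.mem_union] at ha ⊢
        exact ⟨.inl ha.1, ha.2⟩
      · simp only [Finset.mem_sdiff, Finset.mem_union] at hb ⊢
        exact ⟨.inl hb.1, hb.2⟩
    · omega
  · exact .inr hd

/-- Inside `u`, no path leaves `t` without meeting the core of `u`. -/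
theorem IsTubing.adj_mem (hT : IsTubing G (insert t T)) (hu : IsParent T t u) {x y : V}
    (hx : x ∈ t) (hy : y ∈ (u : Set V) \ (coreNodes (insert t T) u : Finset V))
    (h : G.Adj x y) : y ∈ t := by
  have hyu : y ∈ u := hy.1
  obtain ⟨s, hs, hsu, hys, -⟩ := exists_maximal_below hyu hy.2
  by_contra hyt
  have hts : t ⊂ s := hT.ssubset_of_adj (Finset.mem_insert_of_mem hs) (by simp) hys hyt hx h.symm
  have hsT : s ∈ T := by
    rcases Finset.mem_insert.1 hs with e | h
    · exact absurd e hts.ne'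
    · exact h
  exact hsu.2 (hu.2.2 s (Finset.mem_insert_of_mem hsT) hts)

/-- Once the core of `u` is deleted, paths starting in `t` stay in `t`, so a minimum cut of the core
of `t` also cuts the merged core. If the core of `t` has no such cut, counting nodes suffices. -/
theorem sep_parent_le_add (hT : IsTubing G (insert t T)) (ht : t ∉ T) (hu : IsParent T t u) :
    sep G u (coreNodes T u) ≤
      sep G t (coreNodes (insert t T) t) + (coreNodes (insert t T) u).card := by
  rw [hT.coreNodes_parent ht hu]
  have hd := hT.disjoint_coreNodes_parent hu
  set Nu := coreNodes (insert t T) u with hNu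
  set Nt := coreNodes (insert t T) t with hNt
  obtain ⟨S, hS, hc, hcut | hle⟩ := exists_sep G t Nt
  · have hSu : Disjoint Nu S := hd.mono_right hS
    rw [← hc, add_comm, ← Finset.card_union_of_disjoint hSu]
    refine sep_le_of_isCut (Finset.union_subset_union_right hS) ?_
    obtain ⟨a, ha, b, hb, hn⟩ := hcut
    have hmem : ∀ v ∈ Nt \ S, v ∈ (Nu ∪ Nt) \ (Nu ∪ S) := by
      intro v hv
      rw [Finset.mem_sdiff] at hv
      have := Finset.disjoint_right.1 hd hv.1
      simp [hv.1, hv.2, this]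
    refine ⟨a, hmem a ha, b, hmem b hb, fun hj => hn ?_⟩
    refine hj.of_closed ?_ ⟨coreNodes_subset (Finset.mem_sdiff.1 ha).1,
      (Finset.mem_sdiff.1 ha).2⟩
    rintro x ⟨hx, -⟩ y ⟨hy1, hy2⟩ hxy
    rw [Finset.mem_coe, Finset.mem_union, not_or] at hy2
    exact ⟨hT.adj_mem hu hx ⟨hy1, hy2.1⟩ hxy, hy2.2⟩
  · have h1 := sep_le_card_sub_one G u (Nu ∪ Nt)
    rw [Finset.card_union_of_disjoint hd] at h1
    omega

/-- In the second alternative the core of `u` is as connected as a complete graph, and its inner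
block holds at most one color. -/
theorem sep_parent_le (hT : IsTubing G (insert t T)) (ht : t ∉ T) (hu : IsParent T t u) :
    sep G u (coreNodes T u) ≤ sep G u (coreNodes (insert t T) u) ∨
      (coreNodes (insert t T) u).card ≤ sep G u (coreNodes (insert t T) u) + 1 := by
  rw [hT.coreNodes_parent ht hu]
  by_cases h : (coreNodes (insert t T) u).card ≤ sep G u (coreNodes (insert t T) u) + 1
  · exact .inr h
  · exact .inl ((sep_union_le_left (not_le.1 h)).resolve_right
      (not_not.2 (hT.disjoint_coreNodes_parent hu)))

/-- Two siblings are separated by the core of their common parent. -/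
theorem sep_siblings_le {s : Finset V} (hT : IsTubing G (insert s (insert t T)))
    (hs : s ∉ insert t T) (ht : t ∉ T)
    (hsu : IsParent T s u) (htu : IsParent T t u) (hst : ¬ s ⊂ t) (hts : ¬ t ⊂ s)
    (hsn : (coreNodes (insert s (insert t T)) s).Nonempty)
    (htn : (coreNodes (insert s (insert t T)) t).Nonempty) :
    sep G u (coreNodes T u) ≤ (coreNodes (insert s (insert t T)) u).card := by
  have hsu' : IsParent (insert t T) s u := by
    refine ⟨?_, hsu.2.1, fun w hw hsw => ?_⟩
    · have := hsu.1
      simp only [Finset.mem_insert] at this ⊢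
      tauto
    · simp only [Finset.mem_insert] at hw
      rcases hw with rfl | rfl | hw
      · exact Finset.subset_univ _
      · exact absurd hsw hst
      · exact hsu.2.2 w (by simp [hw]) hsw
  have hT' : IsTubing G (insert t T) := hT.mono (Finset.subset_insert _ _)
  rw [hT'.coreNodes_parent ht htu, hT.coreNodes_parent hs hsu']
  obtain ⟨a, ha⟩ := hsn
  obtain ⟨b, hb⟩ := htn
  have hs1 : s ∈ insert Finset.univ (insert s (insert t T)) := by simp
  have ht1 : t ∈ insert Finset.univ (insert s (insert t T)) := by simp
  have hu1 : u ∈ insert Finset.univ (insert s (insert t T)) := by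
    have := hsu.1
    simp only [Finset.mem_insert] at this ⊢
    tauto
  have hb' : b ∈ coreNodes (insert t T) t :=
    mem_coreNodes.2 ⟨coreNodes_subset hb, fun r hr hrt =>
      (mem_coreNodes.1 hb).2 r (Finset.mem_insert_of_mem hr) hrt⟩
  refine sep_le_of_isCut (by intro v hv; simp [hv]) ⟨a, ?_, b, ?_, fun hj => ?_⟩
  · have := Finset.disjoint_right.1 (hT.disjoint_coreNodes hu1 hs1 hsu.2.1.ne') ha
    simp [ha, this]
  · have := Finset.disjoint_right.1 (hT.disjoint_coreNodes hu1 ht1 htu.2.1.ne') hb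
    simp [hb', this]
  · have hbs := (hj.of_closed (K := (s : Set V))
      (fun x hx y hy h => hT.adj_mem hsu' hx hy h) (coreNodes_subset ha)).mem_right
    rcases hT.nested hs1 ht1 hbs (coreNodes_subset hb) with h | h
    · exact hst (h.ssubset_of_ne (by rintro rfl; simp at hs))
    · exact hts h

end Separation

end ColorfulGA

namespace ColorfulGA

/-! ### Blocks of colors and their listings. -/

namespace Blocks

variable {α : Type*} {b b' : Blocks α} {l p r r' : List α}

theorem exists_isListing (b : Blocks α) : ∃ l, b.IsListing l :=
  ⟨_, b.inner.toList, b.inner.coe_toList, rfl⟩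

theorem IsListing.coe_eq (h : b.IsListing l) : (l : Multiset α) = b.colors := by
  obtain ⟨i, hi, rfl⟩ := h
  simp [colors, ← hi]

theorem IsListing.length (h : b.IsListing l) :
    l.length = b.color.toList.length + b.outer.length + b.inner.card := by
  obtain ⟨i, hi, rfl⟩ := h
  simp [← hi, add_assoc]

theorem length_toList_color (h : b.color.isSome ↔ b'.color.isSome) :
    b.color.toList.length = b'.color.toList.length := by
  cases hb : b.color <;> cases hb' : b'.color <;> simp_all

/-- The lengths of color and outer part are known, so the listing can be cut back into its blocks.
-/
theorem IsListing.unique (h : b.IsListing l) (h' : b'.IsListing l)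
    (hc : b.color.isSome ↔ b'.color.isSome) (ho : b.outer.length = b'.outer.length) : b = b' := by
  obtain ⟨i, hi, rfl⟩ := h
  obtain ⟨i', hi', e⟩ := h'
  have hc' := length_toList_color hc
  rw [List.append_assoc, List.append_assoc] at e
  obtain ⟨e1, e2⟩ := List.append_inj e hc'
  obtain ⟨e2, e3⟩ := List.append_inj e2 ho
  ext1
  · cases hb : b.color <;> cases hb' : b'.color <;> simp_all
  · exact e2
  · rw [← hi, ← hi', e3]

/-- By `hp` the part that is permuted lies within the inner block. -/
theorem IsListing.perm_suffix (h : b.IsListing (p ++ r)) (hr : r.Perm r')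
    (hp : b.color.toList.length + b.outer.length ≤ p.length) : b.IsListing (p ++ r') := by
  obtain ⟨i, hi, e⟩ := h
  rw [List.append_eq_append_iff] at e
  rcases e with ⟨q, h1, h2⟩ | ⟨q, h1, h2⟩
  · have hq : q = [] := by
      have := congrArg List.length h1
      simp only [List.length_append] at this
      exact List.length_eq_zero_iff.1 (by omega)
    subst hq
    simp only [List.append_nil] at h1
    simp only [List.nil_append] at h2
    refine ⟨r', ?_, by rw [h1]⟩
    rw [← hi, ← h2]
    exact Multiset.coe_eq_coe.2 hr.symm
  · refine ⟨q ++ r', ?_, by rw [h1]; simp⟩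
    rw [← hi, h2]
    exact Multiset.coe_eq_coe.2 (hr.symm.append_left q)

/-- The blocks with a given listing. -/
def ofList (colored : Prop) [Decidable colored] (m : ℕ) (l : List α) : Blocks α :=
  if colored then ⟨l.head?, l.tail.take m, l.tail.drop m⟩ else ⟨none, l.take m, l.drop m⟩

theorem isListing_ofList (colored : Prop) [Decidable colored] (m : ℕ) (l : List α) :
    (ofList colored m l).IsListing l := by
  unfold ofList
  split_ifs
  · refine ⟨l.tail.drop m, rfl, ?_⟩
    cases l <;> simp
  · exact ⟨l.drop m, rfl, by simp⟩

end Blocks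

/-! ### Removal of tubes: existence, independence of choices, commutation. -/

namespace ColorTemplate

open Blocks

variable {V α : Type*} [Fintype V] [DecidableEq V] {G : SimpleGraph V} {c : Multiset α}
  {x y z : ColorTemplate G c} {s t u w : Finset V} {l : List α}

theorem color_isSome_congr (h : s ∈ x.tubing ↔ s ∈ y.tubing) :
    (x.blocks s).color.isSome ↔ (y.blocks s).color.isSome := by
  rw [x.color_isSome, y.color_isSome, h]

theorem length_color_of_mem (h : t ∈ x.tubing) : (x.blocks t).color.toList.length = 1 := by
  have := (x.color_isSome t).2 h
  cases hb : (x.blocks t).color <;> simp_all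

theorem length_color_univ (x : ColorTemplate G c) :
    (x.blocks Finset.univ).color.toList.length = 0 := by
  have := (x.color_isSome Finset.univ).not.2 x.isTubing.univ_notMem
  cases hb : (x.blocks Finset.univ).color <;> simp_all

theorem outer_length_eq (x : ColorTemplate G c) (ht : t ∈ insert Finset.univ x.tubing) :
    (x.blocks t).outer.length = sep G t (coreNodes x.tubing t) - 1 := by
  rw [x.outer_length t ht, connectivity_coreGraph x.isTubing]

theorem coreNodes_nonempty (x : ColorTemplate G c) (ht : t ∈ insert Finset.univ x.tubing) :
    (coreNodes x.tubing t).Nonempty := by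
  rw [← Finset.card_pos, ← x.card_blocks t ht]
  omega

theorem length_listing (ht : t ∈ insert Finset.univ x.tubing) (h : (x.blocks t).IsListing l) :
    l.length + 1 = (x.blocks t).color.toList.length + (coreNodes x.tubing t).card := by
  rw [h.length, ← x.card_blocks t ht]
  omega

theorem blocks_eq_of_listing (h : t ∈ x.tubing ↔ t ∈ y.tubing)
    (ht : t ∈ insert Finset.univ x.tubing) (hc : coreNodes x.tubing t = coreNodes y.tubing t)
    (hx : (x.blocks t).IsListing l) (hy : (y.blocks t).IsListing l) : x.blocks t = y.blocks t := by
  refine hx.unique hy (color_isSome_congr h) ?_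
  rw [x.outer_length_eq ht, y.outer_length_eq (by simpa [h] using ht), hc]

/-- Templates with the same tubing and a common listing of each tube are equal. -/
theorem ext_listing (h : x.tubing = y.tubing)
    (hl : ∀ t ∈ insert Finset.univ x.tubing, ∃ l,
      (x.blocks t).IsListing l ∧ (y.blocks t).IsListing l) : x = y := by
  ext1
  · exact h
  · funext t
    by_cases ht : t ∈ insert Finset.univ x.tubing
    · obtain ⟨l, h1, h2⟩ := hl t ht
      exact blocks_eq_of_listing (by rw [h]) ht (by rw [h]) h1 h2
    · rw [x.blocks_eq_empty t ht, y.blocks_eq_empty t (h ▸ ht)]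

/-- Cutting each word at the length prescribed by the connectivity of its core gives the blocks.
Templates can thus be specified by plain words of the right lengths. -/
theorem exists_of_words {T : Finset (Finset V)} (hT : IsTubing G T) (W : Finset V → List α)
    (hne : ∀ t ∈ T, W t ≠ []) (hlen : ∀ t ∈ T, (W t).length = (coreNodes T t).card)
    (hlen' : (W Finset.univ).length + 1 = (coreNodes T Finset.univ).card)
    (hsum : ∑ t ∈ insert Finset.univ T, (W t : Multiset α) = c) :
    ∃ x : ColorTemplate G c, x.tubing = T ∧
      ∀ t ∈ insert Finset.univ T, (x.blocks t).IsListing (W t) := by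
  have hB : ∀ t ∈ T, ∀ m, m ≤ (coreNodes T t).card - 1 - 1 →
      (ofList (t ∈ T) m (W t)).color.isSome ∧ (ofList (t ∈ T) m (W t)).outer.length = m ∧
      1 + (ofList (t ∈ T) m (W t)).outer.length + (ofList (t ∈ T) m (W t)).inner.card =
        (coreNodes T t).card := by
    intro t ht m hm
    have h1 := hne t ht
    have h2 := hlen t ht
    cases hW : W t with
    | nil => exact absurd hW h1
    | cons a l =>
      rw [hW] at h2
      simp only [List.length_cons] at h2
      simp only [ofList, ht, if_true, List.head?_cons, List.tail_cons, List.length_take,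
        Multiset.coe_card, List.length_drop, Option.isSome_some]
      refine ⟨trivial, ?_, ?_⟩ <;> omega
  have hU : ∀ m, m ≤ (coreNodes T Finset.univ).card - 1 - 1 →
      (ofList (Finset.univ ∈ T) m (W Finset.univ)).outer.length = m ∧
      1 + (ofList (Finset.univ ∈ T) m (W Finset.univ)).outer.length +
        (ofList (Finset.univ ∈ T) m (W Finset.univ)).inner.card =
        (coreNodes T Finset.univ).card := by
    intro m hm
    simp only [ofList, hT.univ_notMem, if_false, List.length_take, Multiset.coe_card,
      List.length_drop]
    constructor <;> omega
  -- The connectivity is less than the number of core nodes, so the outer colors fit beside the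
  -- color of a tube. The word of `univ` is one shorter but has no color to spend.
  have hsep : ∀ t, connectivity (coreGraph G T t) - 1 ≤ (coreNodes T t).card - 1 - 1 := by
    intro t
    rw [connectivity_coreGraph hT]
    exact Nat.sub_le_sub_right (sep_le_card_sub_one _ _ _) 1
  refine ⟨⟨T, fun t => if t ∈ insert Finset.univ T then
    ofList (t ∈ T) (connectivity (coreGraph G T t) - 1) (W t) else Blocks.empty, hT,
    ?_, ?_, ?_, ?_, ?_⟩, rfl, ?_⟩
  · intro t
    constructor
    · intro h
      by_contra ht
      split_ifs at h
      · simp [ofList, ht] at h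
      · simp [Blocks.empty] at h
    · intro ht
      rw [if_pos (Finset.mem_insert_of_mem ht)]
      exact (hB t ht _ (hsep t)).1
  · intro t ht
    rw [if_pos ht]
    rcases Finset.mem_insert.1 ht with rfl | ht
    · exact (hU _ (hsep _)).1
    · exact (hB t ht _ (hsep t)).2.1
  · intro t ht
    rw [if_pos ht]
    rcases Finset.mem_insert.1 ht with rfl | ht
    · exact (hU _ (hsep _)).2
    · exact (hB t ht _ (hsep t)).2.2
  · intro t ht
    rw [if_neg ht]
  · rw [← hsum]
    refine Finset.sum_congr rfl fun t ht => ?_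
    rw [if_pos ht]
    exact (isListing_ofList _ _ _).coe_eq.symm
  · intro t ht
    dsimp only
    rw [if_pos ht]
    exact isListing_ofList _ _ _

/-- `y` arises from `x` by removing the tube `t`, whose colors are appended to those of its
parent `u`, in any order that respects the blocks. -/
structure Removes (x y : ColorTemplate G c) (t u : Finset V) : Prop where
  notMem : t ∉ y.tubing
  tubing_eq : x.tubing = insert t y.tubing
  parent : IsParent y.tubing t u
  blocks_eq : ∀ s, s ≠ t → s ≠ u → x.blocks s = y.blocks s
  listing : ∀ l₁ l₂, (x.blocks u).IsListing l₁ → (x.blocks t).IsListing l₂ →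
    (y.blocks u).IsListing (l₁ ++ l₂)

/-- `AddTube` asks for some listings, `Removes` for all. They agree because a reordering of the
inner blocks of `u` and `t` is either absorbed by the inner block of the merged core or trivial. -/
theorem addTube_iff : AddTube x y ↔ ∃ t u, Removes x y t u := by
  constructor
  swap
  · rintro ⟨t, u, h⟩
    obtain ⟨l₁, h₁⟩ := (x.blocks u).exists_isListing
    obtain ⟨l₂, h₂⟩ := (x.blocks t).exists_isListing
    exact ⟨t, u, h.notMem, h.tubing_eq, h.parent.1, h.parent.2.1, h.parent.2.2, h.blocks_eq,
      l₁, l₂, h₁, h₂, h.listing _ _ h₁ h₂⟩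
  · rintro ⟨t, u, ht, hxy, hu, htu, hmin, hb, l₁, l₂, h₁, h₂, h⟩
    have hp : IsParent y.tubing t u := ⟨hu, htu, hmin⟩
    refine ⟨t, u, ht, hxy, hp, hb, ?_⟩
    intro l₁' l₂' h₁' h₂'
    have hTx : IsTubing G (insert t y.tubing) := hxy ▸ x.isTubing
    have hux : u ∈ insert Finset.univ x.tubing := by
      rw [hxy]
      simp only [Finset.mem_insert] at hu ⊢
      tauto
    have htx : t ∈ x.tubing := hxy ▸ Finset.mem_insert_self _ _
    have ho : (x.blocks u).color.toList.length = (y.blocks u).color.toList.length :=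
      length_toList_color (color_isSome_congr (by
        rw [hxy, Finset.mem_insert]
        exact or_iff_right htu.ne'))
    have hy1 := y.outer_length_eq hu
    have hx1 := x.outer_length_eq hux
    have hx2 := x.outer_length_eq (Finset.mem_insert_of_mem htx)
    have hx3 := x.card_blocks u hux
    have hx4 := length_color_of_mem htx
    have hl2 : l₂.Perm l₂' := Multiset.coe_eq_coe.1 (h₂.coe_eq.trans h₂'.coe_eq.symm)
    obtain ⟨i₁, hi₁, rfl⟩ := h₁
    obtain ⟨i₁', hi₁', rfl⟩ := h₁'
    have hii : i₁.Perm i₁' := Multiset.coe_eq_coe.1 (hi₁.trans hi₁'.symm)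
    have s1 := sep_parent_le hTx ht hp
    have s2 := sep_parent_le_add hTx ht hp
    rw [← hxy] at s1 s2
    -- Either the outer colors of the merged core fit into the color and outer colors of `u`, and
    -- everything behind may be permuted; or `u` has at most one inner color, so that `l₁` is
    -- forced, and the outer colors of the merged core end no later than those of `t`.
    rcases s1 with s1 | s1
    · rw [List.append_assoc] at h ⊢
      refine h.perm_suffix (hii.append hl2) ?_
      simp only [List.length_append]
      omega
    · have hi : i₁ = i₁' := by
        have : i₁.length ≤ 1 := by
          rw [← Multiset.coe_card, hi₁]
          omega
        rcases i₁ with _ | ⟨a, _ | ⟨b, i⟩⟩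
        · exact (List.nil_perm.1 hii).symm
        · exact List.singleton_perm.1 hii
        · simp at this
      subst hi
      obtain ⟨i₂, hi₂, rfl⟩ := h₂
      obtain ⟨i₂', hi₂', rfl⟩ := h₂'
      rw [← List.append_assoc] at h ⊢
      refine h.perm_suffix (Multiset.coe_eq_coe.1 (hi₂.trans hi₂'.symm)) ?_
      have h5 : i₁.length = (x.blocks u).inner.card := by rw [← hi₁, Multiset.coe_card]
      simp only [List.length_append]
      omega

theorem Removes.mem (h : Removes x y t u) : t ∈ x.tubing :=
  h.tubing_eq ▸ Finset.mem_insert_self _ _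

theorem Removes.tubing_eq_erase (h : Removes x y t u) : y.tubing = x.tubing.erase t := by
  rw [h.tubing_eq, Finset.erase_insert h.notMem]

theorem Removes.le (h : Removes x y t u) : x ≤ y :=
  Relation.ReflTransGen.single (addTube_iff.2 ⟨t, u, h⟩)

theorem Removes.blocks_eq' (h : Removes x y t u) (hs : s ∈ insert Finset.univ y.tubing)
    (hsu : s ≠ u) : x.blocks s = y.blocks s := by
  refine h.blocks_eq s ?_ hsu
  rintro rfl
  rcases Finset.mem_insert.1 hs with rfl | hs
  · exact x.isTubing.univ_notMem h.mem
  · exact h.notMem hs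

/-- The new template has the words of `x`, with the word of `t` appended to that of its parent. -/
theorem exists_removes (ht : t ∈ x.tubing) : ∃ y u, Removes x y t u := by
  obtain ⟨T, hT, hTx⟩ : ∃ T, t ∉ T ∧ x.tubing = insert t T :=
    ⟨x.tubing.erase t, Finset.notMem_erase _ _, (Finset.insert_erase ht).symm⟩
  have hTx' : IsTubing G (insert t T) := hTx ▸ x.isTubing
  have hT' : IsTubing G T := hTx'.mono (Finset.subset_insert _ _)
  obtain ⟨u, hu⟩ := hTx'.exists_parent (Finset.mem_insert_self _ _)
  rw [isParent_insert] at hu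
  choose W hW using fun s => (x.blocks s).exists_isListing
  have htT : t ∉ insert Finset.univ T := by
    rw [Finset.mem_insert, not_or]
    exact ⟨fun h => x.isTubing.univ_notMem (h ▸ ht), hT⟩
  have hsub : ∀ s ∈ insert Finset.univ T, s ∈ insert Finset.univ x.tubing := by
    intro s hs
    rw [hTx]
    simp only [Finset.mem_insert] at hs ⊢
    tauto
  have htx : t ∈ insert Finset.univ x.tubing := Finset.mem_insert_of_mem ht
  have hcard : (coreNodes T u).card =
      (coreNodes x.tubing u).card + (coreNodes x.tubing t).card := by
    rw [hTx, hTx'.coreNodes_parent hT hu,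
      Finset.card_union_of_disjoint (hTx'.disjoint_coreNodes_parent hu)]
  have hlen : ∀ s ∈ insert Finset.univ T,
      (Function.update W u (W u ++ W t) s).length + 1 =
        (x.blocks s).color.toList.length + (coreNodes T s).card := by
    intro s hs
    by_cases hsu : s = u
    · subst hsu
      have h1 := length_listing (hsub s hs) (hW s)
      have h2 := length_listing htx (hW t)
      have h3 := length_color_of_mem ht
      rw [Function.update_self, hcard, List.length_append]
      omega
    · rw [Function.update_of_ne hsu, length_listing (hsub s hs) (hW s), hTx,
        coreNodes_of_ne_parent hu hs hsu]
  obtain ⟨y, hy, hl⟩ := exists_of_words (c := c) hT' (Function.update W u (W u ++ W t)) (by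
      intro s hs h
      have h1 := hlen s (Finset.mem_insert_of_mem hs)
      have h2 := x.coreNodes_nonempty (hsub s (Finset.mem_insert_of_mem hs))
      have h3 : coreNodes x.tubing s ⊆ coreNodes T s := fun v hv =>
        mem_coreNodes.2 ⟨coreNodes_subset hv, fun r hr hrs =>
          (mem_coreNodes.1 hv).2 r (by rw [hTx]; exact Finset.mem_insert_of_mem hr) hrs⟩
      have h4 := (h2.mono h3).card_pos
      have h5 := length_color_of_mem (x := x) (t := s)
        (by rw [hTx]; exact Finset.mem_insert_of_mem hs)
      rw [h] at h1
      simp only [List.length_nil] at h1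
      omega) (by
      intro s hs
      have h1 := hlen s (Finset.mem_insert_of_mem hs)
      have h5 := length_color_of_mem (x := x) (t := s)
        (by rw [hTx]; exact Finset.mem_insert_of_mem hs)
      omega) (by
      rw [hlen _ (Finset.mem_insert_self _ _), length_color_univ, zero_add]) (by
      have h1 : ∑ s ∈ insert Finset.univ T, (Function.update W u (W u ++ W t) s : Multiset α) =
          ∑ s ∈ insert Finset.univ T,
            Function.update (fun s => (W s : Multiset α)) u ((W u : Multiset α) + W t) s := by
        refine Finset.sum_congr rfl fun s _ => ?_
        by_cases hsu : s = u
        · subst hsu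
          simp
        · simp [hsu]
      rw [h1, Finset.sum_update_of_mem hu.1, ← x.sum_colors, hTx, Finset.insert_comm,
        Finset.sum_insert htT, ← Finset.sum_sdiff (Finset.singleton_subset_iff.2 hu.1),
        Finset.sum_singleton]
      simp only [← (hW _).coe_eq]
      abel)
  have hadd : AddTube x y := by
    refine ⟨t, u, by rwa [hy], by rw [hy, hTx], by rw [hy]; exact hu.1, hu.2.1,
      by rw [hy]; exact hu.2.2, fun s hst hsu => ?_, W u, W t, hW u, hW t, ?_⟩
    · by_cases hs : s ∈ insert Finset.univ T
      · refine blocks_eq_of_listing (l := W s) ?_ (hsub s hs) ?_ (hW s) ?_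
        · rw [hTx, hy, Finset.mem_insert]
          exact or_iff_right hst
        · rw [hTx, hy]
          exact coreNodes_of_ne_parent hu hs hsu
        · have := hl s hs
          rwa [Function.update_of_ne hsu] at this
      · rw [y.blocks_eq_empty s (by rwa [hy]), x.blocks_eq_empty s]
        rw [hTx]
        simp only [Finset.mem_insert] at hs ⊢
        tauto
    · have := hl u hu.1
      rwa [Function.update_self] at this
  obtain ⟨t', u', h⟩ := addTube_iff.1 hadd
  have : t = t' := by
    have h1 := h.mem
    rw [hTx, Finset.mem_insert] at h1
    rcases h1 with e | h1
    · exact e.symm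
    · exact absurd (hy ▸ h1) h.notMem
  exact ⟨y, u', this ▸ h⟩

theorem Removes.unique (h : Removes x y t u) (h' : Removes x z t w) : y = z := by
  have hyz : y.tubing = z.tubing := by rw [h.tubing_eq_erase, h'.tubing_eq_erase]
  obtain rfl : u = w := h.parent.unique (hyz ▸ h'.parent)
  refine ext_listing hyz fun s hs => ?_
  by_cases hsu : s = u
  · subst hsu
    obtain ⟨l₁, h₁⟩ := (x.blocks s).exists_isListing
    obtain ⟨l₂, h₂⟩ := (x.blocks t).exists_isListing
    exact ⟨_, h.listing _ _ h₁ h₂, h'.listing _ _ h₁ h₂⟩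
  · obtain ⟨l, hl⟩ := (x.blocks s).exists_isListing
    exact ⟨l, h.blocks_eq' hs hsu ▸ hl, h'.blocks_eq' (hyz ▸ hs) hsu ▸ hl⟩

theorem _root_.ColorfulGA.IsParent.insert {T : Finset (Finset V)} (h : IsParent T t u)
    (hs : ¬ t ⊂ s) : IsParent (insert s T) t u := by
  refine ⟨?_, h.2.1, fun w hw htw => ?_⟩
  · have := h.1
    simp only [Finset.mem_insert] at this ⊢
    tauto
  · refine h.2.2 w ?_ htw
    simp only [Finset.mem_insert] at hw ⊢
    rcases hw with rfl | rfl | hw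
    · exact .inl rfl
    · exact absurd htw hs
    · exact .inr hw

theorem _root_.ColorfulGA.IsParent.of_insert {T : Finset (Finset V)}
    (h : IsParent (Insert.insert s T) t u) (hu : u ≠ s) : IsParent T t u := by
  refine ⟨?_, h.2.1, fun w hw htw => h.2.2 w ?_ htw⟩
  · have := h.1
    simp only [Finset.mem_insert] at this ⊢
    tauto
  · simp only [Finset.mem_insert] at hw ⊢
    tauto

/-- Removing first `s` and then its parent `t` merges all three color lists into `u`. -/
theorem Removes.comm_chain {z' y' : ColorTemplate G c} {u' u₁ : Finset V}
    (h₁ : Removes x z s t) (h₂ : Removes z y t u)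
    (h₁' : Removes x z' t u₁) (h₂' : Removes z' y' s u') : y = y' := by
  have e1 : x.tubing = insert s (insert t y.tubing) := by rw [h₁.tubing_eq, h₂.tubing_eq]
  have e2 : x.tubing = insert t (insert s y'.tubing) := by rw [h₁'.tubing_eq, h₂'.tubing_eq]
  have e : y.tubing = y'.tubing := by
    rw [h₂.tubing_eq_erase, h₁.tubing_eq_erase, h₂'.tubing_eq_erase, h₁'.tubing_eq_erase,
      Finset.erase_right_comm]
  have hst : s ⊂ t := h₁.parent.2.1
  have htu : t ⊂ u := h₂.parent.2.1
  have hu' : u' = u := by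
    refine h₂'.parent.unique ⟨e ▸ h₂.parent.1, hst.trans htu, fun w hw hsw => ?_⟩
    rw [← e] at hw
    have htw : t ⊆ w := by
      refine h₁.parent.2.2 w ?_ hsw
      rw [h₂.tubing_eq]
      simp only [Finset.mem_insert] at hw ⊢
      tauto
    refine h₂.parent.2.2 w hw (htw.ssubset_of_ne ?_)
    rintro rfl
    rcases Finset.mem_insert.1 hw with rfl | hw
    · exact htu.2 (Finset.subset_univ _)
    · exact h₂.notMem hw
  have hu₁ : u₁ = u := by
    refine h₁'.parent.unique ?_
    rw [h₂'.tubing_eq, ← e]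
    exact h₂.parent.insert fun h => h.2 hst.subset
  subst hu' hu₁
  have hsu : s ≠ u₁ := (hst.trans htu).ne
  refine ext_listing e fun w hw => ?_
  obtain ⟨ls, hls⟩ := (x.blocks s).exists_isListing
  obtain ⟨lt, hlt⟩ := (x.blocks t).exists_isListing
  by_cases hwu : w = u₁
  · subst hwu
    obtain ⟨lu, hlu⟩ := (x.blocks w).exists_isListing
    refine ⟨lu ++ (lt ++ ls), h₂.listing _ _ ?_ (h₁.listing _ _ hlt hls), ?_⟩
    · rwa [← h₁.blocks_eq w hsu.symm htu.ne']
    · rw [← List.append_assoc]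
      refine h₂'.listing _ _ (h₁'.listing _ _ hlu hlt) ?_
      rwa [← h₁'.blocks_eq s hst.ne hsu]
  · have h3 := h₂.blocks_eq' hw hwu
    have h4 := h₂'.blocks_eq' (e ▸ hw) hwu
    have hws : w ≠ s := by
      rintro rfl
      rcases Finset.mem_insert.1 hw with rfl | hw
      · exact hst.2 (Finset.subset_univ _)
      · exact h₂'.notMem (e ▸ hw)
    have hwt : w ≠ t := by
      rintro rfl
      rcases Finset.mem_insert.1 hw with rfl | hw
      · exact htu.2 (Finset.subset_univ _)
      · exact h₂.notMem hw
    obtain ⟨l, hl⟩ := (x.blocks w).exists_isListing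
    refine ⟨l, ?_, ?_⟩
    · rw [← h3, ← h₁.blocks_eq w hws hwt]
      exact hl
    · rw [← h4, ← h₁'.blocks_eq w hwt hwu]
      exact hl

/-- The order in which tubes are removed does not matter. -/
theorem Removes.comm {z' y' : ColorTemplate G c} {u' u₁ u₁' : Finset V} (hne : s ≠ t)
    (h₁ : Removes x z s u₁) (h₂ : Removes z y t u)
    (h₁' : Removes x z' t u₁') (h₂' : Removes z' y' s u') : y = y' := by
  by_cases hc1 : u₁ = t
  · subst hc1
    exact h₁.comm_chain h₂ h₁' h₂'
  by_cases hc2 : u₁' = s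
  · subst hc2
    exact (h₁'.comm_chain h₂' h₁ h₂).symm
  have e : y.tubing = y'.tubing := by
    rw [h₂.tubing_eq_erase, h₁.tubing_eq_erase, h₂'.tubing_eq_erase, h₁'.tubing_eq_erase,
      Finset.erase_right_comm]
  have hp1 : IsParent y.tubing s u₁ := by
    have := h₁.parent
    rw [h₂.tubing_eq] at this
    exact this.of_insert hc1
  have hp2 : IsParent y'.tubing t u₁' := by
    have := h₁'.parent
    rw [h₂'.tubing_eq] at this
    exact this.of_insert hc2
  obtain rfl : u' = u₁ := h₂'.parent.unique (e ▸ hp1)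
  obtain rfl : u = u₁' := h₂.parent.unique (e ▸ hp2)
  have hws : ∀ w ∈ insert Finset.univ y.tubing, w ≠ s := by
    rintro w hw rfl
    rcases Finset.mem_insert.1 hw with rfl | hw
    · exact x.isTubing.univ_notMem h₁.mem
    · exact h₂'.notMem (e ▸ hw)
  have hwt : ∀ w ∈ insert Finset.univ y.tubing, w ≠ t := by
    rintro w hw rfl
    rcases Finset.mem_insert.1 hw with rfl | hw
    · exact x.isTubing.univ_notMem h₁'.mem
    · exact h₂.notMem hw
  refine ext_listing e fun w hw => ?_
  obtain ⟨ls, hls⟩ := (x.blocks s).exists_isListing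
  obtain ⟨lt, hlt⟩ := (x.blocks t).exists_isListing
  obtain ⟨l, hl⟩ := (x.blocks w).exists_isListing
  have hzt : (z.blocks t).IsListing lt := by
    rwa [← h₁.blocks_eq t hne.symm fun h => hc1 h.symm]
  have hzs : (z'.blocks s).IsListing ls := by
    rwa [← h₁'.blocks_eq s hne fun h => hc2 h.symm]
  by_cases hwu : w = u
  · by_cases hwu' : w = u'
    · subst hwu hwu'
      have g1 := h₂.listing _ _ (h₁.listing _ _ hl hls) hzt
      have g2 := h₂'.listing _ _ (h₁'.listing _ _ hl hlt) hzs
      rw [List.append_assoc] at g1 g2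
      -- Here `s` and `t` have the same parent, and the two orders of removal append their colors in
      -- opposite orders. By `sep_siblings_le` the outer colors of the merged core end within the
      -- parent's own colors `l`, so the order does not matter.
      refine ⟨_, g1, g2.perm_suffix List.perm_append_comm ?_⟩
      have hw' : w ∈ insert Finset.univ x.tubing := by
        rw [h₁.tubing_eq, h₂.tubing_eq]
        simp only [Finset.mem_insert] at hw ⊢
        tauto
      have hx : x.tubing = insert s (insert t y.tubing) := by rw [h₁.tubing_eq, h₂.tubing_eq]
      have hsep := sep_siblings_le (hx ▸ x.isTubing) (by
          rw [← h₂.tubing_eq]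
          exact h₁.notMem) h₂.notMem hp1 h₂.parent (fun h => ?_) (fun h => ?_)
          (hx ▸ x.coreNodes_nonempty (Finset.mem_insert_of_mem h₁.mem))
          (hx ▸ x.coreNodes_nonempty (Finset.mem_insert_of_mem h₁'.mem))
      · rw [← hx] at hsep
        have hlen := length_listing hw' hl
        have ho := y'.outer_length_eq (e ▸ hw)
        rw [← e] at ho
        have hcol : (x.blocks w).color.toList.length = (y'.blocks w).color.toList.length := by
          refine length_toList_color (color_isSome_congr ?_)
          rw [hx, ← e]
          simp [hws w hw, hwt w hw]
        have := (x.coreNodes_nonempty hw').card_pos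
        omega
      · exact h₂.parent.2.1.2 (h₁.parent.2.2 t (by rw [h₂.tubing_eq]; simp) h)
      · exact hp1.2.1.2 (h₁'.parent.2.2 s (by rw [h₂'.tubing_eq]; simp) h)
    · subst hwu
      refine ⟨l ++ lt, h₂.listing _ _ ?_ hzt, ?_⟩
      · rwa [← h₁.blocks_eq w (hws w hw) hwu']
      · rw [← h₂'.blocks_eq' (e ▸ hw) hwu']
        exact h₁'.listing _ _ hl hlt
  · by_cases hwu' : w = u'
    · subst hwu'
      refine ⟨l ++ ls, ?_, h₂'.listing _ _ ?_ hzs⟩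
      · rw [← h₂.blocks_eq' hw hwu]
        exact h₁.listing _ _ hl hls
      · rwa [← h₁'.blocks_eq w (hwt w hw) hwu]
    · refine ⟨l, ?_, ?_⟩
      · rwa [← h₂.blocks_eq' hw hwu, ← h₁.blocks_eq w (hws w hw) hwu']
      · rwa [← h₂'.blocks_eq' (e ▸ hw) hwu', ← h₁'.blocks_eq w (hwt w hw) hwu]

theorem tubing_subset_of_le (h : x ≤ y) : y.tubing ⊆ x.tubing := by
  induction h with
  | refl => exact Finset.Subset.refl _
  | tail _ h ih =>
    obtain ⟨t, u, h⟩ := addTube_iff.1 h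
    refine Finset.Subset.trans ?_ ih
    rw [h.tubing_eq]
    exact Finset.subset_insert _ _

/-- Removals commute, so the removal of `s` can be pulled to the front of a chain of removals from
`x` to `y`. -/
theorem Removes.le_of_le (h : Removes x z s u) (hxy : x ≤ y) (hs : s ∉ y.tubing) : z ≤ y := by
  change Relation.ReflTransGen AddTube x y at hxy
  induction hxy using Relation.ReflTransGen.head_induction_on generalizing z u with
  | refl => exact absurd h.mem hs
  | @head x w hxw hwy ih =>
    obtain ⟨t, u', hw⟩ := addTube_iff.1 hxw
    by_cases hst : s = t
    · subst hst
      rw [h.unique hw]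
      exact hwy
    · have hsw : s ∈ w.tubing := by
        rw [hw.tubing_eq_erase]
        exact Finset.mem_erase.2 ⟨hst, h.mem⟩
      have htz : t ∈ z.tubing := by
        rw [h.tubing_eq_erase]
        exact Finset.mem_erase.2 ⟨fun e => hst e.symm, hw.mem⟩
      obtain ⟨v, _, hv⟩ := exists_removes hsw
      obtain ⟨v', _, hv'⟩ := exists_removes htz
      rw [hw.comm (fun e => hst e.symm) hv h hv'] at hv
      exact hv'.le.trans (ih hv)

/-- Above a template, the order is reverse inclusion of tubings. -/
theorem le_of_le_of_subset (hxy : x ≤ y) (hxz : x ≤ z) (h : z.tubing ⊆ y.tubing) : y ≤ z := by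
  change Relation.ReflTransGen AddTube x y at hxy
  induction hxy using Relation.ReflTransGen.head_induction_on with
  | refl => exact hxz
  | head hxw hwy ih =>
    obtain ⟨t, u', hw⟩ := addTube_iff.1 hxw
    exact ih (hw.le_of_le hxz fun ht => hw.notMem (tubing_subset_of_le hwy (h ht)))

theorem eq_of_le_of_le (hxy : x ≤ y) (hxz : x ≤ z) (h : y.tubing = z.tubing) : y = z :=
  (le_of_le_of_subset hxy hxz h.symm.subset).antisymm (le_of_le_of_subset hxz hxy h.subset)

/-- Together with `le_of_le_of_subset` this identifies the templates above `x` with the subsets of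
its tubing. -/
theorem exists_ge_of_subset (x : ColorTemplate G c) {T : Finset (Finset V)} (hT : T ⊆ x.tubing) :
    ∃ y, x ≤ y ∧ y.tubing = T := by
  induction h : (x.tubing \ T).card generalizing x with
  | zero =>
    rw [Finset.card_eq_zero, Finset.sdiff_eq_empty_iff_subset] at h
    exact ⟨x, le_rfl, h.antisymm hT⟩
  | succ n ih =>
    obtain ⟨t, ht⟩ := Finset.card_pos.1 (by omega : 0 < (x.tubing \ T).card)
    rw [Finset.mem_sdiff] at ht
    obtain ⟨z, u, hz⟩ := exists_removes ht.1
    have hTz : T ⊆ z.tubing := by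
      rw [hz.tubing_eq_erase]
      exact Finset.subset_erase.2 ⟨hT, ht.2⟩
    obtain ⟨y, hzy, hy⟩ := ih z hTz (by
      rw [hz.tubing_eq_erase, Finset.erase_sdiff_comm, Finset.card_erase_of_mem (by simp [ht])]
      omega)
    exact ⟨y, hz.le.trans hzy, hy⟩

end ColorTemplate

end ColorfulGA

namespace ColorfulGA

/-! ### Sorting lists by adjacent swaps. -/

section Lists

variable {β : Type*} {l l' m m' p q s : List β} {a b v w x : β}

/-- `v` occurs before `w` in the list. -/
def Before : List β → β → β → Prop
  | [], _, _ => False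
  | a :: l, v, w => (v = a ∧ w ∈ l) ∨ Before l v w

@[simp] theorem before_nil : ¬ Before [] v w := id

@[simp] theorem before_cons : Before (a :: l) v w ↔ (v = a ∧ w ∈ l) ∨ Before l v w := Iff.rfl

@[simp] theorem before_append :
    Before (l ++ l') v w ↔ Before l v w ∨ (v ∈ l ∧ w ∈ l') ∨ Before l' v w := by
  induction l with
  | nil => simp
  | cons a l ih =>
    simp only [List.cons_append, before_cons, ih, List.mem_append, List.mem_cons]
    tauto

theorem Before.mem_left (h : Before l v w) : v ∈ l := by
  induction l with
  | nil => exact h.elim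
  | cons a l ih =>
    rcases h with ⟨rfl, _⟩ | h
    · simp
    · simp [ih h]

theorem Before.mem_right (h : Before l v w) : w ∈ l := by
  induction l with
  | nil => exact h.elim
  | cons a l ih =>
    rcases h with ⟨_, h⟩ | h
    · simp [h]
    · simp [ih h]

theorem before_or_before (hv : v ∈ l) (hw : w ∈ l) (hne : v ≠ w) : Before l v w ∨ Before l w v := by
  induction l with
  | nil => simp at hv
  | cons a l ih =>
    simp only [List.mem_cons] at hv hw
    simp only [before_cons]
    rcases hv with rfl | hv
    · exact .inl (.inl ⟨rfl, hw.resolve_left hne.symm⟩)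
    · rcases hw with rfl | hw
      · exact .inr (.inl ⟨rfl, hv⟩)
      · exact (ih hv hw).imp .inr .inr

theorem Before.asymm (hl : l.Nodup) (h : Before l v w) : ¬ Before l w v := by
  induction l with
  | nil => exact h.elim
  | cons a l ih =>
    rw [List.nodup_cons] at hl
    rintro (⟨rfl, h'⟩ | h')
    · rcases h with ⟨rfl, h⟩ | h
      · exact hl.1 h
      · exact hl.1 h.mem_right
    · rcases h with ⟨rfl, h⟩ | h
      · exact hl.1 h'.mem_right
      · exact ih hl.2 h h'

theorem Before.ne (hl : l.Nodup) (h : Before l v w) : v ≠ w := by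
  rintro rfl
  exact h.asymm hl h

theorem Before.trans (hl : l.Nodup) (h : Before l v w) (h' : Before l w x) : Before l v x := by
  induction l with
  | nil => exact h.elim
  | cons a l ih =>
    rw [List.nodup_cons] at hl
    rcases h with ⟨rfl, h⟩ | h
    · rcases h' with ⟨rfl, h'⟩ | h'
      · exact absurd h hl.1
      · exact .inl ⟨rfl, h'.mem_right⟩
    · rcases h' with ⟨rfl, h'⟩ | h'
      · exact absurd h.mem_right hl.1
      · exact .inr (ih hl.2 h h')

theorem before_iff_mem_right (h : (p ++ v :: s).Nodup) : Before (p ++ v :: s) v w ↔ w ∈ s := by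
  rw [List.nodup_append, List.nodup_cons] at h
  have hv : v ∉ p := fun hv => h.2.2 v hv v (by simp) rfl
  simp only [before_append, before_cons]
  constructor
  · rintro (h' | h' | h' | h')
    · exact absurd h'.mem_left hv
    · exact absurd h'.1 hv
    · exact h'.2
    · exact absurd h'.mem_left h.2.1.1
  · exact fun h' => .inr (.inr (.inl ⟨trivial, h'⟩))

/-- A swap of two adjacent entries that brings them into their order in `l'`. -/
def SwapToward (l' m m' : List β) : Prop :=
  ∃ p a b s, m = p ++ a :: b :: s ∧ m' = p ++ b :: a :: s ∧ Before l' b a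

/-- Bubble sort: the head of `l'` is carried to the front, then the rest is sorted. -/
theorem reflTransGen_swapToward (h : l.Perm l') :
    Relation.ReflTransGen (SwapToward l') l l' := by
  induction l' generalizing l with
  | nil => rw [List.perm_nil.1 h]
  | cons a l' ih =>
    obtain ⟨p, q, rfl⟩ := List.append_of_mem (h.symm.subset (List.mem_cons_self ..) : a ∈ l)
    have h' : (p ++ q).Perm l' := by
      have := List.perm_middle.symm.trans h
      exact (List.perm_cons a).1 this
    have h1 : ∀ p q : List β, (∀ x ∈ p, x ∈ l') →
        Relation.ReflTransGen (SwapToward (a :: l')) (p ++ a :: q) (a :: (p ++ q)) := by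
      intro p
      induction p using List.reverseRecOn with
      | nil => exact fun q _ => .refl
      | append_singleton p x ihp =>
        intro q hx
        refine .head ⟨p, x, a, q, by simp, rfl, .inl ⟨rfl, hx x (by simp)⟩⟩ ?_
        simpa using ihp (x :: q) fun y hy => hx y (by simp [hy])
    refine (h1 p q fun x hx => h'.subset (by simp [hx])).trans ?_
    have h2 := ih h'
    refine Relation.ReflTransGen.lift (a :: ·) ?_ _ _ h2
    rintro _ _ ⟨p, x, y, s, rfl, rfl, hb⟩
    exact ⟨a :: p, x, y, s, rfl, rfl, .inr hb⟩

theorem SwapToward.perm (h : SwapToward l' m m') : m.Perm m' := by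
  obtain ⟨p, a, b, s, rfl, rfl, -⟩ := h
  exact (List.Perm.swap b a s).append_left p

theorem Before.swap (h : Before (p ++ a :: b :: s) v w) (hne : ¬ (v = a ∧ w = b)) :
    Before (p ++ b :: a :: s) v w := by
  simp only [before_append, before_cons, List.mem_cons] at h ⊢
  tauto

/-- A pair on which the list and its target agree is never reversed. Therefore admissibility
survives sorting toward an admissible order. -/
theorem Before.swapToward (hl : l'.Nodup) (h : SwapToward l' m m') (h1 : Before m v w)
    (h2 : Before l' v w) : Before m' v w := by
  obtain ⟨p, a, b, s, rfl, rfl, hb⟩ := h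
  refine h1.swap ?_
  rintro ⟨rfl, rfl⟩
  exact h2.asymm hl hb

theorem before_of_reflTransGen (hl : l'.Nodup) (h : Relation.ReflTransGen (SwapToward l') l m)
    (h1 : Before l v w) (h2 : Before l' v w) : Before m v w := by
  induction h with
  | refl => exact h1
  | tail _ hs ih => exact ih.swapToward hl hs h2

theorem map_eq_map_some_filterMap {γ : Type*} {f : β → Option γ} {l : List β}
    (h : l.length ≤ (l.filterMap f).length) : l.map f = (l.filterMap f).map some := by
  induction l with
  | nil => rfl
  | cons a l ih =>
    have := List.length_filterMap_le f l
    cases hf : f a with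
    | none =>
      rw [List.filterMap_cons_none hf, List.length_cons] at h
      omega
    | some b =>
      rw [List.filterMap_cons_some hf] at h ⊢
      simp only [List.length_cons, Nat.add_le_add_iff_right] at h
      simp [hf, ih h]

end Lists

/-! ### Node orders and their maximal tubings. -/

section Orders

variable {V : Type*} {σ σ' p s : List V} {a b v w : V}

/-- A list of all nodes without repetitions. -/
structure IsOrder (σ : List V) : Prop where
  nodup : σ.Nodup
  mem : ∀ v, v ∈ σ

theorem IsOrder.perm (h : IsOrder σ) (h' : σ.Perm σ') : IsOrder σ' :=
  ⟨h'.nodup_iff.1 h.nodup, fun v => h'.subset (h.mem v)⟩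

theorem IsOrder.before_or (h : IsOrder σ) (hne : v ≠ w) : Before σ v w ∨ Before σ w v :=
  before_or_before (h.mem v) (h.mem w) hne

theorem IsOrder.perm_of_isOrder (h : IsOrder σ) (h' : IsOrder σ') : σ.Perm σ' :=
  (List.perm_ext_iff_of_nodup h.nodup h'.nodup).2 fun v => by simp [h.mem v, h'.mem v]

variable [Fintype V] {G : SimpleGraph V} {T : Finset (Finset V)} {t : Finset V}

theorem IsOrder.length_eq (h : IsOrder σ) : σ.length = Fintype.card V := by
  classical
  rw [← List.toFinset_card_of_nodup h.nodup, ← Finset.card_univ]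
  congr 1
  ext v
  simp [h.mem v]

/-- The nodes joined to `v` after removal of the nodes before `v`. -/
noncomputable def tubeOf (G : SimpleGraph V) (σ : List V) (v : V) : Finset V :=
  comp G {w | w = v ∨ Before σ v w} v

theorem tubeOf_append (h : (p ++ v :: s).Nodup) :
    tubeOf G (p ++ v :: s) v = comp G {w | w ∈ v :: s} v := by
  rw [tubeOf]
  simp only [before_iff_mem_right h, List.mem_cons]

theorem mem_tubeOf_self : v ∈ tubeOf G σ v := mem_comp.2 (.refl (.inl rfl))

theorem eq_or_before_of_mem_tubeOf (h : w ∈ tubeOf G σ v) : w = v ∨ Before σ v w :=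
  (mem_comp.1 h).mem_right

theorem Before.notMem_tubeOf (hσ : IsOrder σ) (h : Before σ v w) : v ∉ tubeOf G σ w := by
  intro h'
  rcases eq_or_before_of_mem_tubeOf h' with e | h'
  · exact h.ne hσ.nodup e
  · exact h.asymm hσ.nodup h'

theorem after_subset (hσ : IsOrder σ) (h : Before σ v w) :
    {x | x = w ∨ Before σ w x} ⊆ {x | x = v ∨ Before σ v x} := by
  rintro x (rfl | hx)
  · exact .inr h
  · exact .inr (h.trans hσ.nodup hx)

theorem tubeOf_ssubset (hσ : IsOrder σ) (h : Before σ v w) (hw : w ∈ tubeOf G σ v) :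
    tubeOf G σ w ⊂ tubeOf G σ v := by
  refine Finset.ssubset_iff_subset_ne.2 ⟨fun x hx => ?_, fun e => ?_⟩
  · exact mem_comp.2 ((mem_comp.1 hw).trans ((mem_comp.1 hx).mono (after_subset hσ h)))
  · exact h.notMem_tubeOf hσ (by rw [e]; exact mem_tubeOf_self)

/-- The two tubes lie in different components of the set of nodes not before `v`. -/
theorem notMem_of_mem_tubeOf (hσ : IsOrder σ) (h : Before σ v w) (hw : w ∉ tubeOf G σ v) {x y : V}
    (hx : x ∈ tubeOf G σ v) (hy : y ∈ tubeOf G σ w) : x ≠ y ∧ ¬ G.Adj x y := by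
  have hy' := (mem_comp.1 hy).mono (after_subset hσ h)
  constructor
  · rintro rfl
    exact hw (mem_comp.2 ((mem_comp.1 hx).trans hy'.symm))
  · intro hxy
    exact hw (mem_comp.2 (((mem_comp.1 hx).tail hxy hy'.mem_right).trans hy'.symm))

theorem tubeOf_injective (hσ : IsOrder σ) : Function.Injective (tubeOf G σ) := by
  intro v w h
  by_contra hne
  rcases hσ.before_or hne with h' | h'
  · exact h'.notMem_tubeOf hσ (by rw [← h]; exact mem_tubeOf_self)
  · exact h'.notMem_tubeOf hσ (by rw [h]; exact mem_tubeOf_self)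

theorem tubeOf_head (hG : G.Connected) (hσ : IsOrder (v :: s)) :
    tubeOf G (v :: s) v = Finset.univ := by
  have h := tubeOf_append (G := G) (p := []) hσ.nodup
  rw [List.nil_append] at h
  have h2 : {w | w ∈ v :: s} = Set.univ := Set.eq_univ_of_forall hσ.mem
  rw [h, h2]
  ext w
  simp [mem_comp, joined_univ hG]

variable [DecidableEq V]

/-- The tubing of an order of the nodes. -/
noncomputable def tubesOf (G : SimpleGraph V) (σ : List V) : Finset (Finset V) :=
  (Finset.univ.image (tubeOf G σ)).erase Finset.univ

theorem mem_tubesOf : t ∈ tubesOf G σ ↔ t ≠ Finset.univ ∧ ∃ v, tubeOf G σ v = t := by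
  simp [tubesOf]

theorem insert_tubesOf (hG : G.Connected) (hσ : IsOrder σ) :
    insert Finset.univ (tubesOf G σ) = Finset.univ.image (tubeOf G σ) := by
  rw [tubesOf, Finset.insert_erase]
  have := hG.nonempty
  cases σ with
  | nil => exact absurd (hσ.mem (Classical.arbitrary V)) (by simp)
  | cons v s => exact Finset.mem_image.2 ⟨v, Finset.mem_univ _, tubeOf_head hG hσ⟩

theorem tubeOf_mem (hG : G.Connected) (hσ : IsOrder σ) (v : V) :
    tubeOf G σ v ∈ insert Finset.univ (tubesOf G σ) := by
  rw [insert_tubesOf hG hσ]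
  exact Finset.mem_image_of_mem _ (Finset.mem_univ _)

theorem isTubing_tubesOf (hσ : IsOrder σ) : IsTubing G (tubesOf G σ) := by
  constructor
  · intro t ht
    obtain ⟨hne, v, rfl⟩ := mem_tubesOf.1 ht
    exact isTube_iff.2 ⟨hne, ⟨v, mem_tubeOf_self⟩, fun a ha b hb => joined_comp ha hb⟩
  · intro s hs t ht hst
    obtain ⟨-, v, rfl⟩ := mem_tubesOf.1 hs
    obtain ⟨-, w, rfl⟩ := mem_tubesOf.1 ht
    have key : ∀ v w, Before σ v w → TubesCompatible G (tubeOf G σ v) (tubeOf G σ w) := by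
      intro v w h
      by_cases hw : w ∈ tubeOf G σ v
      · exact .inr (.inl (tubeOf_ssubset hσ h hw))
      · refine .inr (.inr ⟨Finset.disjoint_left.2 fun x hx hx' => ?_, fun x hx y hy => ?_⟩)
        · exact (notMem_of_mem_tubeOf hσ h hw hx hx').1 rfl
        · exact (notMem_of_mem_tubeOf hσ h hw hx hy).2
    rcases hσ.before_or (fun e : v = w => hst (by rw [e])) with h | h
    · exact key _ _ h
    · exact (key _ _ h).symm

theorem card_tubesOf (hG : G.Connected) (hσ : IsOrder σ) :
    (tubesOf G σ).card + 1 = Fintype.card V := by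
  rw [← Finset.card_insert_of_notMem (isTubing_tubesOf hσ).univ_notMem, insert_tubesOf hG hσ,
    Finset.card_image_of_injective _ (tubeOf_injective hσ), Finset.card_univ]

/-- A tube around `v` is that of `v` or of an earlier node, and in the latter case it contains that
of `v`. -/
theorem home_tubesOf (hG : G.Connected) (hσ : IsOrder σ) (v : V) :
    home (tubesOf G σ) v = tubeOf G σ v := by
  refine (home_subset (tubeOf_mem hG hσ v) mem_tubeOf_self).antisymm fun w hw => ?_
  rw [home, Finset.mem_filter]
  refine ⟨Finset.mem_univ _, fun t ht hv => ?_⟩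
  obtain ⟨-, x, rfl⟩ := mem_tubesOf.1 ht
  rcases eq_or_before_of_mem_tubeOf hv with rfl | h
  · exact hw
  · exact (tubeOf_ssubset hσ h hv).subset hw

theorem coreNodes_tubesOf (hG : G.Connected) (hσ : IsOrder σ) (v : V) :
    coreNodes (tubesOf G σ) (tubeOf G σ v) = {v} := by
  ext w
  rw [(isTubing_tubesOf hσ).mem_coreNodes_iff (tubeOf_mem hG hσ v), home_tubesOf hG hσ,
    (tubeOf_injective hσ).eq_iff, Finset.mem_singleton]

/-- The outer neighbours of each member of `T` come before its nodes. -/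
def Adm (G : SimpleGraph V) (T : Finset (Finset V)) (σ : List V) : Prop :=
  ∀ t ∈ T, ∀ q ∈ t, ∀ p, p ∉ t → (∃ r ∈ t, G.Adj p r) → Before σ p q

/-- Each `t ∈ T` is the tube of its first node `v`: the outer neighbours of `t` come before `v`, so
the component of `v` cannot extend beyond `t`. -/
theorem Adm.subset_tubesOf (hT : IsTubing G T) (hσ : IsOrder σ) (h : Adm G T σ) :
    T ⊆ tubesOf G σ := by
  intro t ht
  refine mem_tubesOf.2 ⟨(hT.1 t ht).1, ?_⟩
  obtain ⟨p, v, s, hps, hv, hp⟩ : ∃ p v s, σ = p ++ v :: s ∧ v ∈ t ∧ ∀ x ∈ p, x ∉ t := by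
    obtain ⟨a, ha⟩ := hT.nonempty ht
    have : ∀ l : List V, a ∈ l → ∃ p v s, l = p ++ v :: s ∧ v ∈ t ∧ ∀ x ∈ p, x ∉ t := by
      intro l
      induction l with
      | nil => simp
      | cons b l ih =>
        intro hal
        by_cases hb : b ∈ t
        · exact ⟨[], b, l, rfl, hb, by simp⟩
        · have hal' : a ∈ l := by
            rcases List.mem_cons.1 hal with rfl | h
            · exact absurd ha hb
            · exact h
          obtain ⟨p, v, s, rfl, hv, hp⟩ := ih hal'
          refine ⟨b :: p, v, s, rfl, hv, ?_⟩
          intro x hx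
          rcases List.mem_cons.1 hx with rfl | hx
          · exact hb
          · exact hp x hx
    exact this σ (hσ.mem a)
  subst hps
  refine ⟨v, ?_⟩
  rw [tubeOf_append hσ.nodup]
  ext x
  rw [mem_comp]
  have hsub : (t : Set V) ⊆ {w | w ∈ v :: s} := by
    intro y hy
    have := hσ.mem y
    rw [List.mem_append] at this
    exact this.resolve_left fun h' => hp y h' hy
  constructor
  · intro hx
    have hcl := hx.of_closed (K := (t : Set V)) (fun y hy z hz hyz => ?_) hv
    · exact hcl.mem_right
    · by_contra hzt
      have h1 := h t ht v hv z hzt ⟨y, hy, hyz.symm⟩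
      have h2 : Before (p ++ v :: s) v z := by
        rw [before_iff_mem_right hσ.nodup]
        rcases List.mem_cons.1 hz with rfl | hz
        · exact absurd hv hzt
        · exact hz
      exact h1.asymm hσ.nodup h2
  · intro hx
    exact ((isTube_iff.1 (hT.1 t ht)).2.2 v hv x hx).mono hsub

theorem adm_of_subset_tubesOf (hσ : IsOrder σ) (h : T ⊆ tubesOf G σ) : Adm G T σ := by
  rintro t ht q hq p hp ⟨r, hr, hpr⟩
  obtain ⟨-, v, rfl⟩ := mem_tubesOf.1 (h ht)
  have hpv : Before σ p v := by
    by_contra hn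
    have hne : p ≠ v := by
      rintro rfl
      exact hp mem_tubeOf_self
    refine hp (mem_comp.2 ((mem_comp.1 hr).tail hpr.symm (.inr ?_)))
    exact (hσ.before_or hne).resolve_left hn
  rcases eq_or_before_of_mem_tubeOf hq with rfl | h'
  · exact hpv
  · exact hpv.trans hσ.nodup h'

/-- The interior of a core may be reordered. -/
theorem Adm.congr (h : Adm G T σ)
    (h' : ∀ x y, home T x ≠ home T y → Before σ x y → Before σ' x y) : Adm G T σ' := by
  rintro t ht q hq p hp ⟨r, hr, hpr⟩
  refine h' p q (fun e => ?_) (h t ht q hq p hp ⟨r, hr, hpr⟩)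
  exact hp (home_subset (Finset.mem_insert_of_mem ht) hq (e ▸ mem_home T p))

/-- Orders by decreasing size of the smallest tube around a node are admissible. -/
theorem adm_of_card (hT : IsTubing G T) (h : ∀ x y, (home T y).card < (home T x).card →
    Before σ x y) : Adm G T σ := by
  rintro t ht q hq p hp ⟨r, hr, hpr⟩
  have ht' := Finset.mem_insert_of_mem (b := (Finset.univ : Finset V)) ht
  have h1 : t ⊂ home T p := hT.ssubset_of_adj (hT.home_mem p) ht' (mem_home T p) hp hr hpr
  exact h p q ((Finset.card_le_card (home_subset ht' hq)).trans_lt (Finset.card_lt_card h1))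

theorem comp_eq_of_not_joined {A : Set V} (h : ¬ Joined G (insert b A) a b) (ha : a ∈ A) :
    comp G (insert b A) a = comp G A a := by
  ext x
  rw [mem_comp, mem_comp]
  refine ⟨fun hx => ?_, fun hx => hx.mono (Set.subset_insert _ _)⟩
  have h1 := hx.of_closed (K := {y | y ∈ A ∧ Joined G (insert b A) a y}) ?_
    ⟨ha, .refl (.inr ha)⟩
  · exact h1.mono fun y hy => hy.1
  · rintro y ⟨hy, hj⟩ z hz hyz
    refine ⟨?_, hj.tail hyz hz⟩
    rcases hz with rfl | hz
    · exact absurd (hj.tail hyz (.inl rfl)) h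
    · exact hz

theorem after_swap (hva : v ≠ a) (hvb : v ≠ b) :
    {w | w = v ∨ Before (p ++ a :: b :: s) v w} = {w | w = v ∨ Before (p ++ b :: a :: s) v w} := by
  ext w
  simp only [before_append, before_cons, List.mem_cons]
  apply or_congr_right
  simp only [hva, hvb]
  tauto

theorem tubeOf_swap (hva : v ≠ a) (hvb : v ≠ b) :
    tubeOf G (p ++ b :: a :: s) v = tubeOf G (p ++ a :: b :: s) v := by
  rw [tubeOf, tubeOf, after_swap hva hvb]

theorem IsOrder.swap (h : IsOrder (p ++ a :: b :: s)) : IsOrder (p ++ b :: a :: s) :=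
  h.perm ((List.Perm.swap b a s).append_left p)

theorem IsOrder.adjacent_ne (h : IsOrder (p ++ a :: b :: s)) : a ≠ b := by
  rintro rfl
  have := (List.nodup_append.1 h.nodup).2.1
  simp at this

theorem IsOrder.tubeOf_left (h : IsOrder (p ++ a :: b :: s)) :
    tubeOf G (p ++ a :: b :: s) a = comp G {w | w ∈ a :: b :: s} a := tubeOf_append h.nodup

theorem IsOrder.tubeOf_right (h : IsOrder (p ++ a :: b :: s)) :
    tubeOf G (p ++ a :: b :: s) b = comp G {w | w ∈ b :: s} b := by
  have := tubeOf_append (G := G) (p := p ++ [a]) (v := b) (s := s) (by simpa using h.nodup)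
  simpa using this

/-- Swapping adjacent nodes in different components does not change the tubes. -/
theorem tubeOf_swap_of_notMem (h : IsOrder (p ++ a :: b :: s))
    (hb : b ∉ tubeOf G (p ++ a :: b :: s) a) :
    tubeOf G (p ++ b :: a :: s) = tubeOf G (p ++ a :: b :: s) := by
  have hab := h.adjacent_ne
  funext v
  rw [h.tubeOf_left, mem_comp] at hb
  have e1 : {w | w ∈ a :: b :: s} = insert b {w | w ∈ a :: s} := by
    ext w
    simp only [List.mem_cons, Set.mem_insert_iff, Set.mem_ofPred_eq]
    tauto
  have e2 : {w | w ∈ b :: a :: s} = insert b {w | w ∈ a :: s} := by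
    ext w
    simp only [List.mem_cons, Set.mem_insert_iff, Set.mem_ofPred_eq]
  have e3 : {w | w ∈ b :: a :: s} = insert a {w | w ∈ b :: s} := by
    ext w
    simp only [List.mem_cons, Set.mem_insert_iff, Set.mem_ofPred_eq]
    tauto
  rw [e1] at hb
  by_cases hva : v = a
  · subst hva
    rw [h.tubeOf_left, h.swap.tubeOf_right, e1, comp_eq_of_not_joined hb]
    simp
  · by_cases hvb : v = b
    · subst hvb
      rw [h.swap.tubeOf_left, h.tubeOf_right, e3, comp_eq_of_not_joined]
      · rw [← e3, e2]
        exact fun h' => hb h'.symm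
      · simp
    · exact tubeOf_swap hva hvb

theorem tubeOf_swap_of_mem (h : IsOrder (p ++ a :: b :: s))
    (hb : b ∈ tubeOf G (p ++ a :: b :: s) a) :
    tubeOf G (p ++ b :: a :: s) b = tubeOf G (p ++ a :: b :: s) a := by
  rw [h.tubeOf_left, mem_comp] at hb
  rw [h.swap.tubeOf_left, h.tubeOf_left, comp_eq_of_joined hb]
  congr 1
  ext w
  simp only [List.mem_cons, Set.mem_ofPred_eq]
  tauto

/-- After swapping two adjacent joined nodes, no tube separates the second from the first. -/
theorem mem_of_mem_tubesOf_swap (h : IsOrder (p ++ a :: b :: s))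
    (hb : b ∈ tubeOf G (p ++ a :: b :: s) a) {t : Finset V}
    (ht : t ∈ tubesOf G (p ++ b :: a :: s)) (hbt : b ∈ t) : a ∈ t := by
  obtain ⟨-, v, rfl⟩ := mem_tubesOf.1 ht
  have hab : a ∈ tubeOf G (p ++ b :: a :: s) b := by
    rw [tubeOf_swap_of_mem h hb]
    exact mem_tubeOf_self
  rcases eq_or_before_of_mem_tubeOf hbt with e | h'
  · rwa [← e]
  · exact (tubeOf_ssubset h.swap h' hbt).subset hab

/-- The tube of `a` is taken over by `b`, and the tubes of all other nodes are unchanged. -/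
theorem erase_tubesOf_subset_swap (h : IsOrder (p ++ a :: b :: s))
    (hb : b ∈ tubeOf G (p ++ a :: b :: s) a) :
    (tubesOf G (p ++ a :: b :: s)).erase (tubeOf G (p ++ a :: b :: s) b) ⊆
      tubesOf G (p ++ b :: a :: s) := by
  intro t ht
  rw [Finset.mem_erase, mem_tubesOf] at ht
  obtain ⟨h1, h2, v, rfl⟩ := ht
  refine mem_tubesOf.2 ⟨h2, ?_⟩
  by_cases hva : v = a
  · exact ⟨b, by rw [hva]; exact tubeOf_swap_of_mem h hb⟩
  · exact ⟨v, tubeOf_swap hva fun e => h1 (by rw [e])⟩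

/-- Every new tube around `b` contains `a`, while the old one does not, as `a` precedes `b`. A swap
of joined neighbours thus replaces exactly one tube. -/
theorem notMem_tubesOf_swap (h : IsOrder (p ++ a :: b :: s))
    (hb : b ∈ tubeOf G (p ++ a :: b :: s) a) :
    tubeOf G (p ++ a :: b :: s) b ∉ tubesOf G (p ++ b :: a :: s) := by
  intro ht
  have h1 := mem_of_mem_tubesOf_swap h hb ht mem_tubeOf_self
  exact Before.notMem_tubeOf h (by simp) h1

end Orders

end ColorfulGA

namespace ColorfulGA

/-! ### Reading colors along a node order. -/

section Words

variable {V α : Type*} [DecidableEq V] {σ p s : List V} {f : V → Option α} {N M : Finset V}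
  {c : Multiset α}

/-- The colors of the nodes in `N`, in the given order. -/
def word (σ : List V) (f : V → Option α) (N : Finset V) : List α :=
  (σ.filter (· ∈ N)).filterMap f

/-- A coloring of all nodes but the first with the colors of the palette. -/
def IsColoring (c : Multiset α) (σ : List V) (f : V → Option α) : Prop :=
  ∃ w : List α, (w : Multiset α) = c ∧ σ.map f = none :: w.map some

theorem coe_filterMap_eq_sum (l : List V) (hl : l.Nodup) :
    (l.filterMap f : Multiset α) = ∑ v ∈ l.toFinset, ((f v).toList : Multiset α) := by
  rw [List.sum_toFinset _ hl]
  induction l with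
  | nil => rfl
  | cons a l ih =>
    rw [List.nodup_cons] at hl
    rw [List.map_cons, List.sum_cons, ← ih hl.2]
    cases hf : f a with
    | none => simp [List.filterMap_cons_none hf]
    | some b => simp [List.filterMap_cons_some hf]

theorem coe_word (hσ : IsOrder σ) :
    (word σ f N : Multiset α) = ∑ v ∈ N, ((f v).toList : Multiset α) := by
  rw [word, coe_filterMap_eq_sum _ (hσ.nodup.filter _)]
  congr 1
  ext v
  simp [hσ.mem v]

theorem coe_filterMap_order [Fintype V] (hσ : IsOrder σ) :
    (σ.filterMap f : Multiset α) = ∑ v, ((f v).toList : Multiset α) := by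
  rw [coe_filterMap_eq_sum _ hσ.nodup]
  congr 1
  ext v
  simp [hσ.mem v]

theorem word_union (hN : ∀ v ∈ N, v ∉ s) (hM : ∀ v ∈ M, v ∉ p) :
    word (p ++ s) f (N ∪ M) = word (p ++ s) f N ++ word (p ++ s) f M := by
  have h1 : p.filter (· ∈ N ∪ M) = p.filter (· ∈ N) := List.filter_congr fun v hv => by
    have : v ∉ M := fun h => hM v h hv
    simp [this]
  have h2 : s.filter (· ∈ N ∪ M) = s.filter (· ∈ M) := List.filter_congr fun v hv => by
    have : v ∉ N := fun h => hN v h hv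
    simp [this]
  have h3 : p.filter (· ∈ M) = [] := by
    simpa using fun v hv hM' => hM v hM' hv
  have h4 : s.filter (· ∈ N) = [] := by
    simpa using fun v hv hN' => hN v hN' hv
  simp only [word, List.filter_append, h1, h2, h3, h4, List.append_nil, List.nil_append,
    List.filterMap_append]

theorem word_singleton (hσ : IsOrder σ) (v : V) : word σ f {v} = (f v).toList := by
  obtain ⟨p, s, rfl⟩ := List.append_of_mem (hσ.mem v)
  have h := List.nodup_append.1 hσ.nodup
  have h1 : p.filter (· ∈ ({v} : Finset V)) = [] := by
    rw [List.filter_eq_nil_iff]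
    intro w hw
    simpa using h.2.2 w hw v (by simp)
  have h2 : s.filter (· ∈ ({v} : Finset V)) = [] := by
    rw [List.filter_eq_nil_iff]
    intro w hw
    simpa using fun e : w = v => (List.nodup_cons.1 h.2.1).1 (e ▸ hw)
  rw [word, List.filter_append, h1, List.filter_cons_of_pos (by simp), h2]
  cases hf : f v <;> simp [hf]

theorem IsColoring.none_iff {v : V} {σ : List V} (h : IsColoring c (v :: σ) f) : f v = none := by
  obtain ⟨w, -, hw⟩ := h
  simpa using (List.cons_eq_cons.1 hw).1

theorem IsColoring.isSome {v : V} {σ : List V} (h : IsColoring c (v :: σ) f) {x : V} (hx : x ∈ σ) :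
    (f x).isSome := by
  obtain ⟨w, -, hw⟩ := h
  have := List.mem_map_of_mem (f := f) hx
  rw [(List.cons_eq_cons.1 hw).2] at this
  obtain ⟨a, -, ha⟩ := List.mem_map.1 this
  simp [← ha]

theorem IsColoring.coe_filterMap (h : IsColoring c σ f) : (σ.filterMap f : Multiset α) = c := by
  obtain ⟨w, rfl, hw⟩ := h
  have : σ.filterMap f = (σ.map f).filterMap id := by simp [List.filterMap_map]
  rw [this, hw]
  simp [List.filterMap_map]

theorem IsColoring.of_head {v : V} {σ : List V} (hv : f v = none)
    (hc : (((v :: σ).filterMap f : List α) : Multiset α) = c) (hlen : c.card = σ.length) :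
    IsColoring c (v :: σ) f := by
  rw [List.filterMap_cons_none hv] at hc
  refine ⟨σ.filterMap f, hc, ?_⟩
  rw [List.map_cons, hv, map_eq_map_some_filterMap]
  rw [← hlen, ← hc, Multiset.coe_card]

end Words

/-! ### Vertices as colored node orders. -/

section Vertices

open Blocks ColorTemplate

variable {V α : Type*} [Fintype V] [DecidableEq V] {G : SimpleGraph V} {c : Multiset α}
  {x x' y z : ColorTemplate G c} {σ σ' p s : List V} {f f' : V → Option α} {a b : V}

/-- The template with one tube for each node but the first, of the color given by `f`. -/
structure Realizes (x : ColorTemplate G c) (σ : List V) (f : V → Option α) : Prop where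
  tubing_eq : x.tubing = tubesOf G σ
  color_eq : ∀ v, (x.blocks (tubeOf G σ v)).color = f v

/-- One-node cores leave no room for outer and inner blocks. -/
theorem Realizes.isListing (hG : G.Connected) (hσ : IsOrder σ) (h : Realizes x σ f) (v : V) :
    (x.blocks (tubeOf G σ v)).IsListing (f v).toList := by
  have hm : tubeOf G σ v ∈ insert Finset.univ x.tubing := by
    rw [h.tubing_eq]
    exact tubeOf_mem hG hσ v
  have hc : coreNodes x.tubing (tubeOf G σ v) = {v} := by
    rw [h.tubing_eq, coreNodes_tubesOf hG hσ]
  have h1 := x.card_blocks _ hm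
  rw [hc, Finset.card_singleton] at h1
  have h2 : (x.blocks (tubeOf G σ v)).outer = [] := List.length_eq_zero_iff.1 (by omega)
  have h3 : (x.blocks (tubeOf G σ v)).inner = 0 := Multiset.card_eq_zero.1 (by omega)
  exact ⟨[], by rw [h3]; rfl, by rw [h2, h.color_eq]; simp⟩

theorem Realizes.unique (hG : G.Connected) (hσ : IsOrder σ) (h : Realizes x σ f)
    (h' : Realizes x' σ f) : x = x' := by
  refine ext_listing (h.tubing_eq.trans h'.tubing_eq.symm) fun t ht => ?_
  rw [h.tubing_eq, insert_tubesOf hG hσ] at ht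
  obtain ⟨v, -, rfl⟩ := Finset.mem_image.1 ht
  exact ⟨_, h.isListing hG hσ v, h'.isListing hG hσ v⟩

theorem Realizes.congr (h : Realizes x σ f) (h' : tubeOf G σ' = tubeOf G σ) : Realizes x σ' f := by
  refine ⟨?_, ?_⟩
  · rw [h.tubing_eq, tubesOf, tubesOf, h']
  · rw [h']
    exact h.color_eq

theorem sum_image_tubeOf (hG : G.Connected) (hσ : IsOrder σ) {M : Type*} [AddCommMonoid M]
    (g : Finset V → M) :
    ∑ t ∈ insert Finset.univ (tubesOf G σ), g t = ∑ v, g (tubeOf G σ v) := by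
  rw [insert_tubesOf hG hσ, Finset.sum_image fun v _ w _ h => tubeOf_injective hσ h]

theorem Realizes.isColoring (hG : G.Connected) (hσ : IsOrder σ) (h : Realizes x σ f) :
    IsColoring c σ f := by
  have hne := hG.nonempty
  cases σ with
  | nil => exact absurd (hσ.mem (Classical.arbitrary V)) (by simp)
  | cons v s =>
    have hv : f v = none := by
      rw [← h.color_eq, tubeOf_head hG hσ, ← Option.not_isSome_iff_eq_none, x.color_isSome]
      exact x.isTubing.univ_notMem
    have hs : ∀ w ∈ s, (f w).isSome := by
      intro w hw
      rw [← h.color_eq, x.color_isSome, h.tubing_eq, mem_tubesOf]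
      refine ⟨fun e => ?_, w, rfl⟩
      rw [← tubeOf_head hG hσ] at e
      rw [tubeOf_injective hσ e] at hw
      exact (List.nodup_cons.1 hσ.nodup).1 hw
    have hsome : (s.filterMap f).length = s.length := by
      rw [List.length_filterMap_eq_countP, List.countP_eq_length]
      exact hs
    refine ⟨s.filterMap f, ?_, ?_⟩
    · have h1 := x.sum_colors
      rw [h.tubing_eq, sum_image_tubeOf hG hσ] at h1
      rw [← h1, ← List.filterMap_cons_none hv, coe_filterMap_order hσ]
      exact Finset.sum_congr rfl fun w _ => (h.isListing hG hσ w).coe_eq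
    · rw [List.map_cons, hv, map_eq_map_some_filterMap hsome.symm.le]

/-- Distinct nodes have distinct tubes, so `Function.invFun` recovers the node of a tube, whose
color is the word of that tube. The first node has the tube `univ` and the empty word. -/
theorem exists_realizes (hG : G.Connected) (hσ : IsOrder σ) (hf : IsColoring c σ f) :
    ∃ x : ColorTemplate G c, Realizes x σ f := by
  have hne := hG.nonempty
  obtain ⟨v, s, rfl⟩ : ∃ v s, σ = v :: s := by
    cases σ with
    | nil => exact absurd (hσ.mem (Classical.arbitrary V)) (by simp)
    | cons v s => exact ⟨v, s, rfl⟩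
  have hinv := Function.leftInverse_invFun (tubeOf_injective (G := G) hσ)
  have hsome : ∀ w, tubeOf G (v :: s) w ∈ tubesOf G (v :: s) → (f w).isSome := by
    intro w hw
    refine hf.isSome ((List.mem_cons.1 (hσ.mem w)).resolve_left ?_)
    rintro rfl
    exact (mem_tubesOf.1 hw).1 (tubeOf_head hG hσ)
  have hlen : ∀ w, (f w).isSome → (f w).toList.length = 1 := by
    intro w hw
    cases hfw : f w <;> simp_all
  have huniv : Function.invFun (tubeOf G (v :: s)) Finset.univ = v := by
    rw [← tubeOf_head hG hσ, hinv]
  obtain ⟨x, hx, hl⟩ := exists_of_words (c := c) (isTubing_tubesOf (G := G) hσ)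
    (fun t => (f (Function.invFun (tubeOf G (v :: s)) t)).toList)
    (by
      intro t ht
      obtain ⟨-, w, rfl⟩ := mem_tubesOf.1 ht
      rw [hinv]
      intro h
      have := hlen w (hsome w ht)
      rw [h] at this
      simp at this)
    (by
      intro t ht
      obtain ⟨-, w, rfl⟩ := mem_tubesOf.1 ht
      rw [hinv, hlen w (hsome w ht), coreNodes_tubesOf hG hσ, Finset.card_singleton])
    (by
      rw [huniv, hf.none_iff, ← tubeOf_head hG hσ, coreNodes_tubesOf hG hσ]
      simp)
    (by
      rw [sum_image_tubeOf hG hσ, ← hf.coe_filterMap, coe_filterMap_order hσ]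
      exact Finset.sum_congr rfl fun w _ => by rw [hinv])
  refine ⟨x, hx, fun w => ?_⟩
  have h1 := hl _ (tubeOf_mem hG hσ w)
  rw [hinv] at h1
  have h2 := x.color_isSome (tubeOf G (v :: s) w)
  rw [hx] at h2
  obtain ⟨i, -, hi⟩ := h1
  by_cases hw : tubeOf G (v :: s) w ∈ tubesOf G (v :: s)
  · have h3 := hsome w hw
    have h4 := h2.2 hw
    cases hfw : f w with
    | none => simp [hfw] at h3
    | some a =>
      cases hcol : (x.blocks (tubeOf G (v :: s) w)).color with
      | none => simp [hcol] at h4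
      | some b =>
        simp only [hfw, hcol, Option.toList_some, List.cons_append] at hi
        rw [(List.cons_eq_cons.1 hi).1]
  · have h3 := h2.not.2 hw
    rw [Option.not_isSome_iff_eq_none] at h3
    rw [h3]
    have hwv : w = v := by
      by_contra hne
      refine hw (mem_tubesOf.2 ⟨fun e => hne ?_, w, rfl⟩)
      rw [← tubeOf_head hG hσ] at e
      exact tubeOf_injective hσ e
    rw [hwv, hf.none_iff]

/-- Removing tubes in the order of their first nodes concatenates the colors in that order. -/
theorem Realizes.exists_ge_words (hG : G.Connected) (hσ : IsOrder σ) (h : Realizes x σ f)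
    (T : Finset (Finset V)) (p : List V) : ∀ s, σ = p ++ s →
    ∃ z, x ≤ z ∧
      (∀ t, t ∈ z.tubing ↔ t ∈ x.tubing ∧ (t ∈ T ∨ ∃ v ∈ s, tubeOf G σ v = t)) ∧
      ∀ u ∈ insert Finset.univ z.tubing,
        (z.blocks u).IsListing (word σ f (coreNodes z.tubing u)) := by
  induction p using List.reverseRecOn with
  | nil =>
    intro s hs
    refine ⟨x, le_rfl, fun t => ⟨fun ht => ⟨ht, .inr ?_⟩, And.left⟩, fun u hu => ?_⟩
    · rw [h.tubing_eq] at ht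
      obtain ⟨-, v, hv⟩ := mem_tubesOf.1 ht
      refine ⟨v, ?_, hv⟩
      have := hσ.mem v
      rwa [hs] at this
    · rw [h.tubing_eq, insert_tubesOf hG hσ] at hu
      obtain ⟨v, -, rfl⟩ := Finset.mem_image.1 hu
      rw [h.tubing_eq, coreNodes_tubesOf hG hσ, word_singleton hσ]
      exact h.isListing hG hσ v
  | append_singleton p v ih =>
    intro s hs
    obtain ⟨z, hxz, hz, hl⟩ := ih (v :: s) (by simpa using hs)
    by_cases ht : tubeOf G σ v ∈ x.tubing ∧ tubeOf G σ v ∉ T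
    swap
    -- The tube of `v` is universal or belongs to `T`; nothing is removed.
    · refine ⟨z, hxz, fun t => ?_, hl⟩
      rw [hz]
      constructor
      · rintro ⟨h1, h2 | ⟨w, hw, rfl⟩⟩
        · exact ⟨h1, .inl h2⟩
        · rcases List.mem_cons.1 hw with rfl | hw
          · exact ⟨h1, .inl (by tauto)⟩
          · exact ⟨h1, .inr ⟨w, hw, rfl⟩⟩
      · rintro ⟨h1, h2 | ⟨w, hw, rfl⟩⟩
        · exact ⟨h1, .inl h2⟩
        · exact ⟨h1, .inr ⟨w, by simp [hw], rfl⟩⟩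
    · obtain ⟨htx, htT⟩ := ht
      have hs' : σ = p ++ v :: s := by simpa using hs
      have hnd : (p ++ v :: s).Nodup := hs' ▸ hσ.nodup
      have htz : tubeOf G σ v ∈ z.tubing := (hz _).2 ⟨htx, .inr ⟨v, by simp, rfl⟩⟩
      have hvs : v ∉ s := (List.nodup_cons.1 (List.nodup_append.1 hnd).2.1).1
      obtain ⟨y, u, hy⟩ := exists_removes htz
      refine ⟨y, hxz.trans hy.le, fun t => ?_, fun w hw => ?_⟩
      · rw [hy.tubing_eq_erase, Finset.mem_erase, hz]
        constructor
        · rintro ⟨h0, h1, h2 | ⟨w, hw, rfl⟩⟩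
          · exact ⟨h1, .inl h2⟩
          · rcases List.mem_cons.1 hw with rfl | hw
            · exact absurd rfl h0
            · exact ⟨h1, .inr ⟨w, hw, rfl⟩⟩
        · rintro ⟨h1, h2 | ⟨w, hw, rfl⟩⟩
          · exact ⟨by rintro rfl; exact htT h2, h1, .inl h2⟩
          · refine ⟨fun e => hvs ?_, h1, .inr ⟨w, by simp [hw], rfl⟩⟩
            rwa [← tubeOf_injective hσ e]
      · have hzT : IsTubing G (insert (tubeOf G σ v) y.tubing) := hy.tubing_eq ▸ z.isTubing
        by_cases hwu : w = u
        · subst hwu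
          have hwz : w ∈ insert Finset.univ z.tubing := by
            rw [hy.tubing_eq]
            simp only [Finset.mem_insert] at hw ⊢
            tauto
          have hcoremem : ∀ q ∈ s, tubeOf G σ q ∈ insert Finset.univ z.tubing := by
            intro q hq
            by_cases hqu : tubeOf G σ q = Finset.univ
            · simp [hqu]
            · refine Finset.mem_insert_of_mem ((hz _).2 ⟨?_, .inr ⟨q, by simp [hq], rfl⟩⟩)
              rw [h.tubing_eq, mem_tubesOf]
              exact ⟨hqu, q, rfl⟩
          -- The tubes of the nodes after `v` are all still present, so `v` alone is left in the
          -- core of its tube.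
          have hNt : coreNodes z.tubing (tubeOf G σ v) = {v} := by
            refine (Finset.subset_singleton_iff'.2 fun q hq => ?_).antisymm ?_
            · by_contra hne
              rcases eq_or_before_of_mem_tubeOf (coreNodes_subset hq) with e | hb
              · exact hne e
              · have hss := tubeOf_ssubset hσ hb (coreNodes_subset hq)
                have hqs : q ∈ s := by
                  have hb' := hb
                  rw [hs', before_iff_mem_right hnd] at hb'
                  exact hb'
                rcases Finset.mem_insert.1 (hcoremem q hqs) with e | hm
                · rw [e] at hss
                  exact hss.2 (Finset.subset_univ _)
                · exact (mem_coreNodes.1 hq).2 _ hm hss mem_tubeOf_self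
            · obtain ⟨q, hq⟩ := z.coreNodes_nonempty (Finset.mem_insert_of_mem htz)
              rw [Finset.singleton_subset_iff, mem_coreNodes]
              refine ⟨mem_tubeOf_self, fun r hr hrt hvr => ?_⟩
              have hrx := ((hz r).1 hr).1
              rw [h.tubing_eq] at hrx
              have := home_subset (Finset.mem_insert_of_mem hrx) hvr
              rw [home_tubesOf hG hσ] at this
              exact hrt.2 this
          have hcore : coreNodes y.tubing w = coreNodes z.tubing w ∪ {v} := by
            rw [hzT.coreNodes_parent hy.notMem hy.parent, ← hy.tubing_eq, hNt]
          -- A core node `q` of the parent that came after `v` would have a tube containing the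
          -- parent, and hence `v`; but `v` precedes `q`.
          have hNw : ∀ q ∈ coreNodes z.tubing w, q ∉ v :: s := by
            intro q hq hqs
            rcases List.mem_cons.1 hqs with rfl | hqs
            · exact (mem_coreNodes.1 hq).2 _ htz hy.parent.2.1 mem_tubeOf_self
            · have h1 := (z.isTubing.mem_coreNodes_iff hwz).1 hq
              have h2 : w ⊆ tubeOf G σ q := by
                rw [← h1]
                exact home_subset (hcoremem q hqs) mem_tubeOf_self
              have h3 := h2 (hy.parent.2.1.subset mem_tubeOf_self)
              have h4 : Before σ v q := by
                rw [hs', before_iff_mem_right hnd]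
                exact hqs
              exact h4.notMem_tubeOf hσ h3
          rw [hcore]
          have hunion : word σ f (coreNodes z.tubing w ∪ {v}) =
              word σ f (coreNodes z.tubing w) ++ word σ f {v} := by
            rw [hs']
            refine word_union hNw fun q hq => ?_
            rw [Finset.mem_singleton] at hq
            subst hq
            exact fun hqp => (List.nodup_append.1 hnd).2.2 q hqp q (by simp) rfl
          rw [hunion]
          refine hy.listing _ _ (hl w hwz) ?_
          have := hl _ (Finset.mem_insert_of_mem htz)
          rwa [hNt] at this
        · rw [← hy.blocks_eq' hw hwu, ← coreNodes_of_ne_parent hy.parent hw hwu,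
            ← hy.tubing_eq]
          refine hl w ?_
          rw [hy.tubing_eq]
          simp only [Finset.mem_insert] at hw ⊢
          tauto

/-- A vertex lies below `y` if its colors list the colors of each tube of `y`. -/
theorem Realizes.le_iff (hG : G.Connected) (hσ : IsOrder σ) (h : Realizes x σ f) :
    x ≤ y ↔ y.tubing ⊆ tubesOf G σ ∧ ∀ u ∈ insert Finset.univ y.tubing,
      (y.blocks u).IsListing (word σ f (coreNodes y.tubing u)) := by
  have key : y.tubing ⊆ x.tubing → ∃ z, x ≤ z ∧ z.tubing = y.tubing ∧
      ∀ u ∈ insert Finset.univ z.tubing,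
        (z.blocks u).IsListing (word σ f (coreNodes z.tubing u)) := by
    intro hT
    obtain ⟨z, hxz, hz, hl⟩ := h.exists_ge_words hG hσ y.tubing σ [] (by simp)
    refine ⟨z, hxz, ?_, hl⟩
    ext t
    rw [hz]
    simpa using fun ht => hT ht
  constructor
  · intro hxy
    have hT := tubing_subset_of_le hxy
    obtain ⟨z, hxz, hz, hl⟩ := key hT
    rw [← eq_of_le_of_le hxz hxy hz]
    exact ⟨by rw [← h.tubing_eq, hz]; exact hT, hl⟩
  · rintro ⟨hT, hl⟩
    rw [← h.tubing_eq] at hT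
    obtain ⟨z, hxz, hz, hlz⟩ := key hT
    have : z = y := ext_listing hz fun u hu => ⟨_, hlz u hu, hz ▸ hl u (hz ▸ hu)⟩
    exact this ▸ hxz

theorem exists_realizes_le (hG : G.Connected) (hc : c.card + 1 = Fintype.card V)
    (y : ColorTemplate G c) (hσ : IsOrder σ) (hA : Adm G y.tubing σ) :
    ∃ f x, Realizes x σ f ∧ x ≤ y := by
  choose W hW using fun u => (y.blocks u).exists_isListing
  -- The listing of `univ` is padded with a leading `none` for the uncolored first node. Each core
  -- then has as many entries as nodes, and `f` hands them out in the order `σ`.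
  let W' : Finset V → List (Option α) := fun u =>
    if u ∈ y.tubing then (W u).map some else none :: (W u).map some
  let L : Finset V → List V := fun u => σ.filter (· ∈ coreNodes y.tubing u)
  let f : V → Option α := fun v => ((W' (home y.tubing v))[(L (home y.tubing v)).idxOf v]?).join
  have hlen : ∀ u ∈ insert Finset.univ y.tubing, (L u).length = (W' u).length := by
    intro u hu
    have h1 : (L u).length = (coreNodes y.tubing u).card := by
      rw [← List.toFinset_card_of_nodup (hσ.nodup.filter _)]
      congr 1
      ext v
      simp [hσ.mem v]
    have h2 := length_listing hu (hW u)
    rw [h1]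
    by_cases hut : u ∈ y.tubing
    · have h3 := length_color_of_mem hut
      simp only [W', hut, if_true, List.length_map]
      omega
    · have h3 : u = Finset.univ := (Finset.mem_insert.1 hu).resolve_right hut
      have h4 := length_color_univ y
      rw [← h3] at h4
      simp only [W', hut, if_false, List.length_map, List.length_cons]
      omega
  have hmap : ∀ u ∈ insert Finset.univ y.tubing, (L u).map f = W' u := by
    intro u hu
    refine List.ext_getElem (by rw [List.length_map, hlen u hu]) fun i h1 h2 => ?_
    have hi : i < (L u).length := by simpa using h1
    have hmem : (L u)[i] ∈ coreNodes y.tubing u := by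
      have := List.getElem_mem hi
      simpa [L] using (List.mem_filter.1 this).2
    have hh : home y.tubing (L u)[i] = u := (y.isTubing.mem_coreNodes_iff hu).1 hmem
    rw [List.getElem_map]
    simp only [f]
    rw [hh, List.Nodup.idxOf_getElem (hσ.nodup.filter _), List.getElem?_eq_getElem h2]
    rfl
  have hword : ∀ u ∈ insert Finset.univ y.tubing, word σ f (coreNodes y.tubing u) = W u := by
    intro u hu
    have h1 : word σ f (coreNodes y.tubing u) = ((L u).map f).filterMap id := by
      simp [word, L, List.filterMap_map]
    rw [h1, hmap u hu]
    simp only [W']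
    split_ifs <;> simp [List.filterMap_map]
  have hne := hG.nonempty
  obtain ⟨v, s, rfl⟩ : ∃ v s, σ = v :: s := by
    cases σ with
    | nil => exact absurd (hσ.mem (Classical.arbitrary V)) (by simp)
    | cons v s => exact ⟨v, s, rfl⟩
  -- A tube of `y` around the first node would be a tube of `σ` around it, hence all of `univ`.
  have hv : home y.tubing v = Finset.univ := by
    have h1 := hA.subset_tubesOf y.isTubing hσ
    refine (Finset.mem_insert.1 (y.isTubing.home_mem v)).resolve_right fun h2 => ?_
    have h3 := home_subset (Finset.mem_insert_of_mem (h1 h2)) (mem_home y.tubing v)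
    rw [home_tubesOf hG hσ, tubeOf_head hG hσ] at h3
    exact y.isTubing.univ_notMem (Finset.univ_subset_iff.1 h3 ▸ h2)
  have hfv : f v = none := by
    have h1 := hmap Finset.univ (Finset.mem_insert_self _ _)
    have h2 : v ∈ coreNodes y.tubing Finset.univ :=
      (y.isTubing.mem_coreNodes_iff (Finset.mem_insert_self _ _)).2 hv
    simp only [L, W', List.filter_cons, h2, decide_true, if_true, List.map_cons,
      y.isTubing.univ_notMem, if_false] at h1
    exact (List.cons_eq_cons.1 h1).1
  have hcol : IsColoring c (v :: s) f := by
    refine .of_head hfv ?_ ?_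
    · have h1 := Finset.sum_biUnion (f := fun v => ((f v).toList : Multiset α))
        (fun s hs t ht => y.isTubing.disjoint_coreNodes hs ht)
      rw [y.isTubing.biUnion_coreNodes] at h1
      rw [coe_filterMap_order hσ, ← y.sum_colors, h1]
      refine Finset.sum_congr rfl fun u hu => ?_
      rw [← coe_word hσ, hword u hu, (hW u).coe_eq]
    · have := hσ.length_eq
      rw [List.length_cons] at this
      omega
  obtain ⟨x, hx⟩ := exists_realizes hG hσ hcol
  refine ⟨f, x, hx, (hx.le_iff hG hσ).2 ⟨hA.subset_tubesOf y.isTubing hσ, fun u hu => ?_⟩⟩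
  rw [hword u hu]
  exact hW u

/-- Templates have at most `n - 1` tubes; the vertices are those with exactly `n - 1` tubes. -/
theorem card_tubing_lt (x : ColorTemplate G c) : x.tubing.card + 1 ≤ Fintype.card V := by
  rw [← Finset.card_insert_of_notMem x.isTubing.univ_notMem, ← x.isTubing.sum_card_coreNodes,
    Finset.card_eq_sum_ones]
  exact Finset.sum_le_sum fun u hu => (x.coreNodes_nonempty hu).card_pos

theorem exists_realizes_of_card (hG : G.Connected) (hσ : IsOrder σ)
    (hx : x.tubing.card + 1 = Fintype.card V) (hA : Adm G x.tubing σ) : ∃ f, Realizes x σ f := by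
  refine ⟨fun v => (x.blocks (tubeOf G σ v)).color, ?_, fun _ => rfl⟩
  refine Finset.eq_of_subset_of_card_le (hA.subset_tubesOf x.isTubing hσ) ?_
  have := card_tubesOf hG hσ
  omega

theorem Realizes.card (hG : G.Connected) (hσ : IsOrder σ) (h : Realizes x σ f) :
    x.tubing.card + 1 = Fintype.card V := by
  rw [h.tubing_eq, card_tubesOf hG hσ]

/-- Orders that list the cores one after the other, each in a prescribed order. -/
theorem exists_block_order {T : Finset (Finset V)} (hT : IsTubing G T)
    (ord : Finset V → List V) (hord : ∀ u ∈ insert Finset.univ T, (ord u).Nodup)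
    (hmem : ∀ u ∈ insert Finset.univ T, ∀ v, v ∈ ord u ↔ v ∈ coreNodes T u) :
    ∃ σ, IsOrder σ ∧ Adm G T σ ∧ ∀ u ∈ insert Finset.univ T, ∃ p s, σ = p ++ (ord u ++ s) ∧
      (∀ v ∈ p, u.card ≤ (home T v).card) ∧ ∀ v ∈ s, (home T v).card ≤ u.card := by
  let L := (insert Finset.univ T).toList.mergeSort fun s t => decide (t.card ≤ s.card)
  have hperm : L.Perm (insert Finset.univ T).toList := List.mergeSort_perm _ _
  have hLnd : L.Nodup := hperm.nodup_iff.2 (Finset.nodup_toList _)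
  have hLmem : ∀ u, u ∈ L ↔ u ∈ insert Finset.univ T := fun u => by
    rw [hperm.mem_iff, Finset.mem_toList]
  have hLp : L.Pairwise fun s t => t.card ≤ s.card := by
    have := List.pairwise_mergeSort (le := fun s t : Finset V => decide (t.card ≤ s.card))
      (fun a b c => by simpa using fun h1 h2 => h2.trans h1)
      (fun a b => by simpa using le_total _ _) (insert Finset.univ T).toList
    simpa [L] using this
  have hhome : ∀ u ∈ L, ∀ v ∈ ord u, home T v = u := by
    intro u hu v hv
    rw [hLmem] at hu
    exact (hT.mem_coreNodes_iff hu).1 ((hmem u hu v).1 hv)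
  have hσ : IsOrder (L.flatMap ord) := by
    constructor
    · rw [List.nodup_flatMap]
      refine ⟨fun u hu => hord u ((hLmem u).1 hu), ?_⟩
      have := hLnd.pairwise_of_forall_ne (r := fun s t => List.Disjoint (ord s) (ord t))
        fun s hs t ht hst v hv hv' => hst ((hhome s hs v hv).symm.trans (hhome t ht v hv'))
      exact this
    · intro v
      rw [List.mem_flatMap]
      exact ⟨home T v, (hLmem _).2 (hT.home_mem v),
        (hmem _ (hT.home_mem v) v).2 ((hT.mem_coreNodes_iff (hT.home_mem v)).2 rfl)⟩
  have hdec : ∀ u ∈ insert Finset.univ T, ∃ p s, L.flatMap ord = p ++ (ord u ++ s) ∧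
      (∀ v ∈ p, u.card ≤ (home T v).card) ∧ ∀ v ∈ s, (home T v).card ≤ u.card := by
    intro u hu
    obtain ⟨l₁, l₂, hl⟩ := List.append_of_mem ((hLmem u).2 hu)
    refine ⟨l₁.flatMap ord, l₂.flatMap ord, by rw [hl]; simp, fun v hv => ?_, fun v hv => ?_⟩
    · obtain ⟨w, hw, hvw⟩ := List.mem_flatMap.1 hv
      rw [hhome w (by rw [hl]; simp [hw]) v hvw]
      rw [hl] at hLp
      exact (List.pairwise_append.1 hLp).2.2 w hw u (by simp)
    · obtain ⟨w, hw, hvw⟩ := List.mem_flatMap.1 hv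
      rw [hhome w (by rw [hl]; simp [hw]) v hvw]
      rw [hl] at hLp
      exact (List.pairwise_cons.1 (List.pairwise_append.1 hLp).2.1).1 w hw
  refine ⟨_, hσ, adm_of_card hT fun x y hxy => ?_, hdec⟩
  obtain ⟨p, s, hps, hp, hs⟩ := hdec (home T x) (hT.home_mem x)
  have hx : x ∈ ord (home T x) :=
    (hmem _ (hT.home_mem x) x).2 ((hT.mem_coreNodes_iff (hT.home_mem x)).2 rfl)
  have hy := hσ.mem y
  rw [hps] at hy ⊢
  simp only [List.mem_append] at hy
  simp only [before_append]
  rcases hy with hy | hy | hy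
  · exact absurd (hp y hy) (not_le.2 hxy)
  · exact absurd (hhome _ ((hLmem _).2 (hT.home_mem x)) y hy) (by
      intro e
      rw [e] at hxy
      exact lt_irrefl _ hxy)
  · exact .inr (.inr (.inr (.inl ⟨hx, hy⟩)))

theorem exists_order_adm {T : Finset (Finset V)} (hT : IsTubing G T) :
    ∃ σ, IsOrder σ ∧ Adm G T σ := by
  obtain ⟨σ, h1, h2, -⟩ := exists_block_order hT (fun u => (coreNodes T u).toList)
    (fun u _ => Finset.nodup_toList _) fun u _ v => Finset.mem_toList
  exact ⟨σ, h1, h2⟩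

end Vertices

end ColorfulGA

namespace ColorfulGA

/-! ### Exchanges between two sets generate all rearrangements. -/

section Swaps

variable {ι X : Type*} [DecidableEq ι] {f g : ι → X} {B C : Finset ι}

/-- Exchange of the values at a point of `B` and a point of `C`. -/
def CrossSwap (B C : Finset ι) (f g : ι → X) : Prop :=
  ∃ e ∈ B, ∃ e' ∈ C, g = f ∘ Equiv.swap e e'

/-- Two points of the same side are exchanged with the help of a point `r` of the other, by `(p q) =
(p r)(q r)(p r)`. -/
theorem reflTransGen_crossSwap_swap (hB : B.Nonempty) (hC : C.Nonempty) {p q : ι}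
    (hp : p ∈ B ∪ C) (hq : q ∈ B ∪ C) (f : ι → X) :
    Relation.ReflTransGen (CrossSwap B C) f (f ∘ Equiv.swap p q) := by
  have hone : ∀ f : ι → X, ∀ p ∈ B, ∀ q ∈ C,
      Relation.ReflTransGen (CrossSwap B C) f (f ∘ Equiv.swap p q) :=
    fun f p hp q hq => .single ⟨p, hp, q, hq, rfl⟩
  have hone' : ∀ f : ι → X, ∀ p ∈ B, ∀ q ∈ C,
      Relation.ReflTransGen (CrossSwap B C) f (f ∘ Equiv.swap q p) :=
    fun f p hp q hq => by
      rw [Equiv.swap_comm]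
      exact hone f p hp q hq
  by_cases hpq : p = q
  · subst hpq
    rw [Equiv.swap_self]
    exact .refl
  obtain ⟨b, hb⟩ := hB
  obtain ⟨c, hc⟩ := hC
  rw [Finset.mem_union] at hp hq
  have key : ∀ r, r ≠ p → r ≠ q → f ∘ Equiv.swap p q =
      ((f ∘ Equiv.swap p r) ∘ Equiv.swap q r) ∘ Equiv.swap p r := by
    intro r hrp hrq
    rw [Function.comp_assoc, Function.comp_assoc, ← Equiv.coe_trans, ← Equiv.coe_trans]
    congr 2
    ext x
    simp only [Equiv.trans_apply, Equiv.swap_apply_def]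
    split_ifs <;> simp_all
  rcases hp with hp | hp <;> rcases hq with hq | hq
  · by_cases hcp : c = p
    · exact hone' f q hq p (hcp ▸ hc)
    by_cases hcq : c = q
    · exact hone f p hp q (hcq ▸ hc)
    rw [key c hcp hcq]
    exact ((hone _ p hp c hc).trans (hone _ q hq c hc)).trans (hone _ p hp c hc)
  · exact hone f p hp q hq
  · exact hone' f q hq p hp
  · by_cases hbp : b = p
    · exact hone f p (hbp ▸ hb) q hq
    by_cases hbq : b = q
    · exact hone' f q (hbq ▸ hb) p hp
    rw [key b hbp hbq]
    exact ((hone' _ b hb p hp).trans (hone' _ b hb q hq)).trans (hone' _ b hb p hp)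

/-- Two functions with the same values on `B ∪ C`, counted with multiplicity, differ by exchanges
across `B` and `C`. -/
theorem exists_reflTransGen_crossSwap (hB : B.Nonempty) (hC : C.Nonempty) (f g : ι → X)
    (h : (B ∪ C).val.map f = (B ∪ C).val.map g) :
    ∃ f', Relation.ReflTransGen (CrossSwap B C) f f' ∧ (∀ v ∈ B ∪ C, f' v = g v) ∧
      ∀ v, v ∉ B ∪ C → f' v = f v := by
  classical
  induction hn : ((B ∪ C).filter fun v => f v ≠ g v).card using Nat.strong_induction_on
    generalizing f with
  | _ n ih =>
  by_cases hD : ∃ p ∈ B ∪ C, f p ≠ g p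
  swap
  · push Not at hD
    exact ⟨f, .refl, hD, fun _ _ => rfl⟩
  obtain ⟨p, hp, hpne⟩ := hD
  -- The places of agreement cancel, so the value `g p` is taken by `f` at another place `q` of
  -- disagreement. Swapping `p` and `q` mends `p` and spoils nothing.
  have hcancel : (((B ∪ C).filter fun v => f v ≠ g v).val.map f) =
      (((B ∪ C).filter fun v => f v ≠ g v).val.map g) := by
    have h1 := Multiset.filter_add_not (fun v => f v ≠ g v) (B ∪ C).val
    rw [← h1, Multiset.map_add, Multiset.map_add] at h
    have h2 : Multiset.map f (Multiset.filter (fun v => ¬ (f v ≠ g v)) (B ∪ C).val) =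
        Multiset.map g (Multiset.filter (fun v => ¬ (f v ≠ g v)) (B ∪ C).val) := by
      refine Multiset.map_congr rfl fun v hv => ?_
      simpa using (Multiset.mem_filter.1 hv).2
    rw [h2] at h
    exact add_right_cancel h
  have hgp : g p ∈ (((B ∪ C).filter fun v => f v ≠ g v).val.map f) := by
    rw [hcancel]
    exact Multiset.mem_map_of_mem g (Finset.mem_filter.2 ⟨hp, hpne⟩)
  obtain ⟨q, hq, hqp⟩ := Multiset.mem_map.1 hgp
  have hq' := Finset.mem_filter.1 hq
  have hpq : p ≠ q := by
    rintro rfl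
    exact hpne hqp
  have hS : (B ∪ C).val.map (f ∘ Equiv.swap p q) = (B ∪ C).val.map f := by
    have h1 : (B ∪ C).map (Equiv.swap p q).toEmbedding = B ∪ C := by
      refine Finset.eq_of_subset_of_card_le (fun v hv => ?_) (by rw [Finset.card_map])
      obtain ⟨w, hw, rfl⟩ := Finset.mem_map.1 hv
      simp only [Equiv.coe_toEmbedding, Equiv.swap_apply_def]
      split_ifs
      exacts [hq'.1, hp, hw]
    conv_rhs => rw [← h1]
    simp
  obtain ⟨f', h1, h2, h3⟩ := ih _ (by
      rw [← hn]
      refine Finset.card_lt_card (Finset.ssubset_iff_subset_ne.2 ⟨fun v hv => ?_, fun e => ?_⟩)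
      · rw [Finset.mem_filter] at hv ⊢
        refine ⟨hv.1, ?_⟩
        by_cases hvp : v = p
        · rw [hvp]
          exact hpne
        by_cases hvq : v = q
        · rw [hvq]
          exact hq'.2
        have := hv.2
        rwa [Function.comp_apply, Equiv.swap_apply_of_ne_of_ne hvp hvq] at this
      · have : p ∈ (B ∪ C).filter fun v => f v ≠ g v := Finset.mem_filter.2 ⟨hp, hpne⟩
        rw [← e, Finset.mem_filter] at this
        simp [hqp] at this) (f ∘ Equiv.swap p q) (hS.trans h) rfl
  refine ⟨f', (reflTransGen_crossSwap_swap hB hC hp hq'.1 f).trans h1, h2, fun v hv => ?_⟩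
  rw [h3 v hv, Function.comp_apply, Equiv.swap_apply_of_ne_of_ne]
  · rintro rfl
    exact hv hp
  · rintro rfl
    exact hv hq'.1

end Swaps

/-! ### Listing a core along a minimum separator. -/

section Separators

variable {V : Type*} [DecidableEq V] {G : SimpleGraph V} {T : Finset (Finset V)}
  {u : Finset V} {b : V}

/-- `B` can be listed so that each node is joined to `b` by later nodes and `D`. -/
theorem exists_elimination_order (B : Finset V) (D : Set V) (hbB : b ∉ B) (hBD : ∀ x ∈ B, x ∉ D)
    (h : ∀ x ∈ B, Joined G (insert b (B ∪ D)) b x) :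
    ∃ β : List V, β.Nodup ∧ (∀ v, v ∈ β ↔ v ∈ B) ∧
      ∀ x ∈ β, Joined G (insert b (insert x ({w | Before β x w} ∪ D))) b x := by
  have key : ∀ n ≤ B.card, ∃ β : List V, β.Nodup ∧ (∀ v ∈ β, v ∈ B) ∧ β.length = n ∧
      ∀ x ∈ β, Joined G (insert b (insert x ({w | Before β x w} ∪ D))) b x := by
    intro n
    induction n with
    | zero => exact fun _ => ⟨[], by simp⟩
    | succ n ih =>
      intro hn
      obtain ⟨β, hnd, hsub, hlen, hJ⟩ := ih (by omega)
      obtain ⟨y, hyB, hy⟩ : ∃ y ∈ B, y ∉ β := by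
        by_contra hcon
        push Not at hcon
        have := Finset.card_le_card (s := B) (t := β.toFinset) fun v hv => by simpa using hcon v hv
        rw [List.toFinset_card_of_nodup hnd] at this
        omega
      -- The list is built from its end. If no unlisted node could be reached, the nodes reachable
      -- from `b` through `β` and `D` would form a closed set that misses `y`, against `h`.
      obtain ⟨x, hxB, hx, hjx⟩ : ∃ x ∈ B, x ∉ β ∧
          Joined G (insert b (insert x ({w | w ∈ β} ∪ D))) b x := by
        by_contra hcon
        push Not at hcon
        have h1 := (h y hyB).of_closed
          (K := {w | Joined G (insert b ({w | w ∈ β} ∪ D)) b w}) ?_ (.refl (.inl rfl))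
        · rcases h1.mem_right.mem_right with rfl | h2 | h2
          · exact hbB hyB
          · exact hy h2
          · exact hBD y hyB h2
        · intro v hv z hz hvz
          by_cases hzK : z ∈ insert b ({w | w ∈ β} ∪ D)
          · exact hv.tail hvz hzK
          · have hzB : z ∈ B := by
              rcases hz with rfl | hz | hz
              · exact absurd (.inl rfl) hzK
              · exact hz
              · exact absurd (.inr (.inr hz)) hzK
            have hzβ : z ∉ β := fun h' => hzK (.inr (.inl h'))
            refine absurd ?_ (hcon z hzB hzβ)
            refine (hv.mono ?_).tail hvz (.inr (.inl rfl))
            exact Set.insert_subset_insert (Set.subset_insert _ _)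
      refine ⟨x :: β, List.nodup_cons.2 ⟨hx, hnd⟩, ?_, by simp [hlen], ?_⟩
      · intro v hv
        rcases List.mem_cons.1 hv with rfl | hv
        · exact hxB
        · exact hsub v hv
      · intro v hv
        rcases List.mem_cons.1 hv with rfl | hv
        · refine hjx.mono ?_
          refine Set.insert_subset_insert (Set.insert_subset_insert
            (Set.union_subset_union_left _ fun w hw => ?_))
          exact .inl ⟨rfl, hw⟩
        · refine (hJ v hv).mono ?_
          refine Set.insert_subset_insert (Set.insert_subset_insert
            (Set.union_subset_union_left _ fun w hw => ?_))
          exact .inr hw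
  obtain ⟨β, hnd, hsub, hlen, hJ⟩ := key B.card le_rfl
  refine ⟨β, hnd, fun v => ⟨hsub v, fun hv => ?_⟩, hJ⟩
  have : β.toFinset = B := Finset.eq_of_subset_of_card_le (fun v hv => hsub v (by simpa using hv))
    (by rw [List.toFinset_card_of_nodup hnd, hlen])
  rw [← this] at hv
  simpa using hv

variable [Fintype V]

/-- Each node of the core is joined to each node of a minimum separator on its own side. -/
theorem joined_separator_node {A N : Finset V} (hA : A ⊆ N) (hNu : N ⊆ u)
    (hc : A.card = sep G u N) (hb : b ∈ A) {x : V}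
    (hx : x ∈ N \ A) :
    Joined G (insert b {w | Joined G ((u : Set V) \ A) x w}) b x := by
  have hxA : x ∈ (u : Set V) \ A := by
    rw [Finset.mem_sdiff] at hx
    exact ⟨hNu hx.1, hx.2⟩
  have hb' : b ∈ N \ A.erase b := by simp [hA hb]
  have hx' : x ∈ N \ A.erase b := by
    rw [Finset.mem_sdiff] at hx
    simp [hx.1, hx.2]
  have hj := joined_of_card_lt_sep (G := G) (u := u) ((Finset.erase_subset b A).trans hA)
    (by rw [← hc]; exact Finset.card_lt_card (Finset.erase_ssubset hb)) hx' hb'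
  -- By minimality, `A` without `b` does not separate `x` from `b`. So some node on the side of `x`
  -- is adjacent to `b`.
  obtain ⟨w, hw, hwb⟩ : ∃ w, Joined G ((u : Set V) \ A) x w ∧ G.Adj w b := by
    by_contra hcon
    push Not at hcon
    have h1 := hj.of_closed (K := {w | Joined G ((u : Set V) \ A) x w}) ?_ (.refl hxA)
    · exact h1.mem_right.mem_right.2 hb
    · intro y hy z hz hyz
      by_cases hzb : z = b
      · subst hzb
        exact absurd hyz (hcon y hy)
      · refine hy.tail hyz ⟨hz.1, fun hzA => hz.2 ?_⟩
        rw [Finset.mem_coe, Finset.mem_erase]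
        exact ⟨hzb, hzA⟩
  have h2 : Joined G {w | Joined G ((u : Set V) \ A) x w} x w :=
    hw.of_closed (fun y hy z hz hyz => hy.tail hyz hz) (.refl hxA)
  exact ((h2.mono (Set.subset_insert _ _)).tail hwb (.inl rfl)).symm

/-- The nodes of a core that is not complete, listed along a minimum separator. -/
theorem exists_separator_order (hG : G.Connected) (hT : IsTubing G T)
    (hu : u ∈ insert Finset.univ T)
    (h : sep G u (coreNodes T u) + 1 < (coreNodes T u).card) :
    ∃ (A : List V) (b : V) (β γ : List V), (A ++ b :: (β ++ γ)).Nodup ∧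
      (∀ v, v ∈ A ++ b :: (β ++ γ) ↔ v ∈ coreNodes T u) ∧
      A.length + 1 = sep G u (coreNodes T u) ∧ β ≠ [] ∧ γ ≠ [] ∧
      (∀ x ∈ β, Joined G (insert b (insert x ({w | Before β x w} ∪
        ((u : Set V) \ coreNodes T u)))) b x) ∧
      (∀ x ∈ γ, Joined G (insert b (insert x ({w | Before γ x w} ∪
        ((u : Set V) \ coreNodes T u)))) b x) ∧
      ∀ x ∈ β, ∀ y ∈ γ, ¬ Joined G ((u : Set V) \ {w | w ∈ A ∨ w = b}) x y := by
  classical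
  set N := coreNodes T u with hN
  have hNu : N ⊆ u := coreNodes_subset
  obtain ⟨S, hS, hc, hcut | hle⟩ := exists_sep G u N
  swap
  · omega
  obtain ⟨a, ha, a', ha', hna⟩ := hcut
  -- As `u` is connected, the empty set is no cut. Any node of the minimum cut can serve as `b`.
  obtain ⟨b, hb⟩ : S.Nonempty := by
    rw [Finset.nonempty_iff_ne_empty]
    rintro rfl
    refine hna ?_
    simp only [Finset.coe_empty, Set.sdiff_empty]
    exact hT.joined hG hu (hNu (Finset.mem_sdiff.1 ha).1) (hNu (Finset.mem_sdiff.1 ha').1)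
  set D : Set V := (u : Set V) \ N with hD
  -- `B` is the side of `a`; `C` collects all the other sides.
  let B := (N \ S).filter fun w => Joined G ((u : Set V) \ S) a w
  let C := (N \ S).filter fun w => ¬ Joined G ((u : Set V) \ S) a w
  have haA : a ∈ (u : Set V) \ S := by
    rw [Finset.mem_sdiff] at ha
    exact ⟨hNu ha.1, ha.2⟩
  have hside : ∀ w, w ∈ (u : Set V) \ S → w ∈ N \ S ∨ w ∈ D := by
    intro w hw
    by_cases hwN : w ∈ N
    · left
      rw [Finset.mem_sdiff]
      exact ⟨hwN, hw.2⟩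
    · exact .inr ⟨hw.1, hwN⟩
  obtain ⟨β, hβn, hβm, hβJ⟩ := exists_elimination_order (G := G) (b := b) B D
    (by simp [B, hb]) (by
      intro x hx hxD
      exact hxD.2 (Finset.mem_sdiff.1 (Finset.mem_filter.1 hx).1).1) (by
      intro x hx
      have hx' := Finset.mem_filter.1 hx
      refine (joined_separator_node hS hNu hc hb hx'.1).mono
        (Set.insert_subset_insert fun w hw => ?_)
      rcases hside w hw.mem_right with h1 | h1
      · exact .inl (Finset.mem_filter.2 ⟨h1, hx'.2.trans hw⟩)
      · exact .inr h1)
  obtain ⟨γ, hγn, hγm, hγJ⟩ := exists_elimination_order (G := G) (b := b) C D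
    (by simp [C, hb]) (by
      intro x hx hxD
      exact hxD.2 (Finset.mem_sdiff.1 (Finset.mem_filter.1 hx).1).1) (by
      intro x hx
      have hx' := Finset.mem_filter.1 hx
      refine (joined_separator_node hS hNu hc hb hx'.1).mono
        (Set.insert_subset_insert fun w hw => ?_)
      rcases hside w hw.mem_right with h1 | h1
      · exact .inl (Finset.mem_filter.2 ⟨h1, fun h2 => hx'.2 (h2.trans hw.symm)⟩)
      · exact .inr h1)
  have hSet : {w | w ∈ (S.erase b).toList ∨ w = b} = (S : Set V) := by
    ext w
    by_cases hwb : w = b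
    · simp [hwb, hb]
    · simp [hwb]
  refine ⟨(S.erase b).toList, b, β, γ, ?_, ?_, ?_, ?_, ?_, hβJ, hγJ, ?_⟩
  · rw [List.nodup_append, List.nodup_cons, List.nodup_append]
    refine ⟨Finset.nodup_toList _, ⟨?_, hβn, hγn, ?_⟩, ?_⟩
    · simp [hβm, hγm, B, C, hb]
    · rintro x hx y hy rfl
      rw [hβm] at hx
      rw [hγm] at hy
      exact (Finset.mem_filter.1 hy).2 (Finset.mem_filter.1 hx).2
    · rintro x hx y hy rfl
      rw [Finset.mem_toList, Finset.mem_erase] at hx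
      simp only [List.mem_cons, List.mem_append, hβm, hγm, B, C, Finset.mem_filter,
        Finset.mem_sdiff] at hy
      tauto
  · intro v
    simp only [List.mem_append, Finset.mem_toList, Finset.mem_erase, List.mem_cons, hβm, hγm, B, C,
      Finset.mem_filter, Finset.mem_sdiff]
    by_cases hvb : v = b
    · simp [hvb, hS hb]
    · have := @hS v
      tauto
  · rw [Finset.length_toList, Finset.card_erase_add_one hb, hc]
  · have : a ∈ β := (hβm a).2 (Finset.mem_filter.2 ⟨ha, .refl haA⟩)
    exact List.ne_nil_of_mem this
  · have : a' ∈ γ := (hγm a').2 (Finset.mem_filter.2 ⟨ha', hna⟩)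
    exact List.ne_nil_of_mem this
  · intro x hx y hy hxy
    rw [hSet] at hxy
    rw [hβm] at hx
    rw [hγm] at hy
    exact (Finset.mem_filter.1 hy).2 ((Finset.mem_filter.1 hx).2.trans hxy)

end Separators

end ColorfulGA

namespace ColorfulGA

open Blocks ColorTemplate

/-! ### Flips of vertices along edges. -/

section Flips

variable {V α : Type*} [Fintype V] [DecidableEq V] {G : SimpleGraph V} {c : Multiset α}
  {x x' y z : ColorTemplate G c} {σ σ' m m' p s : List V} {f f' : V → Option α} {a b : V}
  {T : Finset (Finset V)}

/-- `x` and `x'` lie below a common edge that lies below `y`. -/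
def Flip (y x x' : ColorTemplate G c) : Prop :=
  ∃ e, x ≤ e ∧ x' ≤ e ∧ e ≤ y ∧ e.tubing.card + 2 = Fintype.card V

theorem reflTransGen_symm {β : Type*} {r : β → β → Prop} (hr : ∀ a b, r a b → r b a) {a b : β}
    (h : Relation.ReflTransGen r a b) : Relation.ReflTransGen r b a := by
  induction h with
  | refl => exact .refl
  | tail _ h ih => exact .head (hr _ _ h) ih

theorem reflTransGen_flip_symm (h : Relation.ReflTransGen (Flip y) x x') :
    Relation.ReflTransGen (Flip y) x' x :=
  reflTransGen_symm (fun _ _ ⟨e, h1, h2, h3⟩ => ⟨e, h2, h1, h3⟩) h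

/-- Swap of two adjacent nodes of a core that lie in a common component of the later nodes. -/
def JoinedSwap (G : SimpleGraph V) (T : Finset (Finset V)) (m m' : List V) : Prop :=
  ∃ p a b s, m = p ++ a :: b :: s ∧ m' = p ++ b :: a :: s ∧ home T a = home T b ∧
    Joined G {w | w ∈ a :: b :: s} a b

/-- Swap of two adjacent nodes that lie in different components of the later nodes. -/
def FreeSwap (G : SimpleGraph V) (m m' : List V) : Prop :=
  ∃ p a b s, m = p ++ a :: b :: s ∧ m' = p ++ b :: a :: s ∧
    ¬ Joined G {w | w ∈ a :: b :: s} a b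

theorem JoinedSwap.symm (h : JoinedSwap G T m m') : JoinedSwap G T m' m := by
  obtain ⟨p, a, b, s, rfl, rfl, h1, h2⟩ := h
  refine ⟨p, b, a, s, rfl, rfl, h1.symm, h2.symm.mono ?_⟩
  intro w
  simp only [List.mem_cons, Set.mem_ofPred_eq]
  tauto

theorem FreeSwap.symm (h : FreeSwap G m m') : FreeSwap G m' m := by
  obtain ⟨p, a, b, s, rfl, rfl, h2⟩ := h
  refine ⟨p, b, a, s, rfl, rfl, fun h => h2 (h.symm.mono ?_)⟩
  intro w
  simp only [List.mem_cons, Set.mem_ofPred_eq]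
  tauto

/-- Order and coloring are swapped together, so each position keeps its color. -/
theorem word_swap (N : Finset V) (h : a ∈ N ↔ b ∈ N) (hσ : IsOrder (p ++ a :: b :: s)) :
    word (p ++ b :: a :: s) (f ∘ Equiv.swap a b) N = word (p ++ a :: b :: s) f N := by
  have hnd := List.nodup_append.1 hσ.nodup
  have hab := hσ.adjacent_ne
  have h2 := hnd.2.1
  simp only [List.nodup_cons, List.mem_cons, not_or] at h2
  have key : ∀ l : List V, a ∉ l → b ∉ l →
      (l.filter (· ∈ N)).filterMap (f ∘ Equiv.swap a b) = (l.filter (· ∈ N)).filterMap f := by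
    intro l ha hb
    refine List.filterMap_congr fun v hv => ?_
    have hv' := (List.mem_filter.1 hv).1
    rw [Function.comp_apply, Equiv.swap_apply_of_ne_of_ne]
    · rintro rfl
      exact ha hv'
    · rintro rfl
      exact hb hv'
  have hp := key p (fun h => hnd.2.2 a h a (by simp) rfl) (fun h => hnd.2.2 b h b (by simp) rfl)
  have hs := key s h2.1.2 h2.2.1
  have hga : (f ∘ Equiv.swap a b) a = f b := by simp
  have hgb : (f ∘ Equiv.swap a b) b = f a := by simp
  generalize f ∘ Equiv.swap a b = g at hp hs hga hgb
  simp only [word, List.filter_append, List.filterMap_append, hp, List.filter_cons]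
  by_cases ha : a ∈ N
  · have hb := h.1 ha
    simp only [ha, hb, decide_true, if_true, List.filterMap_cons, hs, hga, hgb]
  · have hb : b ∉ N := fun h' => ha (h.2 h')
    simp only [ha, hb, decide_false, Bool.false_eq_true, if_false, hs]

theorem map_swap (hσ : IsOrder (p ++ a :: b :: s)) :
    (p ++ b :: a :: s).map (f ∘ Equiv.swap a b) = (p ++ a :: b :: s).map f := by
  have hnd := List.nodup_append.1 hσ.nodup
  have h2 := hnd.2.1
  simp only [List.nodup_cons, List.mem_cons, not_or] at h2
  have key : ∀ l : List V, a ∉ l → b ∉ l → l.map (f ∘ Equiv.swap a b) = l.map f := by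
    intro l ha hb
    refine List.map_congr_left fun v hv => ?_
    rw [Function.comp_apply, Equiv.swap_apply_of_ne_of_ne]
    · rintro rfl
      exact ha hv
    · rintro rfl
      exact hb hv
  have hp := key p (fun h => hnd.2.2 a h a (by simp) rfl) (fun h => hnd.2.2 b h b (by simp) rfl)
  have hs := key s h2.1.2 h2.2.1
  simp only [List.map_append, List.map_cons, hp, hs, Function.comp_apply, Equiv.swap_apply_left,
    Equiv.swap_apply_right]

/-- The common edge arises by removing the tube of `b`, the only one that the swap destroys. There
`a` and `b` lie in the same core, so both vertices spell the same words. -/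
theorem Realizes.flip (hG : G.Connected) (hσ : IsOrder (p ++ a :: b :: s))
    (hx : Realizes x (p ++ a :: b :: s) f) (hxy : x ≤ y)
    (hA : Adm G y.tubing (p ++ b :: a :: s)) (hj : Joined G {w | w ∈ a :: b :: s} a b) :
    ∃ x', Realizes x' (p ++ b :: a :: s) (f ∘ Equiv.swap a b) ∧ x' ≤ y ∧ Flip y x x' ∧
      x ≠ x' := by
  have hb : b ∈ tubeOf G (p ++ a :: b :: s) a := by
    rwa [hσ.tubeOf_left, mem_comp]
  have ha : a ∈ tubeOf G (p ++ b :: a :: s) b := by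
    rw [tubeOf_swap_of_mem hσ hb]
    exact mem_tubeOf_self
  obtain ⟨w, hw, hmap⟩ := hx.isColoring hG hσ
  obtain ⟨x', hx'⟩ := exists_realizes hG hσ.swap (f := f ∘ Equiv.swap a b)
    (c := c) ⟨w, hw, by rw [map_swap hσ, hmap]⟩
  have hbne : tubeOf G (p ++ a :: b :: s) b ∈ tubesOf G (p ++ a :: b :: s) := by
    refine mem_tubesOf.2 ⟨fun e => ?_, b, rfl⟩
    have : a ∈ tubeOf G (p ++ a :: b :: s) b := e ▸ Finset.mem_univ _
    exact Before.notMem_tubeOf hσ (by simp) this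
  obtain ⟨e, hxe, he⟩ := x.exists_ge_of_subset
    (T := (tubesOf G (p ++ a :: b :: s)).erase (tubeOf G (p ++ a :: b :: s) b))
    (by rw [hx.tubing_eq]; exact Finset.erase_subset _ _)
  -- The destroyed tube is not a tube of `y`, because the swapped order is admissible for `y` as
  -- well.
  have hey : e ≤ y := by
    refine le_of_le_of_subset hxe hxy fun t ht => ?_
    rw [he, Finset.mem_erase]
    refine ⟨?_, hx.tubing_eq ▸ tubing_subset_of_le hxy ht⟩
    rintro rfl
    exact notMem_tubesOf_swap hσ hb (hA.subset_tubesOf y.isTubing hσ.swap ht)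
  have hx'e : x' ≤ e := by
    rw [hx'.le_iff hG hσ.swap]
    refine ⟨by rw [he]; exact erase_tubesOf_subset_swap hσ hb, fun u hu => ?_⟩
    rw [word_swap _ _ hσ]
    · exact ((hx.le_iff hG hσ).1 hxe).2 u hu
    · have hh : home e.tubing a = home e.tubing b := by
        have key : ∀ t ∈ e.tubing, a ∈ t ↔ b ∈ t := by
          intro t ht
          rw [he] at ht
          refine ⟨fun h => ?_, fun h => ?_⟩
          · exact mem_of_mem_tubesOf_swap hσ.swap ha (Finset.mem_of_mem_erase ht) h
          · exact mem_of_mem_tubesOf_swap hσ hb (erase_tubesOf_subset_swap hσ hb ht) h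
        ext v
        simp only [home, Finset.mem_filter, Finset.mem_univ, true_and]
        exact forall₂_congr fun t ht => by rw [key t ht]
      rw [e.isTubing.mem_coreNodes_iff hu, e.isTubing.mem_coreNodes_iff hu, hh]
  refine ⟨x', hx', hx'e.trans hey, ⟨e, hxe, hx'e, hey, ?_⟩, ?_⟩
  · rw [he, Finset.card_erase_of_mem hbne]
    have := card_tubesOf hG hσ
    have := Finset.card_pos.2 ⟨_, hbne⟩
    omega
  · rintro rfl
    refine notMem_tubesOf_swap hσ hb ?_
    rw [← hx'.tubing_eq, hx.tubing_eq]
    exact hbne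

theorem Realizes.freeSwap (hσ : IsOrder m) (h : FreeSwap G m m') (hx : Realizes x m f) :
    Realizes x m' f := by
  obtain ⟨p, a, b, s, rfl, rfl, h⟩ := h
  refine hx.congr (tubeOf_swap_of_notMem hσ ?_)
  rwa [hσ.tubeOf_left, mem_comp]

theorem Realizes.freeSwaps (hσ : IsOrder m) (h : Relation.ReflTransGen (FreeSwap G) m m')
    (hx : Realizes x m f) : Realizes x m' f ∧ IsOrder m' := by
  induction h with
  | refl => exact ⟨hx, hσ⟩
  | tail _ h ih =>
    refine ⟨ih.1.freeSwap ih.2 h, ?_⟩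
    obtain ⟨p, a, b, s, rfl, rfl, -⟩ := h
    exact ih.2.swap

theorem Adm.joinedSwap (hA : Adm G T m) (h : JoinedSwap G T m m') : Adm G T m' := by
  obtain ⟨p, a, b, s, rfl, rfl, h, -⟩ := h
  refine hA.congr fun v w hvw hb => hb.swap ?_
  rintro ⟨rfl, rfl⟩
  exact hvw h

theorem Realizes.joinedSwaps (hG : G.Connected) (hσ : IsOrder m) (hA : Adm G y.tubing m)
    (h : Relation.ReflTransGen (JoinedSwap G y.tubing) m m')
    (hx : Realizes x m f) (hxy : x ≤ y) :
    IsOrder m' ∧ Adm G y.tubing m' ∧ ∃ f' x', m'.map f' = m.map f ∧ Realizes x' m' f' ∧ x' ≤ y ∧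
      Relation.ReflTransGen (Flip y) x x' := by
  induction h with
  | refl => exact ⟨hσ, hA, f, x, rfl, hx, hxy, .refl⟩
  | tail _ h ih =>
    obtain ⟨h1, h2, f', x', h3, h4, h5, h6⟩ := ih
    have h7 := h2.joinedSwap h
    obtain ⟨p, a, b, s, rfl, rfl, hh, hj⟩ := h
    obtain ⟨x'', h8, h9, h10, -⟩ := h4.flip hG h1 h5 h7 hj
    exact ⟨h1.swap, h7, f' ∘ Equiv.swap a b, x'', by rw [map_swap h1, h3], h8, h9, h6.tail h10⟩

/-- Any vertex below `y` can be moved by flips to a given order of the nodes. -/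
theorem Realizes.exists_order (hG : G.Connected) (hσ : IsOrder σ) (hσ' : IsOrder σ')
    (hA' : Adm G y.tubing σ') (hx : Realizes x σ f) (hxy : x ≤ y) :
    ∃ f' x', Realizes x' σ' f' ∧ x' ≤ y ∧ Relation.ReflTransGen (Flip y) x x' := by
  have hA : Adm G y.tubing σ :=
    adm_of_subset_tubesOf hσ (hx.tubing_eq ▸ tubing_subset_of_le hxy)
  -- Both orders are admissible, and sorting preserves that. Each swap on the way is either a flip
  -- or has no effect on the template.
  suffices ∀ m, Relation.ReflTransGen (SwapToward σ') σ m → IsOrder m ∧ Adm G y.tubing m ∧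
      ∃ f' x', Realizes x' m f' ∧ x' ≤ y ∧ Relation.ReflTransGen (Flip y) x x' from
    (this σ' (reflTransGen_swapToward (hσ.perm_of_isOrder hσ'))).2.2
  intro m h
  induction h with
  | refl => exact ⟨hσ, hA, f, x, hx, hxy, .refl⟩
  | @tail m m' _ h ih =>
    obtain ⟨h1, h2, f', x', h3, h4, h5⟩ := ih
    have h6 : Adm G y.tubing m' := fun t ht q hq r hr hadj =>
      (h2 t ht q hq r hr hadj).swapToward hσ'.nodup h (hA' t ht q hq r hr hadj)
    have h7 : IsOrder m' := h1.perm h.perm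
    obtain ⟨p, a, b, s, rfl, rfl, -⟩ := h
    by_cases hj : Joined G {w | w ∈ a :: b :: s} a b
    · obtain ⟨x'', h8, h9, h10, -⟩ := h3.flip hG h1 h4 h6 hj
      exact ⟨h7, h6, _, x'', h8, h9, h5.tail h10⟩
    · exact ⟨h7, h6, f', x', h3.freeSwap h1 ⟨p, a, b, s, rfl, rfl, hj⟩, h4, h5⟩

/-- A node can be moved past later nodes of its core that it is joined to. -/
theorem reflTransGen_joinedSwap_move (q : List V) (p : List V) (r : List V)
    (hh : ∀ w ∈ q, home T b = home T w)
    (h : ∀ q₁ w q₂, q = q₁ ++ w :: q₂ → Joined G {v | v ∈ b :: w :: (q₂ ++ r)} b w) :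
    Relation.ReflTransGen (JoinedSwap G T) (p ++ b :: (q ++ r)) (p ++ (q ++ b :: r)) := by
  induction q generalizing p with
  | nil => exact .refl
  | cons w q ih =>
    refine .head ⟨p, b, w, q ++ r, by simp, rfl, hh w (by simp), h [] w q rfl⟩ ?_
    have := ih (p ++ [w]) (fun v hv => hh v (by simp [hv]))
      fun q₁ v q₂ hq => h (w :: q₁) v q₂ (by simp [hq])
    simpa using this

end Flips

end ColorfulGA

namespace ColorfulGA

open Blocks ColorTemplate

/-! ### Recoloring a core across its separator. -/

section Recoloring

variable {V α : Type*} [Fintype V] [DecidableEq V] {G : SimpleGraph V} {c : Multiset α}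
  {x x' y : ColorTemplate G c} {σ P Q β γ : List V} {f f' : V → Option α} {b : V}
  {T : Finset (Finset V)} {D : Set V}

/-- Two lists without edges between them may be shuffled. -/
theorem reflTransGen_freeSwap_shuffle {Z : List V} (hnd : (β ++ γ).Nodup)
    (hZ : (β ++ γ).Perm Z) (hβ : ∀ v w, Before β v w → Before Z v w)
    (hγ : ∀ v w, Before γ v w → Before Z v w)
    (hsep : ∀ v ∈ β, ∀ w ∈ γ, ¬ Joined G {w | w ∈ (β ++ γ) ++ Q} v w) :
    Relation.ReflTransGen (FreeSwap G) (P ++ ((β ++ γ) ++ Q)) (P ++ (Z ++ Q)) := by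
  have hZnd := hZ.nodup_iff.1 hnd
  suffices ∀ m, Relation.ReflTransGen (SwapToward Z) (β ++ γ) m →
      Relation.ReflTransGen (FreeSwap G) (P ++ ((β ++ γ) ++ Q)) (P ++ (m ++ Q)) ∧
        (β ++ γ).Perm m from (this Z (reflTransGen_swapToward hZ)).1
  intro m h
  induction h with
  | refl => exact ⟨.refl, .refl _⟩
  | @tail m m' hm h ih =>
    obtain ⟨h1, h2⟩ := ih
    refine ⟨h1.tail ?_, h2.trans h.perm⟩
    obtain ⟨p, a, d, s, rfl, rfl, had⟩ := h
    refine ⟨P ++ p, a, d, s ++ Q, by simp, by simp, fun hj => ?_⟩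
    have hmnd := h2.nodup_iff.1 hnd
    have hbm : Before (p ++ a :: d :: s) a d := by simp
    have hne := hbm.ne hmnd
    have hsub : {w | w ∈ a :: d :: (s ++ Q)} ⊆ {w | w ∈ (β ++ γ) ++ Q} := by
      intro w hw
      simp only [Set.mem_ofPred_eq, List.mem_cons, List.mem_append] at hw
      rw [Set.mem_ofPred_eq, List.mem_append, h2.mem_iff]
      simp only [List.mem_append, List.mem_cons]
      tauto
    -- Two entries of the same list have the same order there and in `Z`, so sorting never swaps
    -- them. Entries of different lists are not joined, by `hsep`.
    have hcase : ∀ l : List V, (∀ v w, Before l v w → Before Z v w) →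
        (∀ v w, Before l v w → Before (β ++ γ) v w) → a ∈ l → d ∈ l → False := by
      intro l hl hl' ha hd
      rcases before_or_before ha hd hne with h' | h'
      · exact (hl _ _ h').asymm hZnd had
      · exact hbm.asymm hmnd (before_of_reflTransGen hZnd hm (hl' _ _ h') (hl _ _ h'))
    have ha : a ∈ β ++ γ := h2.mem_iff.2 (by simp)
    have hd : d ∈ β ++ γ := h2.mem_iff.2 (by simp)
    rw [List.mem_append] at ha hd
    rcases ha with ha | ha <;> rcases hd with hd | hd
    · exact hcase β hβ (fun v w h => by simp [h]) ha hd
    · exact hsep a ha d hd (hj.mono hsub)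
    · exact hsep d hd a ha (hj.mono hsub).symm
    · exact hcase γ hγ (fun v w h => by simp [h]) ha hd

/-- Colors on the two sides of a separator can be exchanged by flips. -/
theorem Realizes.crossSwap (hG : G.Connected) (hσ : IsOrder (P ++ b :: ((β ++ γ) ++ Q)))
    (hA : Adm G y.tubing (P ++ b :: ((β ++ γ) ++ Q)))
    (hh : ∀ w ∈ β ++ γ, home y.tubing b = home y.tubing w) (hD : ∀ w ∈ D, w ∈ Q)
    (hβ : ∀ v ∈ β, Joined G (insert b (insert v ({w | Before β v w} ∪ D))) b v)
    (hγ : ∀ v ∈ γ, Joined G (insert b (insert v ({w | Before γ v w} ∪ D))) b v)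
    (hsep : ∀ v ∈ β, ∀ w ∈ γ, ¬ Joined G {w | w ∈ (β ++ γ) ++ Q} v w)
    {e e' : V} (he : e ∈ β) (he' : e' ∈ γ)
    (hx : Realizes x (P ++ b :: ((β ++ γ) ++ Q)) f) (hxy : x ≤ y) :
    ∃ x', Realizes x' (P ++ b :: ((β ++ γ) ++ Q)) (f ∘ Equiv.swap e e') ∧ x' ≤ y ∧
      Relation.ReflTransGen (Flip y) x x' := by
  have hnd : (β ++ γ).Nodup :=
    (List.nodup_append.1 (List.nodup_cons.1 (List.nodup_append.1 hσ.nodup).2.1).2).1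
  obtain ⟨β₁, β₂, hβe⟩ := List.append_of_mem he
  obtain ⟨γ₁, γ₂, hγe⟩ := List.append_of_mem he'
  -- The route: shuffle the two sides until `e` and `e'` are neighbours in the list, move `b` behind
  -- them so that they are joined through it, swap them, and undo the first two moves. Free swaps
  -- keep the color of each node and joined swaps that of each position, so in total exactly the
  -- colors of `e` and `e'` are exchanged.
  set E := β₁ ++ γ₁ with hE
  set E' := β₂ ++ γ₂ with hE'
  have key : ∀ q : List V, (q = [e, e'] ∨ q = [e', e]) →
      (β ++ γ).Perm ((E ++ q) ++ E') ∧
      (∀ v w, Before β v w → Before ((E ++ q) ++ E') v w) ∧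
      (∀ v w, Before γ v w → Before ((E ++ q) ++ E') v w) := by
    intro q hq
    refine ⟨?_, ?_, ?_⟩
    · rw [List.perm_iff_count]
      intro v
      rw [hβe, hγe, hE, hE']
      rcases hq with rfl | rfl <;> simp only [List.count_append, List.count_cons, List.count_nil] <;>
        omega
    · intro v w h
      rw [hβe] at h
      rw [hE, hE']
      rcases hq with rfl | rfl <;>
        simp only [before_append, before_cons, List.mem_append, List.mem_cons, before_nil,
          List.not_mem_nil] at h ⊢ <;> grind
    · intro v w h
      rw [hγe] at h
      rw [hE, hE']
      rcases hq with rfl | rfl <;>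
        simp only [before_append, before_cons, List.mem_append, List.mem_cons, before_nil,
          List.not_mem_nil] at h ⊢ <;> grind
  have hfree : ∀ q : List V, (q = [e, e'] ∨ q = [e', e]) →
      Relation.ReflTransGen (FreeSwap G) (P ++ b :: ((β ++ γ) ++ Q))
        (P ++ b :: (((E ++ q) ++ E') ++ Q)) := by
    intro q hq
    obtain ⟨h1, h2, h3⟩ := key q hq
    have := reflTransGen_freeSwap_shuffle (P := P ++ [b]) hnd h1 h2 h3 hsep
    simpa using this
  have hjoin : ∀ q : List V, (q = [e, e'] ∨ q = [e', e]) → ∀ q₁ w q₂, E ++ q = q₁ ++ w :: q₂ →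
      Joined G {v | v ∈ b :: w :: (q₂ ++ (E' ++ Q))} b w := by
    intro q hq q₁ w q₂ hqe
    obtain ⟨h1, h2, h3⟩ := key q hq
    have hnd' := h1.nodup_iff.1 hnd
    rw [hqe, List.append_assoc, List.cons_append] at h1 h2 h3 hnd'
    have hsub : ∀ l : List V, (∀ v v', Before l v v' → Before (q₁ ++ w :: (q₂ ++ E')) v v') →
        insert b (insert w ({v | Before l w v} ∪ D)) ⊆ {v | v ∈ b :: w :: (q₂ ++ (E' ++ Q))} := by
      rintro l hl v (rfl | rfl | hv | hv)
      · simp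
      · simp
      · have := (before_iff_mem_right hnd').1 (hl _ _ hv)
        simp only [List.mem_append] at this
        simp only [Set.mem_ofPred_eq, List.mem_cons, List.mem_append]
        tauto
      · simp [hD v hv]
    have hw : w ∈ β ++ γ := h1.mem_iff.2 (by simp)
    rcases List.mem_append.1 hw with hw | hw
    · exact (hβ w hw).mono (hsub β h2)
    · exact (hγ w hw).mono (hsub γ h3)
  have hhome : ∀ q : List V, (q = [e, e'] ∨ q = [e', e]) → ∀ w ∈ E ++ q,
      home y.tubing b = home y.tubing w := by
    intro q hq w hw
    exact hh w ((key q hq).1.mem_iff.2 (List.mem_append_left _ hw))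
  have hmove : ∀ q : List V, (q = [e, e'] ∨ q = [e', e]) →
      Relation.ReflTransGen (JoinedSwap G y.tubing) (P ++ b :: (((E ++ q) ++ E') ++ Q))
        (P ++ ((E ++ q) ++ b :: (E' ++ Q))) := by
    intro q hq
    have := reflTransGen_joinedSwap_move (G := G) (T := y.tubing) (b := b) (E ++ q) P (E' ++ Q)
      (hhome q hq) (hjoin q hq)
    simpa using this
  have hswap : JoinedSwap G y.tubing (P ++ ((E ++ [e, e']) ++ b :: (E' ++ Q)))
      (P ++ ((E ++ [e', e]) ++ b :: (E' ++ Q))) := by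
    refine ⟨P ++ E, e, e', b :: (E' ++ Q), by simp, by simp, ?_, ?_⟩
    · rw [← hhome _ (.inl rfl) e (by simp), ← hhome _ (.inl rfl) e' (by simp)]
    · have h1 := hjoin _ (.inl rfl) E e [e'] (by simp)
      have h2 := hjoin _ (.inl rfl) (E ++ [e]) e' [] (by simp)
      refine (h1.symm.mono ?_).trans (h2.mono ?_)
      · intro w hw
        simp only [Set.mem_ofPred_eq, List.mem_cons, List.mem_append, List.not_mem_nil] at hw ⊢
        tauto
      · intro w hw
        simp only [Set.mem_ofPred_eq, List.mem_cons, List.mem_append, List.not_mem_nil] at hw ⊢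
        tauto
  obtain ⟨hx0, hσ0⟩ := hx.freeSwaps hσ (hfree _ (.inl rfl))
  have hA0 : Adm G y.tubing (P ++ b :: (((E ++ [e, e']) ++ E') ++ Q)) :=
    adm_of_subset_tubesOf hσ0 (hx0.tubing_eq ▸ tubing_subset_of_le hxy)
  obtain ⟨hσ1, -, f', x', hmap, hx', hx'y, hpath⟩ := hx0.joinedSwaps hG hσ0 hA0
    (((hmove _ (.inl rfl)).tail hswap).trans
      (reflTransGen_symm (fun _ _ h => h.symm) (hmove _ (.inr rfl)))) hxy
  have hback := (hx'.freeSwaps hσ1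
    (reflTransGen_symm (fun _ _ h => h.symm) (hfree _ (.inr rfl)))).1
  have hf' : f' = f ∘ Equiv.swap e e' := by
    have h1 : (P ++ b :: (((E ++ [e', e]) ++ E') ++ Q)) =
      (P ++ b :: E) ++ e' :: e :: (E' ++ Q) := by simp
    have h2 : (P ++ b :: (((E ++ [e, e']) ++ E') ++ Q)) =
      (P ++ b :: E) ++ e :: e' :: (E' ++ Q) := by simp
    rw [h1] at hσ1 hmap
    rw [h2] at hσ0 hmap
    have h3 : ∀ v, (f' ∘ Equiv.swap e' e) v = f v := fun v =>
      List.map_inj_left.1 ((map_swap hσ1).trans hmap) v (hσ0.mem v)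
    funext v
    rw [Function.comp_apply, ← h3, Function.comp_apply, Equiv.swap_comm e', Equiv.swap_apply_self]
  exact ⟨x', hf' ▸ hback, hx'y, hpath⟩

theorem filterMap_eq_on {l : List V} {f g : V → Option α} (h : ∀ v ∈ l, f v = none ↔ g v = none)
    (he : l.filterMap f = l.filterMap g) : ∀ v ∈ l, f v = g v := by
  induction l with
  | nil => simp
  | cons a l ih =>
    have ha := h a (by simp)
    have h' := fun v hv => h v (List.mem_cons_of_mem a hv)
    intro v hv
    cases hf : f a with
    | none =>
      have hg := ha.1 hf
      rw [List.filterMap_cons_none hf, List.filterMap_cons_none hg] at he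
      rcases List.mem_cons.1 hv with rfl | hv
      · rw [hf, hg]
      · exact ih h' he v hv
    | some i =>
      cases hg : g a with
      | none => rw [ha.2 hg] at hf; simp at hf
      | some j =>
        rw [List.filterMap_cons_some hf, List.filterMap_cons_some hg] at he
        rw [List.cons.injEq] at he
        rcases List.mem_cons.1 hv with rfl | hv
        · rw [hf, hg, he.1]
        · exact ih h' he.2 v hv

theorem IsColoring.none_iff_head {v h : V} {l : List V} (hf : IsColoring c (h :: l) f)
    (hv : v ∈ h :: l) : f v = none ↔ v = h := by
  constructor
  · intro hn
    refine (List.mem_cons.1 hv).resolve_right fun hvl => ?_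
    have := hf.isSome hvl
    simp [hn] at this
  · rintro rfl
    exact hf.none_iff

theorem IsColoring.none_iff_none (hσ : IsOrder σ) (hf : IsColoring c σ f) (hf' : IsColoring c σ f')
    (v : V) : f v = none ↔ f' v = none := by
  have hv := hσ.mem v
  cases σ with
  | nil => simp at hv
  | cons h l => rw [hf.none_iff_head hv, hf'.none_iff_head hv]

theorem IsColoring.isSome_of_before {v w : V} (hσ : IsOrder σ) (hf : IsColoring c σ f)
    (h : Before σ v w) : (f w).isSome := by
  cases σ with
  | nil => exact h.elim
  | cons a l =>
    refine hf.isSome ?_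
    rcases h with h | h
    · exact h.2
    · exact h.mem_right

theorem word_block {l p s : List V} {N : Finset V} (hσ : IsOrder (p ++ (l ++ s)))
    (hl : ∀ v, v ∈ l ↔ v ∈ N) : word (p ++ (l ++ s)) f N = l.filterMap f := by
  have hnd := List.nodup_append.1 hσ.nodup
  have hnd2 := List.nodup_append.1 hnd.2.1
  have h1 : p.filter (· ∈ N) = [] := by
    rw [List.filter_eq_nil_iff]
    intro v hv
    simp only [decide_eq_true_eq, ← hl]
    exact fun hvl => hnd.2.2 v hv v (by simp [hvl]) rfl
  have h2 : s.filter (· ∈ N) = [] := by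
    rw [List.filter_eq_nil_iff]
    intro v hv
    simp only [decide_eq_true_eq, ← hl]
    exact fun hvl => hnd2.2.2 v hvl v hv rfl
  have h3 : l.filter (· ∈ N) = l := by
    rw [List.filter_eq_self]
    intro v hv
    simpa [← hl] using hv
  simp [word, List.filter_append, h1, h2, h3]

/-- The colors of one core can be rearranged as required by flips. -/
theorem Realizes.exists_recolor_core (hG : G.Connected) {p l s : List V} {u : Finset V}
    (hu : u ∈ insert Finset.univ y.tubing)
    (hσ : IsOrder (p ++ (l ++ s))) (hA : Adm G y.tubing (p ++ (l ++ s)))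
    (hl : ∀ v, v ∈ l ↔ v ∈ coreNodes y.tubing u)
    (hp : ∀ v ∈ p, u.card ≤ (home y.tubing v).card)
    (hs : ∀ v ∈ s, (home y.tubing v).card ≤ u.card)
    (hsep : sep G u (coreNodes y.tubing u) + 1 < (coreNodes y.tubing u).card →
      ∃ (A : List V) (b : V) (β γ : List V), l = A ++ b :: (β ++ γ) ∧
      A.length + 1 = sep G u (coreNodes y.tubing u) ∧ β ≠ [] ∧ γ ≠ [] ∧
      (∀ x ∈ β, Joined G (insert b (insert x ({w | Before β x w} ∪
        ((u : Set V) \ coreNodes y.tubing u)))) b x) ∧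
      (∀ x ∈ γ, Joined G (insert b (insert x ({w | Before γ x w} ∪
        ((u : Set V) \ coreNodes y.tubing u)))) b x) ∧
      ∀ v ∈ β, ∀ w ∈ γ, ¬ Joined G ((u : Set V) \ {w | w ∈ A ∨ w = b}) v w)
    (hx : Realizes x (p ++ (l ++ s)) f) (hxy : x ≤ y)
    (hx' : Realizes x' (p ++ (l ++ s)) f') (hx'y : x' ≤ y) :
    ∃ g z, Realizes z (p ++ (l ++ s)) g ∧ z ≤ y ∧ Relation.ReflTransGen (Flip y) x z ∧
      (∀ v ∈ coreNodes y.tubing u, g v = f' v) ∧ ∀ v, v ∉ coreNodes y.tubing u → g v = f v := by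
  have hnone := (hx.isColoring hG hσ).none_iff_none hσ (hx'.isColoring hG hσ)
  have hlist := ((hx.le_iff hG hσ).1 hxy).2 u hu
  have hlist' := ((hx'.le_iff hG hσ).1 hx'y).2 u hu
  rw [word_block hσ hl] at hlist hlist'
  have hcard := y.card_blocks u hu
  have hout := y.outer_length_eq hu
  have hhome : ∀ v ∈ l, home y.tubing v = u := fun v hv =>
    (y.isTubing.mem_coreNodes_iff hu).1 ((hl v).1 hv)
  by_cases hcase : sep G u (coreNodes y.tubing u) + 1 < (coreNodes y.tubing u).card
  swap
  -- The inner block has at most one color, so `y` forces the colors of the core.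
  · refine ⟨f, x, hx, hxy, .refl, fun v hv => ?_, fun _ _ => rfl⟩
    refine filterMap_eq_on (fun v _ => hnone v) ?_ v ((hl v).2 hv)
    obtain ⟨i, hi, e⟩ := hlist
    obtain ⟨i', hi', e'⟩ := hlist'
    rw [e, e']
    have hii : i.Perm i' := Multiset.coe_eq_coe.1 (hi.trans hi'.symm)
    have hlen : i.length ≤ 1 := by
      rw [← Multiset.coe_card, hi]
      omega
    congr 1
    rcases i with _ | ⟨a, _ | ⟨b, i⟩⟩
    · exact (List.nil_perm.1 hii).symm
    · exact List.singleton_perm.1 hii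
    · simp at hlen
  · obtain ⟨A, b, β, γ, rfl, hlen, hβ0, hγ0, hβ, hγ, hcut⟩ := hsep hcase
    have hσe : p ++ ((A ++ b :: (β ++ γ)) ++ s) = (p ++ A) ++ b :: ((β ++ γ) ++ s) := by simp
    rw [hσe] at hσ hA hx hx' ⊢
    have hnd := (List.nodup_append.1 hσ.nodup).2.1
    have hndβγ := (List.nodup_append.1 (List.nodup_cons.1 hnd).2).1
    have hN : (coreNodes y.tubing u).card = A.length + 1 + (β ++ γ).length := by
      have h1 : (A ++ b :: (β ++ γ)).Nodup := by
        have := hσ.nodup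
        rw [← hσe] at this
        exact (List.nodup_append.1 (List.nodup_append.1 this).2.1).1
      have h2 : (A ++ b :: (β ++ γ)).toFinset = coreNodes y.tubing u := by
        ext v
        rw [List.mem_toFinset, hl]
      rw [← h2, List.toFinset_card_of_nodup h1, List.length_append, List.length_cons]
      omega
    have hsome : ∀ g : V → Option α, IsColoring c ((p ++ A) ++ b :: ((β ++ γ) ++ s)) g →
        ∀ v ∈ β ++ γ, (g v).isSome := by
      intro g hg v hv
      refine hg.isSome_of_before hσ (v := b) ?_
      rw [before_iff_mem_right hσ.nodup]
      exact List.mem_append_left _ hv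
    -- The nodes of `A` and `b` account for the color and the outer colors, `1 + (sep - 1)` in all,
    -- where for `univ` the uncolored first node stands in for the color. The two sides take exactly
    -- the inner block.
    have hinner : (y.blocks u).inner.card = (β ++ γ).length := by
      clear hsep
      omega
    have hsplit : ∀ g : V → Option α, IsColoring c ((p ++ A) ++ b :: ((β ++ γ) ++ s)) g →
        (y.blocks u).IsListing ((A ++ b :: (β ++ γ)).filterMap g) →
        (A ++ [b]).filterMap g = (y.blocks u).color.toList ++ (y.blocks u).outer ∧
        ((β ++ γ).filterMap g : Multiset α) = (y.blocks u).inner ∧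
        (β ++ γ).map g = ((β ++ γ).filterMap g).map some := by
      intro g hg hgl
      have h1 : ((β ++ γ).filterMap g).length = (β ++ γ).length := by
        rw [List.length_filterMap_eq_countP, List.countP_eq_length]
        exact hsome g hg
      obtain ⟨i, hi, e⟩ := hgl
      have h2 : (A ++ b :: (β ++ γ)).filterMap g =
          (A ++ [b]).filterMap g ++ (β ++ γ).filterMap g := by
        rw [← List.filterMap_append]
        simp
      rw [h2] at e
      have h3 : i.length = (y.blocks u).inner.card := by rw [← hi, Multiset.coe_card]
      obtain ⟨h4, h5⟩ := List.append_inj' e (by rw [h1, h3, hinner])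
      exact ⟨h4, by rw [h5, hi], map_eq_map_some_filterMap h1.symm.le⟩
    obtain ⟨h1, h2, h3⟩ := hsplit f (hx.isColoring hG hσ) hlist
    obtain ⟨h1', h2', h3'⟩ := hsplit f' (hx'.isColoring hG hσ) hlist'
    have heq := filterMap_eq_on (fun v _ => hnone v) (h1.trans h1'.symm)
    have hBC : (β.toFinset ∪ γ.toFinset).val = (β ++ γ : Multiset V) := by
      rw [← List.toFinset_append, List.toFinset_val, hndβγ.dedup]
    obtain ⟨g, hg1, hg2, hg3⟩ := exists_reflTransGen_crossSwap
      (List.toFinset_nonempty_iff _ |>.2 hβ0) (List.toFinset_nonempty_iff _ |>.2 hγ0) f f' (by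
        rw [hBC]
        change (((β ++ γ).map f : List (Option α)) : Multiset (Option α)) = ((β ++ γ).map f' : _)
        rw [h3, h3', ← Multiset.map_coe, ← Multiset.map_coe, h2, h2'])
    have hD : ∀ w ∈ (u : Set V) \ coreNodes y.tubing u, w ∈ s := by
      rintro w ⟨hwu, hwN⟩
      have h4 : home y.tubing w ⊂ u := (home_subset hu hwu).ssubset_of_ne fun e =>
        hwN ((y.isTubing.mem_coreNodes_iff hu).2 e)
      have h5 := hσ.mem w
      rw [← hσe, List.mem_append, List.mem_append, hl] at h5
      rcases h5 with h5 | h5 | h5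
      · exact absurd (hp w h5) (not_le.2 (Finset.card_lt_card h4))
      · exact absurd h5 hwN
      · exact h5
    -- A path through the two sides and later nodes stays in `u`: a node outside `u` with a
    -- neighbour in `u` has a home properly containing `u`, whereas the homes of later nodes are no
    -- larger than `u`.
    have hcut' : ∀ v ∈ β, ∀ w ∈ γ, ¬ Joined G {w | w ∈ (β ++ γ) ++ s} v w := by
      intro v hv w hw hj
      refine hcut v hv w hw (hj.of_closed ?_ ?_)
      · rintro q ⟨hqu, hq⟩ r hr hqr
        have hrb : r ≠ b ∧ r ∉ A := by
          constructor
          · rintro rfl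
            exact (List.nodup_cons.1 hnd).1 hr
          · intro hrA
            exact (List.nodup_append.1 hσ.nodup).2.2 r (by simp [hrA]) r
              (List.mem_cons_of_mem _ hr) rfl
        refine ⟨?_, by simp [hrb]⟩
        by_contra hru
        have h4 := y.isTubing.ssubset_of_adj (y.isTubing.home_mem r) hu (mem_home _ r) hru hqu
          hqr.symm
        rcases List.mem_append.1 hr with hr | hr
        · rw [hhome r (by simp only [List.mem_append, List.mem_cons] at hr ⊢; tauto)] at h4
          exact h4.ne rfl
        · exact absurd (hs r hr) (not_le.2 (Finset.card_lt_card h4))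
      · refine ⟨coreNodes_subset ((hl v).1 (by simp [hv])), ?_⟩
        rintro (hvA | rfl)
        · exact (List.nodup_append.1 hσ.nodup).2.2 v (by simp [hvA]) v (by simp [hv]) rfl
        · exact (List.nodup_cons.1 hnd).1 (by simp [hv])
    have hreach : ∃ z, Realizes z ((p ++ A) ++ b :: ((β ++ γ) ++ s)) g ∧ z ≤ y ∧
        Relation.ReflTransGen (Flip y) x z := by
      clear hg2 hg3
      induction hg1 with
      | refl => exact ⟨x, hx, hxy, .refl⟩
      | tail _ h ih =>
        obtain ⟨z, h4, h5, h6⟩ := ih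
        obtain ⟨e, he, e', he', rfl⟩ := h
        obtain ⟨z', h7, h8, h9⟩ := h4.crossSwap hG hσ hA (fun w hw => by
            rw [hhome b (by simp), hhome w (by
              simp only [List.mem_append, List.mem_cons] at hw ⊢
              tauto)]) hD hβ hγ hcut' (by simpa using he) (by simpa using he') h5
        exact ⟨z', h7, h8, h6.trans h9⟩
    obtain ⟨z, hz1, hz2, hz3⟩ := hreach
    refine ⟨g, z, hz1, hz2, hz3, fun v hv => ?_, fun v hv => hg3 v fun hv' => hv ?_⟩
    · by_cases hvBC : v ∈ β.toFinset ∪ γ.toFinset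
      · exact hg2 v hvBC
      · rw [hg3 v hvBC]
        refine heq v ?_
        have := (hl v).2 hv
        simp only [Finset.mem_union, List.mem_toFinset] at hvBC
        simp only [List.mem_append, List.mem_cons] at this ⊢
        tauto
    · rw [← hl]
      simp only [Finset.mem_union, List.mem_toFinset] at hv'
      simp only [List.mem_append, List.mem_cons]
      tauto

/-- Any two vertices below `y` are joined by flips below `y`. -/
theorem reflTransGen_flip_of_le (hG : G.Connected) (hx : x.tubing.card + 1 = Fintype.card V)
    (hx' : x'.tubing.card + 1 = Fintype.card V) (hxy : x ≤ y) (hx'y : x' ≤ y) :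
    Relation.ReflTransGen (Flip y) x x' := by
  have hord : ∀ u, ∃ l : List V, u ∈ insert Finset.univ y.tubing → l.Nodup ∧
      (∀ v, v ∈ l ↔ v ∈ coreNodes y.tubing u) ∧
      (sep G u (coreNodes y.tubing u) + 1 < (coreNodes y.tubing u).card →
      ∃ (A : List V) (b : V) (β γ : List V), l = A ++ b :: (β ++ γ) ∧
      A.length + 1 = sep G u (coreNodes y.tubing u) ∧ β ≠ [] ∧ γ ≠ [] ∧
      (∀ x ∈ β, Joined G (insert b (insert x ({w | Before β x w} ∪
        ((u : Set V) \ coreNodes y.tubing u)))) b x) ∧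
      (∀ x ∈ γ, Joined G (insert b (insert x ({w | Before γ x w} ∪
        ((u : Set V) \ coreNodes y.tubing u)))) b x) ∧
      ∀ v ∈ β, ∀ w ∈ γ, ¬ Joined G ((u : Set V) \ {w | w ∈ A ∨ w = b}) v w) := by
    intro u
    by_cases hcase : sep G u (coreNodes y.tubing u) + 1 < (coreNodes y.tubing u).card
    · by_cases hu : u ∈ insert Finset.univ y.tubing
      · obtain ⟨A, b, β, γ, h1, h2, h3⟩ := exists_separator_order hG y.isTubing hu hcase
        exact ⟨_, fun _ => ⟨h1, h2, fun _ => ⟨A, b, β, γ, rfl, h3⟩⟩⟩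
      · exact ⟨[], fun h => absurd h hu⟩
    · exact ⟨(coreNodes y.tubing u).toList, fun _ => ⟨Finset.nodup_toList _,
        fun _ => Finset.mem_toList, fun h => absurd h hcase⟩⟩
  choose ord hord using hord
  obtain ⟨σ, hσ, hA, hdec⟩ := exists_block_order y.isTubing ord (fun u hu => (hord u hu).1)
    fun u hu => (hord u hu).2.1
  have hmove : ∀ z : ColorTemplate G c, z.tubing.card + 1 = Fintype.card V → z ≤ y →
      ∃ f z', Realizes z' σ f ∧ z' ≤ y ∧ Relation.ReflTransGen (Flip y) z z' := by
    intro z hz hzy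
    obtain ⟨τ, hτ, hτA⟩ := exists_order_adm z.isTubing
    obtain ⟨f, hf⟩ := exists_realizes_of_card hG hτ hz hτA
    exact hf.exists_order hG hτ hσ hA hzy
  obtain ⟨f, z, hz, hzy, hxz⟩ := hmove x hx hxy
  obtain ⟨f', z', hz', hz'y, hxz'⟩ := hmove x' hx' hx'y
  -- With the order fixed, the cores are recolored one at a time, each without touching the others.
  have key : ∀ U ⊆ insert Finset.univ y.tubing, ∃ g w, Realizes w σ g ∧ w ≤ y ∧
      Relation.ReflTransGen (Flip y) z w ∧ ∀ u ∈ U, ∀ v ∈ coreNodes y.tubing u, g v = f' v := by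
    intro U
    induction U using Finset.induction_on with
    | empty => exact fun _ => ⟨f, z, hz, hzy, .refl, by simp⟩
    | insert u U huU ih =>
      intro hU
      obtain ⟨g, w, hw, hwy, hzw, hg⟩ := ih ((Finset.subset_insert _ _).trans hU)
      have hu := hU (Finset.mem_insert_self _ _)
      obtain ⟨p, s, rfl, hp, hs⟩ := hdec u hu
      obtain ⟨g', w', h1, h2, h3, h4, h5⟩ := hw.exists_recolor_core hG hu hσ hA (hord u hu).2.1
        hp hs (hord u hu).2.2 hwy hz' hz'y
      refine ⟨g', w', h1, h2, hzw.trans h3, fun t ht v hv => ?_⟩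
      rcases Finset.mem_insert.1 ht with rfl | ht
      · exact h4 v hv
      · rw [h5 v, hg t ht v hv]
        have hne : t ≠ u := fun e => huU (e ▸ ht)
        exact Finset.disjoint_left.1 (y.isTubing.disjoint_coreNodes
          (hU (Finset.mem_insert_of_mem ht)) hu hne) hv
  obtain ⟨g, w, hw, -, hzw, hg⟩ := key _ (Finset.Subset.refl _)
  have hgf : g = f' := by
    funext v
    exact hg _ (y.isTubing.home_mem v) v
      ((y.isTubing.mem_coreNodes_iff (y.isTubing.home_mem v)).2 rfl)
  subst hgf
  rw [hw.unique hG hσ hz'] at hzw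
  exact (hxz.trans hzw).trans (reflTransGen_flip_symm hxz')

end Recoloring

end ColorfulGA

namespace ColorfulGA

/-! ### Ranked posets and strong flag connectivity. -/

section Ranked

/-- `r` ranks the faces of a bounded poset, the greatest face having rank `N`: all the ranks
between those of two comparable faces are taken in between. -/
structure IsRanking {P : Type*} [PartialOrder P] (r : P → ℕ) (N : ℕ) : Prop where
  strictMono : StrictMono r
  exists_least : ∃ a, IsLeast Set.univ a ∧ r a = 0
  exists_greatest : ∃ b, IsGreatest Set.univ b ∧ r b = N
  exists_between : ∀ a b, a < b → ∀ m, r a < m → m < r b → ∃ c, a < c ∧ c < b ∧ r c = m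

/-- Any two faces strictly between `f` and `h` are joined by a sequence of incident ones. -/
def SectionConnected {P : Type*} [PartialOrder P] (f h : P) : Prop :=
  ∀ a ∈ Set.Ioo f h, ∀ b ∈ Set.Ioo f h,
    Relation.ReflTransGen (fun a b => b ∈ Set.Ioo f h ∧ (a ≤ b ∨ b ≤ a)) a b

variable {P : Type*} [PartialOrder P] {r : P → ℕ} {N : ℕ}

namespace IsRanking

theorem height_eq (hr : IsRanking r N) (z : P) : Order.height z = (r z : ℕ∞) := by
  induction hz : r z using Nat.strong_induction_on generalizing z with
  | _ m ih =>
    apply le_antisymm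
    · rw [Order.height_le_coe_iff]
      intro y hy
      have := hr.strictMono hy
      rw [ih (r y) (hz ▸ this) y rfl]
      exact_mod_cast hz ▸ this
    · cases m with
      | zero => simp
      | succ m =>
        obtain ⟨a, ha, ha0⟩ := hr.exists_least
        have haz : a < z := (ha.2 (Set.mem_univ z)).lt_of_ne (by rintro rfl; omega)
        obtain ⟨c, hc, hcm⟩ : ∃ c, c < z ∧ r c = m := by
          rcases Nat.eq_zero_or_pos m with rfl | hm
          · exact ⟨a, haz, ha0⟩
          · obtain ⟨c, -, hc, h⟩ := hr.exists_between a z haz m (by omega) (by omega)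
            exact ⟨c, hc, h⟩
        have := Order.height_add_one_le hc
        rw [ih m (by omega) c hcm] at this
        exact_mod_cast this

theorem le_top (hr : IsRanking r N) (z : P) : r z ≤ N := by
  obtain ⟨b, hb, rfl⟩ := hr.exists_greatest
  exact hr.strictMono.monotone (hb.2 (Set.mem_univ z))

variable {Φ Ψ : Flag P}

theorem lt_of_lt (hr : IsRanking r N) {a b : P} (ha : a ∈ Φ) (hb : b ∈ Φ) (h : r a < r b) :
    a < b := by
  refine lt_of_le_of_ne ((Φ.le_or_le ha hb).resolve_right fun h' => ?_) (by rintro rfl; omega)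
  have := hr.strictMono.monotone h'
  omega

theorem injOn (hr : IsRanking r N) (Φ : Flag P) : Set.InjOn r Φ := by
  intro a ha b hb h
  rcases Φ.le_or_le ha hb with h' | h'
  · exact h'.eq_of_not_lt fun h'' => (hr.strictMono h'').ne h
  · exact (h'.eq_of_not_lt fun h'' => (hr.strictMono h'').ne h.symm).symm

theorem finite (hr : IsRanking r N) (Φ : Flag P) : (Φ : Set P).Finite :=
  Set.Finite.of_injOn (fun a _ => Set.mem_Iic.2 (hr.le_top a)) (hr.injOn Φ) (Set.finite_Iic N)

theorem least_mem (Φ : Flag P) {a : P} (ha : IsLeast Set.univ a) : a ∈ Φ :=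
  Flag.mem_iff_forall_le_or_ge.2 fun _ _ => .inl (ha.2 trivial)

theorem greatest_mem (Φ : Flag P) {a : P} (ha : IsGreatest Set.univ a) : a ∈ Φ :=
  Flag.mem_iff_forall_le_or_ge.2 fun _ _ => .inr (ha.2 trivial)

/-- If a rank were missing, a face of that rank could be inserted between the nearest faces of the
flag below and above, against maximality. -/
theorem exists_mem (hr : IsRanking r N) (Φ : Flag P) {m : ℕ} (hm : m ≤ N) : ∃ a ∈ Φ, r a = m := by
  by_contra! hno
  obtain ⟨o, ho, ho0⟩ := hr.exists_least
  obtain ⟨g, hg, hgN⟩ := hr.exists_greatest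
  have hoΦ := least_mem Φ ho
  have hgΦ := greatest_mem Φ hg
  obtain ⟨a, ⟨haΦ, ham⟩, ha⟩ := Set.exists_max_image {x | x ∈ Φ ∧ r x < m} r
    ((hr.finite Φ).subset fun x hx => hx.1) ⟨o, hoΦ, by have := hno o hoΦ; omega⟩
  obtain ⟨b, ⟨hbΦ, hbm⟩, hb⟩ := Set.exists_min_image {x | x ∈ Φ ∧ m < r x} r
    ((hr.finite Φ).subset fun x hx => hx.1) ⟨g, hgΦ, by have := hno g hgΦ; omega⟩
  obtain ⟨c, hac, hcb, hc⟩ := hr.exists_between a b (hr.lt_of_lt haΦ hbΦ (ham.trans hbm)) m ham hbm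
  refine hno c (Flag.mem_iff_forall_le_or_ge.2 fun d hd => ?_) hc
  rcases lt_or_gt_of_ne (hno d hd) with h | h
  · refine .inr (le_trans ?_ hac.le)
    rcases Φ.le_or_le hd haΦ with h' | h'
    · exact h'
    · rw [hr.injOn Φ hd haΦ ((ha d ⟨hd, h⟩).antisymm (hr.strictMono.monotone h'))]
  · refine .inl (hcb.le.trans ?_)
    rcases Φ.le_or_le hbΦ hd with h' | h'
    · exact h'
    · rw [hr.injOn Φ hbΦ hd ((hb d ⟨hd, h⟩).antisymm (hr.strictMono.monotone h'))]

theorem ncard (hr : IsRanking r N) (Φ : Flag P) : (Φ : Set P).ncard = N + 1 := by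
  rw [← (hr.injOn Φ).ncard_image]
  have : r '' (Φ : Set P) = Set.Iic N := by
    ext m
    constructor
    · rintro ⟨a, -, rfl⟩
      exact hr.le_top a
    · exact fun hm => hr.exists_mem Φ hm
  rw [this, ← Finset.coe_Iic, Set.ncard_coe_finset, Nat.card_Iic]

theorem encard (hr : IsRanking r N) (Φ : Flag P) : (Φ : Set P).encard = (N + 1 : ℕ) := by
  rw [← hr.ncard Φ, (hr.finite Φ).cast_ncard_eq]

theorem ncard_diff (hr : IsRanking r N) (Φ Ψ : Flag P) :
    ((Φ : Set P) \ Ψ).ncard = ((Ψ : Set P) \ Φ).ncard := by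
  have h1 := Set.ncard_inter_add_ncard_sdiff_eq_ncard (Φ : Set P) Ψ (hr.finite Φ)
  have h2 := Set.ncard_inter_add_ncard_sdiff_eq_ncard (Ψ : Set P) Φ (hr.finite Ψ)
  rw [hr.ncard] at h1 h2
  rw [Set.inter_comm] at h2
  omega

theorem flagAdjacent (hr : IsRanking r N) {a b : P} (h : (Φ : Set P) \ Ψ ⊆ {a}) (hb : b ∈ Ψ)
    (hb' : b ∉ Φ) : FlagAdjacent Φ Ψ := by
  have h1 : ((Φ : Set P) \ Ψ).ncard ≤ 1 := (Set.ncard_le_ncard h).trans (Set.ncard_singleton a).le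
  have h2 : 0 < ((Ψ : Set P) \ Φ).ncard :=
    (Set.ncard_pos ((hr.finite Ψ).subset Set.sdiff_subset)).2 ⟨b, hb, hb'⟩
  have h3 := hr.ncard_diff Φ Ψ
  exact ⟨by omega, by omega⟩

/-- Two flags contain incident common faces enclosing a given face of one of them. -/
theorem exists_section (hr : IsRanking r N) {a : P} (ha : a ∈ Φ) (ha' : a ∉ Ψ) :
    ∃ f h, f ∈ (Φ : Set P) ∩ Ψ ∧ h ∈ (Φ : Set P) ∩ Ψ ∧ a ∈ Set.Ioo f h ∧
      ∀ c ∈ (Φ : Set P) ∩ Ψ, c ≤ f ∨ h ≤ c := by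
  obtain ⟨o, ho, -⟩ := hr.exists_least
  obtain ⟨g, hg, -⟩ := hr.exists_greatest
  have hne : ∀ c ∈ Ψ, c ≠ a := fun c hc h => ha' (h ▸ hc)
  have hfin := (hr.finite Φ).inter_of_left (Ψ : Set P)
  obtain ⟨f, ⟨hf, hfa⟩, hf'⟩ := Set.exists_max_image {x | x ∈ (Φ : Set P) ∩ Ψ ∧ x < a} r
    (hfin.subset fun x hx => hx.1)
    ⟨o, ⟨least_mem Φ ho, least_mem Ψ ho⟩, (ho.2 trivial).lt_of_ne (hne o (least_mem Ψ ho))⟩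
  obtain ⟨h, ⟨hh, hah⟩, hh'⟩ := Set.exists_min_image {x | x ∈ (Φ : Set P) ∩ Ψ ∧ a < x} r
    (hfin.subset fun x hx => hx.1)
    ⟨g, ⟨greatest_mem Φ hg, greatest_mem Ψ hg⟩,
      (hg.2 trivial).lt_of_ne (hne g (greatest_mem Ψ hg)).symm⟩
  refine ⟨f, h, hf, hh, ⟨hfa, hah⟩, fun c hc => ?_⟩
  rcases Φ.le_or_le hc.1 ha with h' | h'
  · have := hf' c ⟨hc, h'.lt_of_ne (hne c hc.2)⟩
    rcases Φ.le_or_le hc.1 hf.1 with h'' | h''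
    · exact .inl h''
    · exact .inl (hr.injOn Φ hc.1 hf.1 (this.antisymm (hr.strictMono.monotone h''))).le
  · have := hh' c ⟨hc, h'.lt_of_ne (hne c hc.2).symm⟩
    rcases Φ.le_or_le hh.1 hc.1 with h'' | h''
    · exact .inr h''
    · exact .inr (hr.injOn Φ hc.1 hh.1 ((hr.strictMono.monotone h'').antisymm this)).ge

/-- Induction on the number of faces not in common. Between consecutive common faces `f` and `h`, a
path of incident faces leads from a face of `Φ` to one of `Ψ`. Flags through `Φ ∩ Ψ` that share one
further face of this path have a larger intersection, so the induction joins them. -/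
theorem stronglyFlagConnected (hr : IsRanking r N)
    (hs : ∀ f h : P, f < h → r f + 3 ≤ r h → SectionConnected f h) : StronglyFlagConnected P := by
  intro Φ Ψ
  induction hk : N + 1 - ((Φ : Set P) ∩ Ψ).ncard using Nat.strong_induction_on generalizing Φ Ψ with
  | _ k ih =>
    subst hk
    by_cases hΦΨ : (Φ : Set P) ⊆ Ψ
    · rw [Flag.ext (Set.eq_of_subset_of_ncard_le hΦΨ (by rw [hr.ncard, hr.ncard]) (hr.finite Ψ))]
    obtain ⟨a, ha, ha'⟩ := Set.not_subset.1 hΦΨ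
    obtain ⟨f, h, hf, hh, hafh, hC⟩ := hr.exists_section ha ha'
    have hfinC := (hr.finite Φ).inter_of_left (Ψ : Set P)
    have step : ∀ (Ω Ω' : Flag P) (c : P), c ∈ Set.Ioo f h → c ∈ Ω → c ∈ Ω' →
        (Φ : Set P) ∩ Ψ ⊆ Ω → (Φ : Set P) ∩ Ψ ⊆ Ω' → Relation.ReflTransGen
          (fun A B : Flag P => FlagAdjacent A B ∧ (Φ : Set P) ∩ Ψ ⊆ B) Ω Ω' := by
      intro Ω Ω' c hc hcΩ hcΩ' h1 h2
      have hcC : c ∉ (Φ : Set P) ∩ Ψ := fun h' => by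
        rcases hC c h' with h'' | h''
        · exact hc.1.not_ge h''
        · exact hc.2.not_ge h''
      have hlt : ((Φ : Set P) ∩ Ψ).ncard < ((Ω : Set P) ∩ Ω').ncard :=
        Set.ncard_lt_ncard ((Set.ssubset_iff_of_subset (Set.subset_inter h1 h2)).2
          ⟨c, ⟨hcΩ, hcΩ'⟩, hcC⟩) ((hr.finite Ω).inter_of_left _)
      have hle : ((Ω : Set P) ∩ Ω').ncard ≤ N + 1 := by
        rw [← hr.ncard Ω]
        exact Set.ncard_le_ncard Set.inter_subset_left (hr.finite Ω)
      exact Relation.ReflTransGen.mono (fun A B hAB =>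
        ⟨hAB.1, (Set.subset_inter h1 h2).trans hAB.2⟩) _ _ (ih _ (by omega) Ω Ω' rfl)
    obtain ⟨b, hb, hab⟩ := hr.exists_mem Ψ (hr.le_top a)
    have hra := hr.strictMono hafh.1
    have hra' := hr.strictMono hafh.2
    have hbfh : b ∈ Set.Ioo f h :=
      ⟨hr.lt_of_lt hf.2 hb (by omega), hr.lt_of_lt hb hh.2 (by omega)⟩
    by_cases hlen : r f + 3 ≤ r h
    · have key : ∀ c, Relation.ReflTransGen
          (fun a b => b ∈ Set.Ioo f h ∧ (a ≤ b ∨ b ≤ a)) a c → c ∈ Set.Ioo f h ∧ ∀ Ω : Flag P,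
          c ∈ Ω → (Φ : Set P) ∩ Ψ ⊆ Ω → Relation.ReflTransGen
          (fun A B : Flag P => FlagAdjacent A B ∧ (Φ : Set P) ∩ Ψ ⊆ B) Φ Ω := by
        intro c hc
        induction hc with
        | refl => exact ⟨hafh, fun Ω hΩ h' => step Φ Ω a hafh ha hΩ Set.inter_subset_left h'⟩
        | @tail c d _ hcd ihc =>
          refine ⟨hcd.1, fun Ω hΩ h' => ?_⟩
          have hcomp : ∀ e ∈ Set.Ioo f h, ∀ g ∈ (Φ : Set P) ∩ Ψ, e ≠ g → e ≤ g ∨ g ≤ e := by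
            intro e he g hg _
            rcases hC g hg with h'' | h''
            · exact .inr (h''.trans he.1.le)
            · exact .inl (he.2.le.trans h'')
          have hch : IsChain (· ≤ ·) (insert c (insert d ((Φ : Set P) ∩ Ψ))) := by
            refine ((Φ.chain_le.mono Set.inter_subset_left).insert (hcomp d hcd.1)).insert ?_
            rintro g (rfl | hg) hne
            · exact hcd.2
            · exact hcomp c ihc.1 g hg hne
          obtain ⟨Ω', hΩ'⟩ := hch.exists_subset_flag
          have hsub : (Φ : Set P) ∩ Ψ ⊆ Ω' := fun g hg => hΩ' (.inr (.inr hg))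
          exact (ihc.2 Ω' (hΩ' (.inl rfl)) hsub).trans
            (step Ω' Ω d hcd.1 (hΩ' (.inr (.inl rfl))) hΩ hsub h')
      exact (key b (hs f h (hafh.1.trans hafh.2) hlen a hafh b hbfh)).2 Ψ hb
        Set.inter_subset_right
    -- Only one rank lies between `f` and `h`, so replacing `a` by `b` is a single adjacency.
    · have hch : IsChain (· ≤ ·) (insert b ((Φ : Set P) \ {a})) := by
        refine (Φ.chain_le.mono Set.sdiff_subset).insert fun g hg _ => ?_
        rcases Φ.le_or_le hg.1 hf.1 with h' | h'
        · exact .inr (h'.trans hbfh.1.le)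
        rcases Φ.le_or_le hh.1 hg.1 with h'' | h''
        · exact .inl (hbfh.2.le.trans h'')
        rcases h'.eq_or_lt with rfl | h'
        · exact .inr hbfh.1.le
        rcases h''.eq_or_lt with rfl | h''
        · exact .inl hbfh.2.le
        have h1 := hr.strictMono h'
        have h2 := hr.strictMono h''
        exact absurd (hr.injOn Φ hg.1 ha (by omega)) hg.2
      obtain ⟨Ω, hΩ⟩ := hch.exists_subset_flag
      have hsub : (Φ : Set P) ∩ Ψ ⊆ Ω := fun g hg =>
        hΩ (.inr ⟨hg.1, fun h' => ha' (h' ▸ hg.2)⟩)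
      have hbΦ : b ∉ Φ := fun h' => ha' (hr.injOn Φ h' ha hab ▸ hb)
      refine .head ⟨hr.flagAdjacent (a := a) (fun g hg => ?_) (hΩ (.inl rfl)) hbΦ, hsub⟩
        (step Ω Ψ b hbfh (hΩ (.inl rfl)) hb hsub Set.inter_subset_right)
      by_contra hga
      exact hg.2 (hΩ (.inr ⟨hg.1, hga⟩))

end IsRanking

end Ranked

end ColorfulGA

namespace ColorfulGA

/-! ### Diamonds among templates, and the two vertices of an edge. -/

namespace ColorTemplate

open Blocks

variable {V α : Type*} [Fintype V] [DecidableEq V] {G : SimpleGraph V} {c : Multiset α}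
  {x y z : ColorTemplate G c} {s t u w : Finset V}

theorem card_lt_of_lt (h : x < y) : y.tubing.card < x.tubing.card :=
  (eq_or_card_lt h.le).resolve_left h.ne

theorem lt_of_le_of_card (h : x ≤ y) (hc : y.tubing.card < x.tubing.card) : x < y :=
  h.lt_of_ne (by rintro rfl; exact hc.false)

theorem exists_between_of_subset (hxy : x ≤ y) {T : Finset (Finset V)} (h : y.tubing ⊆ T)
    (h' : T ⊆ x.tubing) : ∃ z, x ≤ z ∧ z ≤ y ∧ z.tubing = T := by
  obtain ⟨z, hxz, rfl⟩ := x.exists_ge_of_subset h'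
  exact ⟨z, hxz, le_of_le_of_subset hxz hxy h, rfl⟩

theorem exists_vertex_le (hG : G.Connected) (hc : c.card + 1 = Fintype.card V)
    (y : ColorTemplate G c) : ∃ x ≤ y, x.tubing.card + 1 = Fintype.card V := by
  obtain ⟨σ, hσ, hA⟩ := exists_order_adm y.isTubing
  obtain ⟨f, x, hx, hxy⟩ := exists_realizes_le hG hc y hσ hA
  exact ⟨x, hxy, hx.card hG hσ⟩

/-- Templates between two templates that are two tubes apart. -/
theorem exists_lt_lt_iff (hxy : x ≤ y) (hcard : x.tubing.card = y.tubing.card + 2) :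
    ∃ a b, a ≠ b ∧ ∀ z, x < z ∧ z < y ↔ z = a ∨ z = b := by
  have hsub := tubing_subset_of_le hxy
  obtain ⟨s, t, hst, hD⟩ := Finset.card_eq_two.1
    (show (x.tubing \ y.tubing).card = 2 by rw [Finset.card_sdiff_of_subset hsub]; omega)
  have hmem : ∀ r, r ∈ x.tubing ∧ r ∉ y.tubing ↔ r = s ∨ r = t := fun r => by
    rw [← Finset.mem_sdiff, hD, Finset.mem_insert, Finset.mem_singleton]
  have hs := (hmem s).2 (.inl rfl)
  have ht := (hmem t).2 (.inr rfl)
  obtain ⟨a, hxa, hay, ha⟩ := exists_between_of_subset hxy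
    (Finset.subset_erase.2 ⟨hsub, hs.2⟩) (Finset.erase_subset s x.tubing)
  obtain ⟨b, hxb, hby, hb⟩ := exists_between_of_subset hxy
    (Finset.subset_erase.2 ⟨hsub, ht.2⟩) (Finset.erase_subset t x.tubing)
  have hac := Finset.card_erase_of_mem hs.1
  have hbc := Finset.card_erase_of_mem ht.1
  rw [← ha] at hac
  rw [← hb] at hbc
  refine ⟨a, b, ?_, fun z => ⟨fun hz => ?_, ?_⟩⟩
  · rintro rfl
    have : s ∈ x.tubing.erase t := Finset.mem_erase.2 ⟨hst, hs.1⟩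
    rw [← hb, ha] at this
    exact Finset.notMem_erase _ _ this
  · have h1 := card_lt_of_lt hz.1
    have h2 := card_lt_of_lt hz.2
    have h3 := tubing_subset_of_le hz.1.le
    have h4 := tubing_subset_of_le hz.2.le
    obtain ⟨r, hr, hrz⟩ := Finset.exists_mem_notMem_of_card_lt_card h1
    have key : z.tubing = x.tubing.erase r := Finset.eq_of_subset_of_card_le
      (Finset.subset_erase.2 ⟨h3, hrz⟩) (by rw [Finset.card_erase_of_mem hr]; omega)
    rcases (hmem r).1 ⟨hr, fun h => hrz (h4 h)⟩ with rfl | rfl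
    · exact .inl (eq_of_le_of_le hz.1.le hxa (by rw [key, ha]))
    · exact .inr (eq_of_le_of_le hz.1.le hxb (by rw [key, hb]))
  · rintro (rfl | rfl)
    · exact ⟨lt_of_le_of_card hxa (by omega), lt_of_le_of_card hay (by omega)⟩
    · exact ⟨lt_of_le_of_card hxb (by omega), lt_of_le_of_card hby (by omega)⟩

theorem exists_removes_of_le (h : x ≤ y) (hcard : x.tubing.card = y.tubing.card + 1) :
    ∃ t u, Removes x y t u := by
  have hlt := lt_of_le_of_card h (by omega)
  rcases Relation.ReflTransGen.cases_head h with rfl | ⟨z, hxz, hzy⟩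
  · omega
  obtain ⟨t, u, hz⟩ := addTube_iff.1 hxz
  have h1 : x.tubing.card = z.tubing.card + 1 := by
    rw [hz.tubing_eq, Finset.card_insert_of_notMem hz.notMem]
  rcases eq_or_card_lt hzy with rfl | h2
  · exact ⟨t, u, hz⟩
  · omega

theorem _root_.Finset.exists_eq_two_of_sum {ι : Type*} {S : Finset ι} {f : ι → ℕ}
    (hf : ∀ i ∈ S, 1 ≤ f i) (hsum : ∑ i ∈ S, f i = S.card + 1) :
    ∃ i ∈ S, f i = 2 ∧ ∀ j ∈ S, j ≠ i → f j = 1 := by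
  classical
  obtain ⟨i, hi, hi2⟩ : ∃ i ∈ S, 1 < f i := by
    by_contra! h
    have := Finset.sum_le_card_nsmul S f 1 h
    rw [hsum, smul_eq_mul, mul_one] at this
    exact this.not_gt (Nat.lt_succ_self _)
  have h1 := Finset.add_sum_erase S f hi
  have h2 := Finset.card_erase_of_mem hi
  have hpos := Finset.card_pos.2 ⟨i, hi⟩
  have h3 : (S.erase i).card ≤ ∑ j ∈ S.erase i, f j := by
    simpa using Finset.card_nsmul_le_sum (S.erase i) f 1
      fun j hj => hf j (Finset.mem_of_mem_erase hj)
  refine ⟨i, hi, by omega, fun j hj hji => ?_⟩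
  have hj' := Finset.mem_erase.2 ⟨hji, hj⟩
  have h4 := Finset.add_sum_erase (S.erase i) f hj'
  have h5 := Finset.card_erase_of_mem hj'
  have h6 : ((S.erase i).erase j).card ≤ ∑ k ∈ (S.erase i).erase j, f k := by
    simpa using Finset.card_nsmul_le_sum ((S.erase i).erase j) f 1
      fun k hk => hf k (Finset.mem_of_mem_erase (Finset.mem_of_mem_erase hk))
  have := hf j hj
  have := Finset.card_pos.2 ⟨j, hj'⟩
  omega

theorem _root_.ColorfulGA.Blocks.IsListing.eq_of_card_inner_le {b : Blocks α} {l l' : List α}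
    (h : b.IsListing l) (h' : b.IsListing l') (hi : b.inner.card ≤ 1) : l = l' := by
  obtain ⟨i, hb, rfl⟩ := h
  obtain ⟨i', hb', rfl⟩ := h'
  have hp : i.Perm i' := Multiset.coe_eq_coe.1 (hb.trans hb'.symm)
  rw [← hb, Multiset.coe_card] at hi
  rcases i with _ | ⟨a, _ | ⟨b, i⟩⟩
  · rw [(List.nil_perm.1 hp)]
  · rw [(List.singleton_perm.1 hp)]
  · simp at hi

/-- An edge is a template with exactly one core of two nodes, all others having one. -/
theorem exists_card_coreNodes_eq_two (e : ColorTemplate G c)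
    (he : e.tubing.card + 2 = Fintype.card V) :
    ∃ u ∈ insert Finset.univ e.tubing, (coreNodes e.tubing u).card = 2 ∧
      ∀ w ∈ insert Finset.univ e.tubing, w ≠ u → (coreNodes e.tubing w).card = 1 := by
  refine Finset.exists_eq_two_of_sum
    (fun t ht => (e.coreNodes_nonempty ht).card_pos) ?_
  rw [e.isTubing.sum_card_coreNodes, Finset.card_insert_of_notMem e.isTubing.univ_notMem]
  omega

theorem Removes.coreNodes_eq (h : Removes x y t u) :
    coreNodes y.tubing u = coreNodes x.tubing u ∪ coreNodes x.tubing t := by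
  have hT := h.tubing_eq ▸ x.isTubing
  rw [hT.coreNodes_parent h.notMem h.parent, ← h.tubing_eq]

theorem Removes.disjoint (h : Removes x y t u) :
    Disjoint (coreNodes x.tubing u) (coreNodes x.tubing t) := by
  rw [h.tubing_eq]
  exact (h.tubing_eq ▸ x.isTubing).disjoint_coreNodes_parent h.parent

theorem Removes.mem_insert (h : Removes x y t u) : u ∈ insert Finset.univ x.tubing := by
  have := h.parent.1
  rw [h.tubing_eq]
  simp only [Finset.mem_insert] at this ⊢
  tauto

/-- Both `t` and `t'` are the component of `q` in `u` without `p`. -/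
theorem Removes.subset_of_coreNodes (hG : G.Connected) {t' : Finset V} {p q : V}
    (h : Removes x y t u) (h' : Removes z y t' u) (hp : coreNodes x.tubing u = {p})
    (hp' : coreNodes z.tubing u = {p}) (hq : q ∈ t) (hq' : q ∈ t') : t' ⊆ t := by
  intro v hv
  have hT := h.tubing_eq ▸ x.isTubing
  have hj : Joined G (t' : Set V) q v :=
    z.isTubing.joined hG (Finset.mem_insert_of_mem h'.mem) hq' hv
  have hj' := Joined.of_closed (K := (t : Set V)) (fun a ha b hb hab => ?_) hj hq
  · exact hj'.mem_right
  · refine hT.adj_mem h.parent ha ⟨h'.parent.2.1.1 hb, fun hb' => ?_⟩ hab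
    rw [← h.tubing_eq, hp, ← hp', Finset.mem_coe] at hb'
    exact (mem_coreNodes.1 hb').2 t' h'.mem h'.parent.2.1 hb

/-- A vertex of an edge is determined by the node that stays in the two-node core. -/
theorem Removes.eq_of_coreNodes (hG : G.Connected) {t' : Finset V} {p : V}
    (h : Removes x y t u) (h' : Removes z y t' u) (hcard : (coreNodes y.tubing u).card = 2)
    (hp : coreNodes x.tubing u = {p}) (hp' : coreNodes z.tubing u = {p}) : x = z := by
  have hcore : coreNodes x.tubing t = coreNodes z.tubing t' := by
    have h1 := Finset.union_sdiff_cancel_left h.disjoint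
    have h2 := Finset.union_sdiff_cancel_left h'.disjoint
    rw [← h.coreNodes_eq, hp] at h1
    rw [← h'.coreNodes_eq, hp'] at h2
    rw [← h1, ← h2]
  obtain ⟨q, hq⟩ := x.coreNodes_nonempty (Finset.mem_insert_of_mem h.mem)
  have hq' := hcore ▸ hq
  obtain rfl : t = t' := Finset.Subset.antisymm
    (h'.subset_of_coreNodes hG h hp' hp (coreNodes_subset hq') (coreNodes_subset hq))
    (h.subset_of_coreNodes hG h' hp hp' (coreNodes_subset hq) (coreNodes_subset hq'))
  have hxz : x.tubing = z.tubing := by rw [h.tubing_eq, h'.tubing_eq]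
  have hinner : (y.blocks u).inner.card ≤ 1 := by
    have := y.card_blocks u h.parent.1
    omega
  obtain ⟨l₁, h₁⟩ := (x.blocks u).exists_isListing
  obtain ⟨l₂, h₂⟩ := (x.blocks t).exists_isListing
  obtain ⟨l₁', h₁'⟩ := (z.blocks u).exists_isListing
  obtain ⟨l₂', h₂'⟩ := (z.blocks t).exists_isListing
  have hl := (h.listing _ _ h₁ h₂).eq_of_card_inner_le (h'.listing _ _ h₁' h₂') hinner
  have e1 := length_listing h.mem_insert h₁
  have e2 := length_listing h'.mem_insert h₁'
  rw [← hxz, ← length_toList_color (color_isSome_congr (by rw [hxz] : u ∈ x.tubing ↔ u ∈ z.tubing)),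
    ← e1] at e2
  obtain ⟨rfl, rfl⟩ := List.append_inj hl (by omega)
  refine ext_listing hxz fun r hr => ?_
  by_cases hru : r = u
  · exact hru ▸ ⟨l₁, h₁, h₁'⟩
  by_cases hrt : r = t
  · exact hrt ▸ ⟨l₂, h₂, h₂'⟩
  obtain ⟨l, hl⟩ := (x.blocks r).exists_isListing
  refine ⟨l, hl, ?_⟩
  rw [h'.blocks_eq r hrt hru, ← h.blocks_eq r hrt hru]
  exact hl

/-- Every edge has at least two vertices. -/
theorem exists_pair_lt (hG : G.Connected) (hc : c.card + 1 = Fintype.card V)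
    (e : ColorTemplate G c) {a b : V} (hab : a ≠ b)
    (hu : u ∈ insert Finset.univ e.tubing) (hab' : coreNodes e.tubing u = {a, b}) :
    ∃ x x', x ≠ x' ∧ x ≤ e ∧ x' ≤ e ∧ x.tubing.card + 1 = Fintype.card V ∧
      x'.tubing.card + 1 = Fintype.card V := by
  obtain ⟨σ, hσ, hA, hblock⟩ := exists_block_order e.isTubing
    (fun w => if w = u then [a, b] else (coreNodes e.tubing w).toList)
    (fun w _ => by
      split_ifs
      · simpa using hab
      · exact Finset.nodup_toList _)
    (fun w _ v => by
      split_ifs with h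
      · rw [h, hab']; simp
      · exact Finset.mem_toList)
  obtain ⟨p, s, hσeq, hp, -⟩ := hblock u hu
  rw [if_pos rfl] at hσeq
  obtain rfl : σ = p ++ a :: b :: s := hσeq
  have ha : home e.tubing a = u := (e.isTubing.mem_coreNodes_iff hu).1 (by simp [hab'])
  have hb : home e.tubing b = u := (e.isTubing.mem_coreNodes_iff hu).1 (by simp [hab'])
  have hA' : Adm G e.tubing (p ++ b :: a :: s) := hA.congr fun v w hvw hB =>
    hB.swap (by rintro ⟨rfl, rfl⟩; exact hvw (ha.trans hb.symm))
  obtain ⟨f, x, hx, hxe⟩ := exists_realizes_le hG hc e hσ hA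
  -- Nodes listed before `a` have homes at least as large as `u` and are not in its core, so all of
  -- `u` is still present when `a` comes up. Hence `a` and `b` are joined then.
  have hmem : ∀ v ∈ u, v ∈ a :: b :: s := by
    intro v hv
    rcases List.mem_append.1 (hσ.mem v) with hvp | hv'
    · have h1 := home_subset hu hv
      have h2 : v ∈ coreNodes e.tubing u :=
        (e.isTubing.mem_coreNodes_iff hu).2 (Finset.eq_of_subset_of_card_le h1 (hp v hvp))
      rw [hab', Finset.mem_insert, Finset.mem_singleton] at h2
      have hd := List.disjoint_of_nodup_append hσ.nodup hvp
      rcases h2 with rfl | rfl <;> simp at hd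
    · exact hv'
  have hau : a ∈ u := coreNodes_subset (T := e.tubing) (by simp [hab'])
  have hbu : b ∈ u := coreNodes_subset (T := e.tubing) (by simp [hab'])
  obtain ⟨x', hx', hx'e, -, hne⟩ := hx.flip hG hσ hxe hA'
    ((e.isTubing.joined hG hu hau hbu).mono hmem)
  exact ⟨x, x', hne, hxe, hx'e, hx.card hG hσ, hx'.card hG hσ.swap⟩

/-- Every edge has exactly two vertices. -/
theorem exists_lt_iff (hG : G.Connected) (hc : c.card + 1 = Fintype.card V)
    (e : ColorTemplate G c) (he : e.tubing.card + 2 = Fintype.card V) :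
    ∃ x x', x ≠ x' ∧ ∀ z, z < e ↔ z = x ∨ z = x' := by
  obtain ⟨u, hu, hcard, hone⟩ := exists_card_coreNodes_eq_two e he
  obtain ⟨a, b, hab, hcore⟩ := Finset.card_eq_two.1 hcard
  have key : ∀ z, z < e → ∃ t, Removes z e t u ∧
      (coreNodes z.tubing u = {a} ∨ coreNodes z.tubing u = {b}) := by
    intro z hz
    have h1 := card_lt_of_lt hz
    have h2 := card_tubing_lt z
    obtain ⟨t, w, h⟩ := exists_removes_of_le hz.le (by omega)
    have h3 := (z.coreNodes_nonempty h.mem_insert).card_pos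
    have h4 := (z.coreNodes_nonempty (Finset.mem_insert_of_mem h.mem)).card_pos
    have h5 := Finset.card_union_of_disjoint h.disjoint
    rw [← h.coreNodes_eq] at h5
    obtain rfl : w = u := by
      by_contra hwu
      have := hone w h.parent.1 hwu
      omega
    obtain ⟨p, hp⟩ := Finset.card_eq_one.1
      (show (coreNodes z.tubing w).card = 1 by omega)
    have hpe : p ∈ coreNodes e.tubing w := by
      rw [h.coreNodes_eq, hp]
      simp
    rw [hcore, Finset.mem_insert, Finset.mem_singleton] at hpe
    refine ⟨t, h, ?_⟩
    rcases hpe with rfl | rfl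
    · exact .inl hp
    · exact .inr hp
  obtain ⟨x, x', hne, hxe, hx'e, hx, hx'⟩ := exists_pair_lt hG hc e hab hu hcore
  have hxlt := lt_of_le_of_card hxe (by omega)
  have hx'lt := lt_of_le_of_card hx'e (by omega)
  refine ⟨x, x', hne, fun z => ⟨fun hz => ?_, ?_⟩⟩
  · obtain ⟨t, ht, h⟩ := key z hz
    obtain ⟨t₁, ht₁, h₁⟩ := key x hxlt
    obtain ⟨t₂, ht₂, h₂⟩ := key x' hx'lt
    -- Each vertex is determined by one of the two nodes; `x` and `x'` use up both, so `z` shares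
    -- its node with one of them.
    rcases h with h | h <;> rcases h₁ with h₁ | h₁ <;> rcases h₂ with h₂ | h₂
    all_goals first
      | exact .inl (ht.eq_of_coreNodes hG ht₁ hcard h h₁)
      | exact .inr (ht.eq_of_coreNodes hG ht₂ hcard h h₂)
      | exact absurd (ht₁.eq_of_coreNodes hG ht₂ hcard h₁ h₂) hne
  · rintro (rfl | rfl)
    · exact hxlt
    · exact hx'lt

end ColorTemplate

end ColorfulGA

namespace ColorfulGA

/-! ### Greatest templates of components. -/

open ColorTemplate

variable {V α : Type*} [Fintype V] [DecidableEq V] {G : SimpleGraph V} {c : Multiset α}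

/-- The template without tubes that is compatible with a given one. -/
noncomputable def topOf (x : ColorTemplate G c) : ColorTemplate G c :=
  Classical.choose (x.exists_ge_of_subset (Finset.empty_subset x.tubing))

theorem le_topOf (x : ColorTemplate G c) : x ≤ topOf x :=
  (Classical.choose_spec (x.exists_ge_of_subset (Finset.empty_subset x.tubing))).1

theorem tubing_topOf (x : ColorTemplate G c) : (topOf x).tubing = ∅ :=
  (Classical.choose_spec (x.exists_ge_of_subset (Finset.empty_subset x.tubing))).2

/-- Thus `topOf` is constant on components, and each component has exactly one tubeless template. -/
theorem topOf_eq_of_le {x y : ColorTemplate G c} (h : x ≤ y) : topOf x = topOf y :=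
  eq_of_le_of_le (le_topOf x) (h.trans (le_topOf y)) (by rw [tubing_topOf, tubing_topOf])

theorem topOf_eq_self {x : ColorTemplate G c} (h : x.tubing = ∅) : topOf x = x :=
  (eq_of_le_of_le le_rfl (le_topOf x) (by rw [h, tubing_topOf])).symm

namespace Component

/-- The template without tubes of a component. -/
noncomputable def top (C : Component G c) : ColorTemplate G c :=
  Quot.lift topOf (fun _ _ => topOf_eq_of_le) C

theorem top_eq {C : Component G c} {x : ColorTemplate G c} (h : Quot.mk _ x = C) :
    C.top = topOf x := by
  subst h
  rfl

theorem mk_eq_of_le {C : Component G c} {x y : ColorTemplate G c} (h : x ≤ y)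
    (hx : Quot.mk _ x = C) : Quot.mk (fun x y : ColorTemplate G c => x ≤ y) y = C :=
  (Quot.sound h).symm.trans hx

theorem mk_eq_of_ge {C : Component G c} {x y : ColorTemplate G c} (h : x ≤ y)
    (hy : Quot.mk _ y = C) : Quot.mk (fun x y : ColorTemplate G c => x ≤ y) x = C :=
  (Quot.sound h).trans hy

theorem mk_top (C : Component G c) : Quot.mk _ C.top = C := by
  obtain ⟨x, rfl⟩ := Quot.exists_rep C
  exact mk_eq_of_le (le_topOf x) rfl

theorem tubing_top (C : Component G c) : C.top.tubing = ∅ := by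
  obtain ⟨x, rfl⟩ := Quot.exists_rep C
  exact tubing_topOf x

theorem isGreatest_top (C : Component G c) :
    IsGreatest Set.univ (⟨C.top, C.mk_top⟩ : C.Templates) := by
  refine ⟨Set.mem_univ _, fun y _ => ?_⟩
  change y.1 ≤ C.top
  rw [top_eq y.2]
  exact le_topOf y.1

/-! ### The polytope axioms for a component. -/

variable {C : Component G c}

/-- The rank of a face, the least face having rank `0`. -/
def rank (C : Component G c) (z : C.FacePoset) : ℕ :=
  z.recBotCoe 0 fun x => Fintype.card V - x.1.tubing.card

theorem rank_bot : C.rank ⊥ = 0 := rfl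

theorem rank_coe (x : C.Templates) : C.rank x = Fintype.card V - x.1.tubing.card := rfl

theorem exists_template_between {x y : C.Templates} (h : x ≤ y) {T : Finset (Finset V)}
    (hy : y.1.tubing ⊆ T) (hx : T ⊆ x.1.tubing) :
    ∃ z : C.Templates, x ≤ z ∧ z ≤ y ∧ z.1.tubing = T := by
  obtain ⟨z, hxz, hzy, hz⟩ := exists_between_of_subset (show x.1 ≤ y.1 from h) hy hx
  exact ⟨⟨z, mk_eq_of_le hxz x.2⟩, hxz, hzy, hz⟩

theorem template_lt_of_card {x y : C.Templates} (h : x ≤ y)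
    (hc : y.1.tubing.card < x.1.tubing.card) : x < y :=
  h.lt_of_ne (by rintro rfl; exact hc.false)

theorem card_lt_of_template_lt {x y : C.Templates} (h : x < y) :
    y.1.tubing.card < x.1.tubing.card :=
  card_lt_of_lt (show x.1 < y.1 from h)

theorem exists_vertex_template_le (hG : G.Connected) (hc : c.card + 1 = Fintype.card V)
    (y : C.Templates) : ∃ x ≤ y, x.1.tubing.card + 1 = Fintype.card V := by
  obtain ⟨x, hxy, hx⟩ := exists_vertex_le hG hc y.1
  exact ⟨⟨x, mk_eq_of_ge hxy y.2⟩, hxy, hx⟩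

theorem exists_template_card {x y : C.Templates} (h : x ≤ y) {m : ℕ}
    (hy : y.1.tubing.card ≤ m) (hx : m ≤ x.1.tubing.card) :
    ∃ z : C.Templates, x ≤ z ∧ z ≤ y ∧ z.1.tubing.card = m := by
  obtain ⟨T, h1, h2, rfl⟩ := Finset.exists_subsuperset_card_eq
    (tubing_subset_of_le (show x.1 ≤ y.1 from h)) hy hx
  obtain ⟨z, hxz, hzy, rfl⟩ := exists_template_between h h1 h2
  exact ⟨z, hxz, hzy, rfl⟩

theorem isRanking (hG : G.Connected) (hc : c.card + 1 = Fintype.card V) (C : Component G c) :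
    IsRanking C.rank (Fintype.card V) where
  strictMono := by
    intro a b hab
    induction b using WithBot.recBotCoe with
    | bot => exact absurd hab not_lt_bot
    | coe y =>
      have := card_tubing_lt y.1
      induction a using WithBot.recBotCoe with
      | bot =>
        rw [rank_bot, rank_coe]
        omega
      | coe x =>
        have := card_lt_of_template_lt (WithBot.coe_lt_coe.1 hab)
        have := card_tubing_lt x.1
        rw [rank_coe, rank_coe]
        omega
  exists_least := ⟨⊥, ⟨Set.mem_univ _, fun _ _ => bot_le⟩, rfl⟩
  exists_greatest := by
    refine ⟨((⟨C.top, C.mk_top⟩ : C.Templates) : C.FacePoset), ⟨Set.mem_univ _, fun z _ => ?_⟩, ?_⟩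
    · induction z using WithBot.recBotCoe with
      | bot => exact bot_le
      | coe x => exact WithBot.coe_le_coe.2 (C.isGreatest_top.2 (Set.mem_univ x))
    · rw [rank_coe, tubing_top]
      simp
  exists_between := by
    intro a b hab m ham hmb
    induction b using WithBot.recBotCoe with
    | bot => exact absurd hab not_lt_bot
    | coe y =>
      rw [rank_coe] at hmb
      -- Above a template the tubing can be thinned out to any size; if `a` is the least face, a
      -- vertex below `y` is used instead.
      obtain ⟨x, hxy, hax, hx⟩ : ∃ x ≤ y, a ≤ (x : C.FacePoset) ∧
          Fintype.card V < x.1.tubing.card + m + 1 := by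
        induction a using WithBot.recBotCoe with
        | bot =>
          obtain ⟨x, hxy, hx⟩ := exists_vertex_template_le hG hc y
          rw [rank_bot] at ham
          exact ⟨x, hxy, bot_le, by omega⟩
        | coe x =>
          rw [rank_coe] at ham
          exact ⟨x, WithBot.coe_le_coe.1 hab.le, le_rfl, by omega⟩
      obtain ⟨z, hxz, hzy, hz⟩ := exists_template_card hxy (m := Fintype.card V - m)
        (by omega) (by omega)
      have hzm : C.rank z = m := by
        rw [rank_coe]
        omega
      refine ⟨z, ?_, WithBot.coe_lt_coe.2 (template_lt_of_card hzy (by omega)), hzm⟩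
      refine (hax.trans (WithBot.coe_le_coe.2 hxz)).lt_of_ne ?_
      rintro rfl
      omega

/-- With a tube `t` missing in `a` and a tube `s` missing in `b`, there is a zigzag `a ≥ a' ≤ d ≥ b'
≤ b`, where `d` lacks only `s` and `t`. The gap of three keeps `d` strictly below `y`. -/
theorem sectionConnected_coe {x y : C.Templates} (h : y.1.tubing.card + 3 ≤ x.1.tubing.card) :
    SectionConnected (x : C.FacePoset) y := by
  intro a ha b hb
  induction a using WithBot.recBotCoe with
  | bot => exact absurd ha.1 not_lt_bot
  | coe a =>
  induction b using WithBot.recBotCoe with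
  | bot => exact absurd hb.1 not_lt_bot
  | coe b =>
  have hxa := WithBot.coe_lt_coe.1 ha.1
  have hay := WithBot.coe_lt_coe.1 ha.2
  have hxb := WithBot.coe_lt_coe.1 hb.1
  have hby := WithBot.coe_lt_coe.1 hb.2
  obtain ⟨t, ht, hta⟩ := Finset.exists_mem_notMem_of_card_lt_card (card_lt_of_template_lt hxa)
  obtain ⟨s, hs, hsb⟩ := Finset.exists_mem_notMem_of_card_lt_card (card_lt_of_template_lt hxb)
  have ht1 := Finset.card_erase_of_mem ht
  have hs1 := Finset.card_erase_of_mem hs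
  have hts := Finset.pred_card_le_card_erase (s := x.1.tubing.erase t) (a := s)
  have hya := tubing_subset_of_le (show a.1 ≤ y.1 from hay.le)
  have hyb := tubing_subset_of_le (show b.1 ≤ y.1 from hby.le)
  obtain ⟨a', hxa', haa', ha'⟩ := exists_template_between hxa.le
    (Finset.subset_erase.2 ⟨tubing_subset_of_le (show x.1 ≤ a.1 from hxa.le), hta⟩)
    (Finset.erase_subset t x.1.tubing)
  obtain ⟨b', hxb', hbb', hb'⟩ := exists_template_between hxb.le
    (Finset.subset_erase.2 ⟨tubing_subset_of_le (show x.1 ≤ b.1 from hxb.le), hsb⟩)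
    (Finset.erase_subset s x.1.tubing)
  have hsub : y.1.tubing ⊆ (x.1.tubing.erase t).erase s :=
    Finset.subset_erase.2 ⟨Finset.subset_erase.2
      ⟨tubing_subset_of_le (show x.1 ≤ y.1 from (hxa.trans hay).le), fun h => hta (hya h)⟩,
      fun h => hsb (hyb h)⟩
  obtain ⟨d, had, hdy, hd⟩ := exists_template_between (haa'.trans hay.le) hsub
    (by rw [ha']; exact Finset.erase_subset _ _)
  have hbd : b' ≤ d := le_of_le_of_subset (x := x.1) hxb' (hxa'.trans had) (by
    rw [hd, hb', Finset.erase_right_comm]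
    exact Finset.erase_subset _ _)
  have mem : ∀ z : C.Templates, x ≤ z → z ≤ y → y.1.tubing.card < z.1.tubing.card →
      z.1.tubing.card < x.1.tubing.card → (z : C.FacePoset) ∈ Set.Ioo (x : C.FacePoset) y :=
    fun z h1 h2 h3 h4 => ⟨WithBot.coe_lt_coe.2 (template_lt_of_card h1 h4),
      WithBot.coe_lt_coe.2 (template_lt_of_card h2 h3)⟩
  rw [← ha'] at ht1
  rw [← hb'] at hs1
  rw [← hd, ← ha'] at hts
  have hda := Finset.card_le_card (tubing_subset_of_le (show a'.1 ≤ d.1 from had))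
  have hpos := Finset.card_pos.2 ⟨t, ht⟩
  refine .head (b := (a' : C.FacePoset)) ⟨mem a' hxa' (haa'.trans hay.le) (by omega) (by omega),
    .inr (WithBot.coe_le_coe.2 haa')⟩ ?_
  refine .head (b := (d : C.FacePoset)) ⟨mem d (hxa'.trans had) hdy (by omega) (by omega),
    .inl (WithBot.coe_le_coe.2 had)⟩ ?_
  refine .head (b := (b' : C.FacePoset)) ⟨mem b' hxb' (hbb'.trans hby.le) (by omega) (by omega),
    .inr (WithBot.coe_le_coe.2 hbd)⟩ ?_
  exact .single ⟨hb, .inl (WithBot.coe_le_coe.2 hbb')⟩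

/-- Every template has a vertex below it, and vertices are joined by flips. The edges used have more
tubes than `y`, so they lie strictly below it. -/
theorem sectionConnected_bot (hG : G.Connected) (hc : c.card + 1 = Fintype.card V)
    {y : C.Templates} (h : y.1.tubing.card + 3 ≤ Fintype.card V) :
    SectionConnected (⊥ : C.FacePoset) y := by
  intro a ha b hb
  induction a using WithBot.recBotCoe with
  | bot => exact absurd ha.1 not_lt_bot
  | coe a =>
  induction b using WithBot.recBotCoe with
  | bot => exact absurd hb.1 not_lt_bot
  | coe b =>
  have hay := WithBot.coe_lt_coe.1 ha.2
  have hby := WithBot.coe_lt_coe.1 hb.2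
  obtain ⟨v, hva, hv⟩ := exists_vertex_template_le hG hc a
  obtain ⟨w, hwb, hw⟩ := exists_vertex_template_le hG hc b
  have mem : ∀ z : C.Templates, z < y → (z : C.FacePoset) ∈ Set.Ioo (⊥ : C.FacePoset) y :=
    fun z h => ⟨WithBot.bot_lt_coe z, WithBot.coe_lt_coe.2 h⟩
  refine .head (b := (v : C.FacePoset)) ⟨mem v (hva.trans_lt hay), .inr (WithBot.coe_le_coe.2 hva)⟩ ?_
  refine .tail (b := (w : C.FacePoset)) ?_ ⟨hb, .inl (WithBot.coe_le_coe.2 hwb)⟩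
  have path := reflTransGen_flip_of_le hG hv hw (hva.trans hay.le) (hwb.trans hby.le)
  have key : ∀ u, Relation.ReflTransGen (Flip y.1) v.1 u → ∃ hu : Quot.mk _ u = C,
      Relation.ReflTransGen (fun a b : C.FacePoset =>
        b ∈ Set.Ioo (⊥ : C.FacePoset) y ∧ (a ≤ b ∨ b ≤ a)) v (⟨u, hu⟩ : C.Templates) := by
    intro u hu
    induction hu with
    | refl => exact ⟨v.2, .refl⟩
    | @tail u u' _ huu' ih =>
      obtain ⟨e, hue, hue', hey, he⟩ := huu'
      obtain ⟨hu, ih⟩ := ih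
      have he' := mk_eq_of_le hue hu
      have hey' : (⟨e, he'⟩ : C.Templates) < y :=
        template_lt_of_card hey (show y.1.tubing.card < e.tubing.card by omega)
      refine ⟨mk_eq_of_ge hue' he', ?_⟩
      refine (ih.tail (b := _) (c := ((⟨e, he'⟩ : C.Templates) : C.FacePoset))
        ⟨mem _ hey', .inl (WithBot.coe_le_coe.2 hue)⟩).tail
        ⟨mem _ (lt_of_le_of_lt (show (⟨u', _⟩ : C.Templates) ≤ ⟨e, he'⟩ from hue') hey'),
          .inr (WithBot.coe_le_coe.2 hue')⟩
  exact (key w.1 path).2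

theorem sectionConnected (hG : G.Connected) (hc : c.card + 1 = Fintype.card V)
    {f h : C.FacePoset} (hfh : C.rank f + 3 ≤ C.rank h) : SectionConnected f h := by
  induction h using WithBot.recBotCoe with
  | bot => simp [rank_bot] at hfh
  | coe y =>
  rw [rank_coe] at hfh
  induction f using WithBot.recBotCoe with
  | bot => exact sectionConnected_bot hG hc (by rw [rank_bot] at hfh; omega)
  | coe x =>
    have := card_tubing_lt x.1
    exact sectionConnected_coe (by rw [rank_coe] at hfh; omega)

theorem ncard_Ioo (hG : G.Connected) (hc : c.card + 1 = Fintype.card V) {f h : C.FacePoset}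
    (hlt : f < h) (hfh : C.rank h = C.rank f + 2) : (Set.Ioo f h).ncard = 2 := by
  induction h using WithBot.recBotCoe with
  | bot => simp [rank_bot] at hfh
  | coe y =>
  rw [rank_coe] at hfh
  induction f using WithBot.recBotCoe with
  | bot =>
    rw [rank_bot] at hfh
    obtain ⟨a, b, hab, hz⟩ := exists_lt_iff hG hc y.1 (by omega)
    have ha := (hz a).2 (.inl rfl)
    have hb := (hz b).2 (.inr rfl)
    refine Set.ncard_eq_two.2 ⟨((⟨a, mk_eq_of_ge ha.le y.2⟩ : C.Templates) : C.FacePoset),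
      ((⟨b, mk_eq_of_ge hb.le y.2⟩ : C.Templates) : C.FacePoset),
      fun h => hab (congrArg Subtype.val (WithBot.coe_injective h)), ?_⟩
    ext z
    induction z using WithBot.recBotCoe with
    | bot => simp
    | coe z =>
      simp only [Set.mem_Ioo, WithBot.bot_lt_coe, true_and, WithBot.coe_lt_coe,
        Set.mem_insert_iff, WithBot.coe_inj, Set.mem_singleton_iff, Subtype.ext_iff]
      exact hz z.1
  | coe x =>
    have := card_tubing_lt x.1
    rw [rank_coe] at hfh
    have hxy : x.1 ≤ y.1 := (WithBot.coe_lt_coe.1 hlt).le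
    obtain ⟨a, b, hab, hz⟩ := exists_lt_lt_iff hxy (by omega)
    have ha := (hz a).2 (.inl rfl)
    have hb := (hz b).2 (.inr rfl)
    refine Set.ncard_eq_two.2 ⟨((⟨a, mk_eq_of_ge ha.2.le y.2⟩ : C.Templates) : C.FacePoset),
      ((⟨b, mk_eq_of_ge hb.2.le y.2⟩ : C.Templates) : C.FacePoset),
      fun h => hab (congrArg Subtype.val (WithBot.coe_injective h)), ?_⟩
    ext z
    induction z using WithBot.recBotCoe with
    | bot => simp
    | coe z =>
      simp only [Set.mem_Ioo, WithBot.coe_lt_coe,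
        Set.mem_insert_iff, WithBot.coe_inj, Set.mem_singleton_iff, Subtype.ext_iff]
      exact hz z.1

/-- The faces above a vertex correspond to the sets of tubes that are removed from it. -/
theorem exists_orderIso {v : C.Templates} {m : ℕ} (hv : v.1.tubing.card = m) :
    Nonempty (Set.Ici (v : C.FacePoset) ≃o Finset (Fin m)) := by
  have hlift : ∀ z : Set.Ici (v : C.FacePoset), ∃ w : C.Templates, z.1 = w ∧ v ≤ w := by
    rintro ⟨z, hz⟩
    induction z using WithBot.recBotCoe with
    | bot => exact absurd (show (v : C.FacePoset) = ⊥ from le_bot_iff.1 hz) WithBot.coe_ne_bot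
    | coe w => exact ⟨w, rfl, WithBot.coe_le_coe.1 hz⟩
  choose w hw hvw using hlift
  let g := v.1.tubing.equivFinOfCardEq hv
  let φ : Set.Ici (v : C.FacePoset) → Finset (Fin m) :=
    fun z => Finset.univ.filter fun i => (g.symm i).1 ∉ (w z).1.tubing
  have hφ : ∀ a b, φ a ≤ φ b ↔ a ≤ b := by
    intro a b
    have e : a ≤ b ↔ w a ≤ w b := by
      rw [← Subtype.coe_le_coe, hw a, hw b, WithBot.coe_le_coe]
    rw [e]
    constructor
    · intro h
      refine le_of_le_of_subset (x := v.1) (hvw a) (hvw b) fun t ht => ?_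
      have htv := tubing_subset_of_le (show v.1 ≤ (w b).1 from hvw b) ht
      by_contra hta
      have h1 : g ⟨t, htv⟩ ∈ φ a := by simpa [φ] using hta
      have h2 := h h1
      simp only [φ, Finset.mem_filter, Equiv.symm_apply_apply] at h2
      exact h2.2 ht
    · intro h i hi
      simp only [φ, Finset.mem_filter, Finset.mem_univ, true_and] at hi ⊢
      exact fun h' => hi (tubing_subset_of_le (show (w a).1 ≤ (w b).1 from h) h')
  refine ⟨RelIso.ofSurjective (OrderEmbedding.ofMapLEIff φ hφ) fun S => ?_⟩
  obtain ⟨z, hvz, hz⟩ := v.1.exists_ge_of_subset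
    (T := v.1.tubing.filter fun t => ∀ h : t ∈ v.1.tubing, g ⟨t, h⟩ ∉ S)
    (Finset.filter_subset _ _)
  let z' : C.Templates := ⟨z, mk_eq_of_le hvz v.2⟩
  have hz' : (v : C.FacePoset) ≤ (z' : C.FacePoset) := WithBot.coe_le_coe.2 hvz
  refine ⟨⟨z', hz'⟩, ?_⟩
  change φ ⟨z', hz'⟩ = S
  have hwz : w ⟨z', hz'⟩ = z' := (WithBot.coe_injective (hw ⟨z', hz'⟩)).symm
  ext i
  simp only [φ, Finset.mem_filter, Finset.mem_univ, true_and, hwz, z', hz]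
  simp

theorem isSimpleAbstractPolytope (hG : G.Connected) (hc : c.card + 1 = Fintype.card V)
    (C : Component G c) : IsSimpleAbstractPolytope C.FacePoset (Fintype.card V - 1) where
  exists_least := ⟨⊥, Set.mem_univ _, fun _ _ => bot_le⟩
  exists_greatest := by
    obtain ⟨b, hb, -⟩ := (isRanking hG hc C).exists_greatest
    exact ⟨b, hb⟩
  card_flag Φ := by
    -- With the number of nodes written as `c.card + 1`, the truncated `n - 1` is `c.card`.
    rw [(isRanking hG hc C).encard, ← hc]
    rfl
  stronglyFlagConnected := (isRanking hG hc C).stronglyFlagConnected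
    fun f h _ hfh => sectionConnected hG hc hfh
  diamond f h hlt hfh := by
    rw [(isRanking hG hc C).height_eq, (isRanking hG hc C).height_eq] at hfh
    exact ncard_Ioo hG hc hlt (by exact_mod_cast hfh)
  vertexFigure v hv := by
    rw [(isRanking hG hc C).height_eq] at hv
    have hv' : C.rank v = 1 := by exact_mod_cast hv
    induction v using WithBot.recBotCoe with
    | bot => simp [rank_bot] at hv'
    | coe v =>
      rw [rank_coe] at hv'
      exact exists_orderIso (by omega)

end Component

end ColorfulGA

namespace ColorfulGA

/-! ### Components and lists of outer colors. -/

open ColorTemplate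

variable {V α : Type*} [Fintype V] [DecidableEq V] {G : SimpleGraph V} {c : Multiset α}

theorem coreNodes_empty_univ : coreNodes (∅ : Finset (Finset V)) Finset.univ = Finset.univ := by
  ext v
  simp [mem_coreNodes]

namespace ColorTemplate

variable {x y : ColorTemplate G c}

theorem length_outer_of_tubing_eq_empty (h : x.tubing = ∅) :
    (x.blocks Finset.univ).outer.length = connectivity G - 1 := by
  rw [x.outer_length_eq (Finset.mem_insert_self _ _), h, coreNodes_empty_univ,
    connectivity_eq_sep_univ]

theorem color_univ (x : ColorTemplate G c) : (x.blocks Finset.univ).color = none := by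
  rw [← Option.not_isSome_iff_eq_none, x.color_isSome]
  exact x.isTubing.univ_notMem

theorem outer_add_inner_of_tubing_eq_empty (h : x.tubing = ∅) :
    ((x.blocks Finset.univ).outer : Multiset α) + (x.blocks Finset.univ).inner = c := by
  have hs := x.sum_colors
  rw [h] at hs
  simpa [Blocks.colors, x.color_univ] using hs

/-- The inner block is what the outer colors leave of the palette. -/
theorem eq_of_outer_eq (hx : x.tubing = ∅) (hy : y.tubing = ∅)
    (h : (x.blocks Finset.univ).outer = (y.blocks Finset.univ).outer) : x = y := by
  have hx' := (outer_add_inner_of_tubing_eq_empty hx).trans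
    (outer_add_inner_of_tubing_eq_empty hy).symm
  rw [h] at hx'
  ext1
  · rw [hx, hy]
  · funext t
    by_cases ht : t = Finset.univ
    · subst ht
      ext1
      · rw [x.color_univ, y.color_univ]
      · exact h
      · exact add_left_cancel hx'
    · rw [x.blocks_eq_empty t (by simpa [hx] using ht), y.blocks_eq_empty t (by simpa [hy] using ht)]

theorem exists_outer_eq (hc : c.card + 1 = Fintype.card V) {l : List α}
    (hl : l.length = connectivity G - 1) (hlc : (l : Multiset α) ≤ c) :
    ∃ x : ColorTemplate G c, x.tubing = ∅ ∧ (x.blocks Finset.univ).outer = l := by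
  obtain ⟨r, rfl⟩ := Multiset.le_iff_exists_add.1 hlc
  obtain ⟨x, hx, hW⟩ := exists_of_words (G := G) (c := (l : Multiset α) + r) (T := ∅)
    ⟨by simp, by simp⟩ (fun _ => l ++ r.toList) (by simp) (by simp)
    (by rw [coreNodes_empty_univ, Finset.card_univ, ← hc]; simp)
    (by simp [← Multiset.coe_add])
  obtain ⟨i, -, hi⟩ := hW Finset.univ (Finset.mem_insert_self _ _)
  rw [x.color_univ] at hi
  exact ⟨x, hx, (List.append_inj hi (by
    simp [hl, length_outer_of_tubing_eq_empty hx])).1.symm⟩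

end ColorTemplate

/-- The components correspond to the colorings of the outer blocks of their greatest templates. -/
noncomputable def componentEquiv (hc : c.card + 1 = Fintype.card V) : Component G c ≃
    {l : List α // l.length = connectivity G - 1 ∧ (l : Multiset α) ≤ c} :=
  Equiv.ofBijective (fun C => ⟨(C.top.blocks Finset.univ).outer,
    length_outer_of_tubing_eq_empty C.tubing_top,
    (Multiset.le_add_right _ _).trans (outer_add_inner_of_tubing_eq_empty C.tubing_top).le⟩) <| by
    refine ⟨fun C C' h => ?_, fun l => ?_⟩
    · rw [← C.mk_top, ← C'.mk_top,
        eq_of_outer_eq C.tubing_top C'.tubing_top (congrArg Subtype.val h)]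
    · obtain ⟨x, hx, hxl⟩ := exists_outer_eq (G := G) hc l.2.1 l.2.2
      refine ⟨Quot.mk _ x, Subtype.ext ?_⟩
      dsimp only
      rw [Component.top_eq rfl, topOf_eq_self hx, hxl]

end ColorfulGA

theorem theorem4p2 {V α : Type*} [Fintype V] [DecidableEq V] (G : SimpleGraph V)
    (hG : G.Connected) (c : Multiset α) (hc : c.card + 1 = Fintype.card V)
    (n k : ℕ) (hn : Fintype.card V = n) (hk : ColorfulGA.connectivity G = k) :
    (∀ C : ColorfulGA.Component G c,
      ColorfulGA.IsSimpleAbstractPolytope C.FacePoset (n - 1)) ∧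
    ∃ e : ColorfulGA.Component G c ≃ {l : List α // l.length = k - 1 ∧ (l : Multiset α) ≤ c},
      ∀ C : ColorfulGA.Component G c, ∃ x : C.Templates,
        IsGreatest Set.univ x ∧ x.1.tubing = ∅ ∧
          (x.1.blocks Finset.univ).outer = (e C : List α) := by
  subst hn hk
  exact ⟨fun C => C.isSimpleAbstractPolytope hG hc, ColorfulGA.componentEquiv hc,
    fun C => ⟨⟨C.top, C.mk_top⟩, C.isGreatest_top, C.tubing_top, rfl⟩⟩
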